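/- **Setting.** Let $a,b,c\ge 1$ be integers and $n=a+b+c$. Consider the $n\times n$ square grid with vertex set $\{1,\dots,n\}^2$, its internal edges, and its $4n$ external edges (one at each boundary vertex for each side of the square it lies on), cyclically ordered along the boundary. A *fully packed loop (FPL) configuration* is a set of occupied edges such that every vertex lies on exactly two occupied edges and every other one of the $4n$ external edges is occupied (closed loops are allowed). Let $A,B,C$ be three external edges such that, if every other external edge is occupied and $A,B,C$ are not, there are $a+b$ occupied external edges between $A$ and $B$, $b+c$ between $B$ and $C$, and $c+a$ between $C$ and $A$. An FPL configuration is *of type $(A,B,C)$* if $A,B,C$ are unoccupied and its paths connect, for $i=1,\dots,a$, the $i$-th occupied external edge on one side of $A$ with the $i$-th one on the other side, and likewise for $B$ with $i=1,\dots,b$ and for $C$ with $i=1,\dots,c$ (three sets of $a,b,c$ nested arches centred at $A,B,C$). A plane partition in an $a\times b\times c$ box is an array $(\pi_{ij})_{1\le i\le a,\,1\le j\le b}$ of integers $0\le \pi_{ij}\le c$, weakly decreasing in $i$ and in $j$. **Theorem.** (1) There is a bijection between the FPL configurations of type $(A,B,C)$ and the plane partitions in an $a\times b\times c$ box. (2)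 The bijection is explicit, as follows. For an external edge $X$ let its *cone* be the closed region between the two diagonals (lines of slope $\pm1$) that start at the innermost endpoint of $X$ and point into the grid; an external edge is said to lie in a cone if its innermost endpoint does. Exactly one of $A,B,C$ has a cone that contains the other two. Relabel and rotate so that it is $C$, $C$ is on the bottom side, and $C,B,A$ follow one another counterclockwise. Write $X=(x_X,y_X)$ for the innermost endpoint of the edge $X$, $\sigma_X=x_X+y_X$ and $\delta_X=x_X-y_X$. Let $P'$ be the part of the square $[1,n]^2$ given by $\sigma_C\le x+y\le\sigma_B$ and $\delta_A\le x-y\le\delta_C$, without the points that satisfy both $x+y<\sigma_A$ and $x-y>\delta_B$. Let the dominos be the $1\times2$ and $2\times1$ rectangles, made of two unit squares of the grid, all of whose six vertices lie in $P'$, and whose middle edge (the common side of the two squares) is - an edge from $(x,y)$ to $(x+1,y)$ with $x+y<\sigma_A$ and $x+y-\sigma_C$ odd, or - an edge from $(x,y)$ to $(x,y+1)$ with $x+y\ge\sigma_A$, $x-y\le\delta_B$ and $x+y-\sigma_C$ odd, or - an edge from $(x,y)$ to $(x+1,y)$ with $x-y\ge\delta_B$ and $x+y-\sigma_C$ even.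 The graph formed by the borders of the dominos (each border being a cycle of six edges, without the middle edge) is isomorphic, by an isomorphism $\psi$ that takes the dominos exactly to the elementary hexagons, to the part of the hexagonal lattice dual to the hexagon with sides $a,b,c,a,b,c$ of the triangular lattice. Keeping from an FPL configuration of type $(A,B,C)$ exactly its edges on the borders of the dominos, and applying $\psi$, is a bijection onto the dimer configurations (perfect matchings) of this graph, i.e. the lozenge tilings of the $(a,b,c)$ hexagon; and these are in bijection with the plane partitions in the $a\times b\times c$ box, a plane partition being represented by the lozenge tiling formed by the visible faces of the corresponding pile of unit cubes (and of the walls of the box), seen along the direction $(1,1,1)$. (3) Consequently the number of FPL configurations of type $(A,B,C)$ is given by MacMahon's formula $$\prod_{i=1}^{a}\prod_{j=1}^{b}\prod_{k=1}^{c}\frac{i+j+k-1}{i+j+k-2}.$$ -/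

import Mathlib

namespace FullyPackedLoops

/-! ### The square grid with its `4n` external edges -/

/-- The vertices of the `n × n` grid are the points of `ℤ × ℤ` with both coordinates
between `1` and `n`. -/
def InGrid (n : ℕ) (p : ℤ × ℤ) : Prop :=
  1 ≤ p.1 ∧ p.1 ≤ n ∧ 1 ≤ p.2 ∧ p.2 ≤ n

/-- Neighbours in the square lattice. -/
def LatticeAdj (p q : ℤ × ℤ) : Prop :=
  |p.1 - q.1| + |p.2 - q.2| = 1

/-- The external edges are numbered counterclockwise by integers modulo `4n`: the bottom side
from left to right gets `0, …, n - 1`, the right side from bottom to top `n, …, 2n - 1`, then the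
top side from right to left, then the left side from top to bottom.
`side n k ∈ {0, 1, 2, 3}` is the side (bottom, right, top, left) of the external edge `k`. -/
def side (n : ℕ) (k : ℤ) : ℕ := ((k / (n : ℤ)) % 4).toNat

/-- The outermost endpoint (outside the grid) of the external edge number `k`. -/
def outer (n : ℕ) (k : ℤ) : ℤ × ℤ :=
  if side n k = 0 then (k % n + 1, 0)
  else if side n k = 1 then (n + 1, k % n + 1)
  else if side n k = 2 then (n - k % n, n + 1)
  else (0, n - k % n)

/-- The innermost endpoint (a vertex of the grid) of the external edge number `k`. -/
def inner (n : ℕ) (k : ℤ) : ℤ × ℤ :=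
  if side n k = 0 then (k % n + 1, 1)
  else if side n k = 1 then (n, k % n + 1)
  else if side n k = 2 then (n - k % n, n)
  else (1, n - k % n)

/-- The counterclockwise quarter turn of the grid; it sends the external edge `k` to `k + n`. -/
def rot (n : ℕ) (p : ℤ × ℤ) : ℤ × ℤ := (n + 1 - p.2, p.1)

/-! ### Fully packed loops of type `(A, B, C)` -/

/-- A fully packed loop configuration on the `n × n` grid, given by the graph of its occupied
edges: every edge is an internal or external edge of the grid, each vertex of the grid lies on
exactly two occupied edges (so that the configuration is a disjoint union of paths, possibly
closed, visiting each vertex exactly once), and every other external edge is occupied. -/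
def IsFPL (n : ℕ) (G : SimpleGraph (ℤ × ℤ)) : Prop :=
  (∀ p q, G.Adj p q → LatticeAdj p q ∧ (InGrid n p ∨ InGrid n q)) ∧
  (∀ p, InGrid n p → (G.neighborSet p).ncard = 2) ∧
  ((∀ k : ℤ, G.Adj (outer n k) (inner n k) ↔ Even k) ∨
    (∀ k : ℤ, G.Adj (outer n k) (inner n k) ↔ Odd k))

/-- The external edge `X` is unoccupied and is the centre of a bundle of `m` nested arches: for
`i = 1, …, m`, the `i`-th occupied external edge on one side of `X` is connected by a path of the
configuration to the `i`-th occupied external edge on the other side of `X`. -/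
def IsBundle (n : ℕ) (G : SimpleGraph (ℤ × ℤ)) (X : ℤ) (m : ℕ) : Prop :=
  ¬ G.Adj (outer n X) (inner n X) ∧
  ∀ i : ℕ, 1 ≤ i → i ≤ m →
    G.Reachable (outer n (X + (2 * i - 1))) (outer n (X - (2 * i - 1)))

/-- FPL configurations of type `(A, B, C)`, whose link pattern consists of three bundles of
`a`, `b`, `c` nested arches centred at the external edges `A`, `B`, `C`. -/
def FPLOfType (n : ℕ) (A B C : ℤ) (a b c : ℕ) : Type :=
  {G : SimpleGraph (ℤ × ℤ) //
    IsFPL n G ∧ IsBundle n G A a ∧ IsBundle n G B b ∧ IsBundle n G C c}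

/-- `A`, `B`, `C` follow one another counterclockwise along the boundary, with `2 (a + b)` steps
from `A` to `B` and `2 (b + c)` steps from `B` to `C` (hence, if `a + b + c = n`, with `2 (c + a)`
steps from `C` to `A`). As every other external edge is occupied and `A`, `B`, `C` are not, there
are `a + b` occupied external edges between `A` and `B`, and so on. -/
def CounterclockwiseCentres (n : ℕ) (A B C : ℤ) (a b c : ℕ) : Prop :=
  B ≡ A + 2 * (a + b) [ZMOD 4 * n] ∧ C ≡ B + 2 * (b + c) [ZMOD 4 * n]

/-- `A`, `B`, `C`, met in this order in one of the two senses of rotation, are the centres of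
three bundles of `a`, `b`, `c` arches. -/
def AreCentres (n : ℕ) (A B C : ℤ) (a b c : ℕ) : Prop :=
  CounterclockwiseCentres n A B C a b c ∨ CounterclockwiseCentres n C B A c b a

/-! ### Plane partitions and the `(a, b, c)` hexagon -/

/-- Plane partitions in an `a × b × c` box. -/
def PlanePartition (a b c : ℕ) : Type :=
  {π : Fin a → Fin b → ℕ //
    (∀ i j, π i j ≤ c) ∧ ∀ i i' j j', i ≤ i' → j ≤ j' → π i' j' ≤ π i j}

/-- The unit triangles of the hexagon with sides `a, b, c, a, b, c` in the triangular lattice.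
In each of the three lattice directions the hexagon is cut into parallel strips (there are
`b + c`, `c + a` and `a + b` of them); a triangle is given by the three strips containing it.
The two values of the sum distinguish the two orientations of the triangles. -/
def HexVertex (a b c : ℕ) : Type :=
  {v : ℤ × ℤ × ℤ //
    (0 ≤ v.1 ∧ v.1 < b + c) ∧ (0 ≤ v.2.1 ∧ v.2.1 < c + a) ∧ (0 ≤ v.2.2 ∧ v.2.2 < a + b) ∧
    (v.1 + v.2.1 + v.2.2 = a + b + c - 2 ∨ v.1 + v.2.1 + v.2.2 = a + b + c - 1)}

/-- `v` is obtained from `u` by adding a unit vector. -/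
def UnitStep (u v : ℤ × ℤ × ℤ) : Prop :=
  v = u + (1, 0, 0) ∨ v = u + (0, 1, 0) ∨ v = u + (0, 0, 1)

/-- The part of the hexagonal lattice inside the `(a, b, c)` hexagon: its vertices are the unit
triangles, its edges the pairs of triangles with a common side, i.e. the lozenges. -/
def hexGraph (a b c : ℕ) : SimpleGraph (HexVertex a b c) where
  Adj u v := UnitStep u.1 v.1 ∨ UnitStep v.1 u.1
  symm := ⟨fun _ _ h => h.symm⟩
  loopless := ⟨fun u h => by
    have h' : UnitStep u.1 u.1 := h.elim id id
    rcases h' with h' | h' | h' <;> simp at h'⟩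

/-- The set of the six vertices around an elementary hexagon of the hexagonal lattice, lying
entirely in the `(a, b, c)` hexagon. -/
def IsHexFace (a b c : ℕ) (S : Set (HexVertex a b c)) : Prop :=
  ∃ p q r : ℤ, (0 ≤ p ∧ p + 1 < b + c) ∧ (0 ≤ q ∧ q + 1 < c + a) ∧ (0 ≤ r ∧ r + 1 < a + b) ∧
    p + q + r = a + b + c - 3 ∧
    S = {v | (v.1.1 = p ∨ v.1.1 = p + 1) ∧ (v.1.2.1 = q ∨ v.1.2.1 = q + 1) ∧
      (v.1.2.2 = r ∨ v.1.2.2 = r + 1)}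

/-- The dimer configurations on the hexagonal graph (equivalently, the lozenge tilings of the
`(a, b, c)` hexagon). -/
def HexDimer (a b c : ℕ) : Type :=
  {M : (hexGraph a b c).Subgraph // M.IsPerfectMatching}

/-- The lozenges of the picture of a plane partition: seen along the direction `(1, 1, 1)`, the
visible unit squares of the pile of cubes (and of the three walls of the box behind it).
They are the square with corner `(i, j, h)` and normal `(0, 0, 1)`, where `h = π i j`;
the square with corner `(t, j, k)` and normal `(1, 0, 0)`, where `t` is the number of cubes
of the pile in the row `(·, j, k)`; and the square with corner `(i, t, k)` and normal `(0, 1, 0)`,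
where `t` is the number of cubes in the row `(i, ·, k)`.
The strips containing a point `(x, y, z)` are the integer parts of
`y - z + c`, `z - x + a`, `x - y + b`. -/
def LozengeOf {a b c : ℕ} (π : PlanePartition a b c) (u v : ℤ × ℤ × ℤ) : Prop :=
  (∃ (i : Fin a) (j : Fin b), ∃ h : ℕ, h = π.1 i j ∧
    u = ((j : ℤ) - h + c, (h : ℤ) - i - 1 + a, (i : ℤ) - j - 1 + b) ∧ v = u + (0, 0, 1)) ∨
  (∃ (j : Fin b) (k : Fin c), ∃ t : ℕ, t = (Finset.univ.filter fun i => (k : ℕ) < π.1 i j).card ∧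
    u = ((j : ℤ) - k - 1 + c, (k : ℤ) - t + a, (t : ℤ) - j - 1 + b) ∧ v = u + (1, 0, 0)) ∨
  (∃ (i : Fin a) (k : Fin c), ∃ t : ℕ, t = (Finset.univ.filter fun j => (k : ℕ) < π.1 i j).card ∧
    u = ((t : ℤ) - k - 1 + c, (k : ℤ) - i - 1 + a, (i : ℤ) - t + b) ∧ v = u + (0, 1, 0))

/-! ### The cone, the polygon `P'` and its dominos -/

/-- The innermost endpoint of the external edge `Y` lies in the cone of `X`, the region between
the two diagonals which start from the innermost endpoint of `X` and point into the grid.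
Both points are first rotated so that `X` is on the bottom side. -/
def InCone (n : ℕ) (X Y : ℤ) : Prop :=
  let x := inner n (X - side n X * n)
  let y := inner n (Y - side n X * n)
  |y.1 - x.1| ≤ y.2 - x.2

/-- The grid points of the polygon `P'`, when `C` is on the bottom side, its cone contains `A`
and `B`, and `B` is on the right of `A`. Here `A`, `B`, `C` stand for the innermost endpoints.
The diagonals through a point `X` are the lines `x + y = σ X` and `x - y = δ X`. The diagonals
of `C` meet the sides of the square at `C'`, on `x + y = σ C`, and `C''`, on `x - y = δ C`. The
diagonals of `A` and `B` that bound the polygon `P = (AA')C'CC''(B''B)` are `x - y = δ A` and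
`x + y = σ B`. The other two, `AA''` on `x + y = σ A` and `BB'` on `x - y = δ B`, intersect at `D`,
and `P'` is obtained from `P` by removing the rectangle `C B' D A''`. -/
def InPolygon (n : ℕ) (A B C p : ℤ × ℤ) : Prop :=
  InGrid n p ∧
  C.1 + C.2 ≤ p.1 + p.2 ∧ p.1 + p.2 ≤ B.1 + B.2 ∧
  A.1 - A.2 ≤ p.1 - p.2 ∧ p.1 - p.2 ≤ C.1 - C.2 ∧
  ¬ (p.1 + p.2 < A.1 + A.2 ∧ B.1 - B.2 < p.1 - p.2)

/-- A domino (a rectangle made of two adjacent unit squares of the grid) is given by its middle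
edge, i.e. the common side of the two squares, which is `(x, y) – (x + 1, y)` if `hor` is true
and `(x, y) – (x, y + 1)` if `hor` is false, with `base = (x, y)`. -/
structure Domino where
  hor : Bool
  base : ℤ × ℤ

/-- The six vertices of a domino, in cyclic order along its border. -/
def Domino.vertex (d : Domino) : Fin 6 → ℤ × ℤ :=
  let x := d.base.1
  let y := d.base.2
  if d.hor then ![(x, y - 1), (x + 1, y - 1), (x + 1, y), (x + 1, y + 1), (x, y + 1), (x, y)]
  else ![(x - 1, y), (x, y), (x + 1, y), (x + 1, y + 1), (x, y + 1), (x - 1, y + 1)]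

/-- The paving of `P'` by dominos. The segments `DA` and `DB` cut `P'` into three parts: a left
part `x + y < σ A`, an upper part `σ A < x + y`, `x - y < δ B`, and a right part `δ B < x - y`.
In each part the middle edges are every other edge in a given direction, arranged in a staggered
way: horizontal ones in the left and right parts (with opposite parities) and vertical ones in
the upper part. The dominos are those which fit in `P'`, and a domino belongs to the part
containing its centre. -/
def IsPaving (n : ℕ) (A B C : ℤ × ℤ) (d : Domino) : Prop :=
  (∀ i, InPolygon n A B C (d.vertex i)) ∧
  let s := d.base.1 + d.base.2
  let t := d.base.1 - d.base.2
  ((d.hor = true ∧ s < A.1 + A.2 ∧ Odd (s - (C.1 + C.2))) ∨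
    (d.hor = false ∧ A.1 + A.2 ≤ s ∧ t ≤ B.1 - B.2 ∧ Odd (s - (C.1 + C.2))) ∨
    (d.hor = true ∧ B.1 - B.2 ≤ t ∧ Even (s - (C.1 + C.2))))

/-- The vertices of the dominos of the paving. -/
def DominoVertex (n : ℕ) (A B C : ℤ × ℤ) : Type :=
  {p : ℤ × ℤ // ∃ d : Domino, IsPaving n A B C d ∧ ∃ i, p = d.vertex i}

/-- The graph formed by the borders of the dominos of the paving (without the middle edges). -/
def dominoGraph (n : ℕ) (A B C : ℤ × ℤ) : SimpleGraph (DominoVertex n A B C) where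
  Adj p q := p ≠ q ∧ ∃ d : Domino, IsPaving n A B C d ∧ ∃ i : Fin 6,
    (p.1 = d.vertex i ∧ q.1 = d.vertex (i + 1)) ∨ (q.1 = d.vertex i ∧ p.1 = d.vertex (i + 1))
  symm := ⟨fun _ _ h => ⟨h.1.symm, h.2.imp fun _ hd => ⟨hd.1, hd.2.imp fun _ hi => hi.symm⟩⟩⟩
  loopless := ⟨fun _ h => h.1 rfl⟩

/-- The set of vertices of a domino of the paving. -/
def IsDominoFace (n : ℕ) (A B C : ℤ × ℤ) (S : Set (DominoVertex n A B C)) : Prop :=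
  ∃ d : Domino, IsPaving n A B C d ∧ S = {p | ∃ i, p.1 = d.vertex i}

/-- The explicit bijection, for external edges `A`, `B`, `C` (in clockwise order `A`, `B`, `C`)
such that the cone of `C` contains `A` and `B`. The grid is rotated by `side n C` quarter turns, so
that `C` is on the bottom side. Then the dominos of the paving of `P'` can be deformed (by a graph
isomorphism `ψ` that takes dominos to elementary hexagons) into the `(a, b, c)` hexagon; keeping,
from each FPL configuration, exactly the edges on the borders of the dominos is a bijection `Θ`
onto the dimer configurations on the hexagon; and each of these is the picture of a unique
plane partition, which is a bijection `Λ` onto the plane partitions in the box. -/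
def ExplicitBijection (n : ℕ) (A B C : ℤ) (a b c : ℕ) : Prop :=
  let r : ℕ := side n C
  let A₀ := inner n (A - r * n)
  let B₀ := inner n (B - r * n)
  let C₀ := inner n (C - r * n)
  ∃ (ψ : dominoGraph n A₀ B₀ C₀ ≃g hexGraph a b c)
    (Θ : FPLOfType n A B C a b c ≃ HexDimer a b c)
    (Λ : HexDimer a b c ≃ PlanePartition a b c),
    (∀ S : Set (DominoVertex n A₀ B₀ C₀), IsDominoFace n A₀ B₀ C₀ S ↔ IsHexFace a b c (ψ '' S)) ∧
    (∀ (F : FPLOfType n A B C a b c) (p q : DominoVertex n A₀ B₀ C₀),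
      (dominoGraph n A₀ B₀ C₀).Adj p q →
        (F.1.Adj ((rot n)^[r] p.1) ((rot n)^[r] q.1) ↔ (Θ F).1.Adj (ψ p) (ψ q))) ∧
    (∀ (M : HexDimer a b c) (u v : HexVertex a b c),
      M.1.Adj u v ↔ LozengeOf (Λ M) u.1 v.1 ∨ LozengeOf (Λ M) v.1 u.1)

end FullyPackedLoops

/-! The link pattern forces most edges of a configuration, and the remaining freedom is a perfect
matching of a hexagonal graph. After a rotation, `C` is the external edge number `k` on the bottom
side, and the cone condition becomes `a ≤ k < a + c` (`Normalized`).

Forced edges. The occupied external edges on the arc between two consecutive centres lie on pairwise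
different paths, because each is joined by its arch to an edge outside the arc. Consider a region
facing such an arc, with a preferred direction. If a vertex of suitable parity were not joined to
its neighbour in that direction, both of its edges could be followed down to the arc, which would
connect two of its external edges or give three ends to one path (de Gier's lemma: `adj_partner`,
`adj_of_region`). This fixes parallel edges in three regions. In the triangular corners beyond the
diagonals through `A`, `B`, `C`, the degree condition then forces the perpendicular edges, row by
row (`corner_vertical`). Hence every configuration of the type contains `fixedGraph`
(`IsNormalFPL.fixedGraph_le`).

What is left. A vertex of a domino lies on exactly one fixed edge and every other grid point on
exactly two (`fixedDegree_of_isHexSite`, `fixedDegree_of_not_isHexSite`). The other edges between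
domino vertices are those on the borders of the dominos, and `toHex` carries them to the hexagonal
graph (`pavingIso`). So a configuration that contains the fixed edges is `fixedGraph` plus a perfect
matching (`IsFPL.eq_configOf`).

Every matching gives the right link pattern. A matching has a height function. From it one defines
an integer label of the grid points that is constant along the edges of the configuration
(`pathLabel_eq_of_adj`). On the occupied external edges each label occurs exactly twice: `1, …, a`
at the arches around `A`, `a + 1, …, a + c` at those around `C`, and `-b, …, -1` at those around
`B`. By the handshake lemma the path that starts at an external edge has another end, and the label
leaves only one candidate for it (`reachable_of_outerLabel`, `isNormalFPL_configOf`).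

Matchings and plane partitions are both equivalent to height functions of stepped surfaces
(`pictureEquiv`). MacMahon's formula comes from Gelfand–Tsetlin patterns: their number and a
determinant of binomial coefficients satisfy the same recurrence, and the determinant is a quotient
of Vandermonde products. The symmetry of the formula in `a`, `b`, `c` also handles the labellings of
the centres in which the distinguished one is not `C`. -/

namespace FullyPackedLoops

/-! ### Graphs of maximal degree two -/

section MaxDegreeTwo

variable {V : Type*}

/-- Every vertex has at most two neighbours. -/
def MaxDegreeTwo (G : SimpleGraph V) : Prop :=
  ∀ v x y z, G.Adj v x → G.Adj v y → G.Adj v z → x = y ∨ x = z ∨ y = z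

/-- A vertex with at most one neighbour. -/
def IsLeaf (G : SimpleGraph V) (v : V) : Prop :=
  ∀ x y, G.Adj v x → G.Adj v y → x = y

/-- With `y` behind, at most one neighbour of `x` is available, so the two paths take the same step
at every stage; a leaf that ends one of them would have to be passed by the other. -/
theorem MaxDegreeTwo.not_two_paths {G : SimpleGraph V} (hG : MaxDegreeTwo G) {v w : V}
    (hv : IsLeaf G v) (hw : IsLeaf G w) (hvw : v ≠ w) :
    ∀ {x : V} (p : G.Walk x v) (_ : p.IsPath) (q : G.Walk x w) (_ : q.IsPath) (y : V),
      G.Adj y x → y ∉ p.support → y ∉ q.support → False := by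
  intro x p
  induction p with
  | nil =>
    intro _ q _ y hy hyp hyq
    cases q with
    | nil => exact hvw rfl
    | cons h q' =>
      have := hv _ _ h hy.symm
      subst this
      simp at hyq
  | @cons x x' v h p' ih =>
    intro hp q hq y hy hyp hyq
    cases q with
    | nil =>
      have := hw _ _ h hy.symm
      subst this
      simp at hyp
    | @cons _ x'' _ h' q' =>
      rw [SimpleGraph.Walk.cons_isPath_iff] at hp hq
      have hxx : x' = x'' := by
        rcases hG x y x' x'' hy.symm h h' with e | e | e
        · subst e; simp at hyp
        · subst e; simp at hyq
        · exact e
      subst hxx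
      exact ih hv hvw hp.1 q' hq.1 x h hp.2 hq.2

/-- A component of such a graph is a path or a cycle, hence has at most two ends. From the leaf `u`
the first step is forced, and `not_two_paths` handles the rest. -/
theorem MaxDegreeTwo.not_three_leaves {G : SimpleGraph V} (hG : MaxDegreeTwo G) {u v w : V}
    (hu : IsLeaf G u) (hv : IsLeaf G v) (hw : IsLeaf G w) (huv : u ≠ v) (huw : u ≠ w)
    (hvw : v ≠ w) (h₁ : G.Reachable u v) (h₂ : G.Reachable u w) : False := by
  obtain ⟨p, hp⟩ := h₁.exists_isPath
  obtain ⟨q, hq⟩ := h₂.exists_isPath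
  cases p with
  | nil => exact huv rfl
  | cons h p' =>
    cases q with
    | nil => exact huw rfl
    | cons h' q' =>
      rw [SimpleGraph.Walk.cons_isPath_iff] at hp hq
      have := hu _ _ h h'
      subst this
      exact hG.not_two_paths hv hw hvw p' hp.1 q' hq.1 u h hp.2 hq.2

theorem MaxDegreeTwo.mono {G H : SimpleGraph V} (hG : MaxDegreeTwo G) (h : H ≤ G) :
    MaxDegreeTwo H :=
  fun v x y z hx hy hz => hG v x y z (h hx) (h hy) (h hz)

/-- In a finite component in which all vertices except two have degree two, and one of the
exceptional vertices has degree one, the other exceptional vertex occurs. -/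
theorem reachable_of_degrees {G : SimpleGraph V} {e e' : V}
    (hfin : {v | G.Reachable e v}.Finite) (he : (G.neighborSet e).ncard = 1)
    (h : ∀ v, G.Reachable e v → v = e ∨ v = e' ∨ (G.neighborSet v).ncard = 2) :
    G.Reachable e e' := by
  classical
  set K : Set V := {v | G.Reachable e v} with hK
  have : Fintype K := hfin.fintype
  have hdeg : ∀ v : K, (G.induce K).degree v = (G.neighborSet v.1).ncard := by
    intro v
    rw [← SimpleGraph.card_neighborSet_eq_degree, ← Nat.card_eq_fintype_card,
      ← Nat.card_coe_set_eq]
    refine Nat.card_congr ⟨fun w => ⟨w.1.1, w.2⟩,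
      fun w => ⟨⟨w.1, v.2.trans (SimpleGraph.Adj.reachable w.2)⟩, w.2⟩, fun _ => rfl, fun _ => rfl⟩
  -- The number of vertices of odd degree is even, so the component has a second one, and only `e'`
  -- is allowed to be odd.
  have h1 : Odd ((G.induce K).degree ⟨e, SimpleGraph.Reachable.refl e⟩) := by
    rw [hdeg, he]; exact odd_one
  obtain ⟨w, hw, hw'⟩ := SimpleGraph.exists_ne_odd_degree_of_exists_odd_degree _ _ h1
  rw [hdeg] at hw'
  rcases h w.1 w.2 with h2 | h2 | h2
  · exact absurd (Subtype.ext h2) hw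
  · rw [← h2]; exact w.2
  · rw [h2] at hw'; exact absurd hw' (by decide)

/-- The graph with the edges at `v` removed. -/
def removeVertex (G : SimpleGraph V) (v : V) : SimpleGraph V where
  Adj x y := G.Adj x y ∧ x ≠ v ∧ y ≠ v
  symm := ⟨fun _ _ h => ⟨h.1.symm, h.2.2, h.2.1⟩⟩
  loopless := ⟨fun _ h => h.1.ne rfl⟩

theorem removeVertex_le (G : SimpleGraph V) (v : V) : removeVertex G v ≤ G := fun _ _ h => h.1

/-- De Gier's lemma in abstract form. Let `E` be a set of leaves no two of which are connected.
Suppose that each edge at `v ∈ S`, other than the one to the partner `R v`, leads to `E` or to the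
partner of some other vertex of `S` (or of `E`), at a smaller rank. Then each vertex of `S` is
joined to its partner. -/
theorem adj_partner {G : SimpleGraph V} (hG : MaxDegreeTwo G) (E S : V → Prop) (R : V → V)
    (ρ : V → ℤ) (lo : ℤ) (hlo : ∀ v, S v → lo ≤ ρ v)
    (hE : ∀ e, E e → IsLeaf G e)
    (hEE : ∀ e e', E e → E e' → G.Reachable e e' → e = e')
    (h2 : ∀ v, S v → ∃ x y, x ≠ y ∧ G.Adj v x ∧ G.Adj v y)
    (hstep : ∀ v, S v → ∀ u, G.Adj v u → u ≠ R v → ρ u < ρ v ∧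
      (E u ∨ ∃ v', ρ v' < ρ u ∧ u = R v' ∧ (S v' ∨ (E v' ∧ G.Adj v' u)))) :
    ∀ v, S v → G.Adj v (R v) := by
  have key : ∀ N : ℕ, ∀ v, S v → ρ v - lo < N → G.Adj v (R v) := by
    intro N
    induction N with
    | zero => intro v hv hN; have := hlo v hv; push_cast at hN; omega
    | succ N ih =>
      intro v hv hN
      by_contra hcon
      set H := removeVertex G v with hH
      -- The descent alternates between a partner edge, present by induction, and the other edge at
      -- the vertex reached. It stays at ranks below `ρ v`, so it arrives in `E` without meeting
      -- `v`.
      have trace : ∀ M : ℕ, ∀ u, ρ u - lo < M → ρ u < ρ v →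
          (E u ∨ ∃ v', ρ v' < ρ u ∧ u = R v' ∧ (S v' ∨ (E v' ∧ G.Adj v' u))) →
          ∃ e, E e ∧ H.Reachable u e := by
        intro M
        induction M with
        | zero =>
          rintro u hu huv (h | ⟨v', h1, -, h | h⟩)
          · exact ⟨u, h, SimpleGraph.Reachable.refl _⟩
          · have := hlo v' h; push_cast at hu; omega
          · refine ⟨v', h.1, SimpleGraph.Adj.reachable ⟨h.2.symm, ?_, ?_⟩⟩
            · rintro rfl; omega
            · rintro rfl; omega
        | succ M ihM =>
          rintro u hu huv (h | ⟨v', h1, h2', h | h⟩)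
          · exact ⟨u, h, SimpleGraph.Reachable.refl _⟩
          · have hadj : G.Adj v' (R v') := ih v' h (by push_cast at hN; omega)
            obtain ⟨u', hu', hne⟩ : ∃ u', G.Adj v' u' ∧ u' ≠ R v' := by
              obtain ⟨x, y, hxy, hx, hy⟩ := h2 v' h
              by_cases hxR : x = R v'
              · exact ⟨y, hy, fun hyR => hxy (hxR.trans hyR.symm)⟩
              · exact ⟨x, hx, hxR⟩
            obtain ⟨h3, h4⟩ := hstep v' h u' hu' hne
            obtain ⟨e, he, hre⟩ := ihM u' (by push_cast at hu; omega) (by omega) h4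
            refine ⟨e, he, ?_⟩
            have a1 : H.Adj u v' := by
              refine ⟨h2' ▸ hadj.symm, ?_, ?_⟩
              · rintro rfl; omega
              · rintro rfl; omega
            have a2 : H.Adj v' u' := by
              refine ⟨hu', ?_, ?_⟩
              · rintro rfl; omega
              · rintro rfl; omega
            exact a1.reachable.trans (a2.reachable.trans hre)
          · refine ⟨v', h.1, SimpleGraph.Adj.reachable ⟨h.2.symm, ?_, ?_⟩⟩
            · rintro rfl; omega
            · rintro rfl; omega
      obtain ⟨x, y, hxy, hx, hy⟩ := h2 v hv
      have hxR : x ≠ R v := by rintro rfl; exact hcon hx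
      have hyR : y ≠ R v := by rintro rfl; exact hcon hy
      obtain ⟨hx1, hx2⟩ := hstep v hv x hx hxR
      obtain ⟨hy1, hy2⟩ := hstep v hv y hy hyR
      obtain ⟨e, he, hre⟩ := trace (ρ x - lo + 1).toNat x (by omega) hx1 hx2
      obtain ⟨e', he', hre'⟩ := trace (ρ y - lo + 1).toNat y (by omega) hy1 hy2
      have hle := removeVertex_le G v
      have hee : e = e' := hEE e e' he he' (((hre.mono hle).symm.trans hx.symm.reachable).trans
        (hy.reachable.trans (hre'.mono hle)))
      subst hee
      -- Without the edges at `v`, the vertices `x` and `y` become leaves, and both are connected to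
      -- `e`. These are three leaves in one component, unless `e` is `x` or `y`; in that case `e` is
      -- isolated in `H`.
      have leaf : ∀ z, G.Adj v z → IsLeaf H z := by
        intro z hz p q hp hq
        rcases hG z v p q hz.symm hp.1 hq.1 with h | h | h
        · exact absurd h.symm hp.2.2
        · exact absurd h.symm hq.2.2
        · exact h
      have noE : ∀ z z', G.Adj v z → E z → z' ≠ z → ¬ H.Reachable z' z := by
        intro z z' hz hEz hne hr
        obtain ⟨p⟩ := hr.symm
        cases p with
        | nil => exact hne rfl
        | cons h _ => exact h.2.2 (hE z hEz _ _ h.1 hz.symm)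
      by_cases hex : e = x
      · exact noE x y hx (hex ▸ he) hxy.symm (hex ▸ hre')
      by_cases hey : e = y
      · exact noE y x hy (hey ▸ he) hxy (hey ▸ hre)
      have eleaf : IsLeaf H e := fun p q hp hq => hE e he p q hp.1 hq.1
      exact (hG.mono hle).not_three_leaves eleaf (leaf x hx) (leaf y hy) hex hey hxy
        hre.symm hre'.symm
  intro v hv
  exact key (ρ v - lo + 1).toNat v hv (by have := hlo v hv; omega)

end MaxDegreeTwo

end FullyPackedLoops

namespace FullyPackedLoops

/-! ### Gelfand–Tsetlin patterns and MacMahon's formula -/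

/-- The determinant of the binomial coefficients `(l i).choose j`. -/
def chooseDet (n : ℕ) (l : Fin n → ℕ) : ℤ :=
  (Matrix.of fun i j : Fin n => ((l i).choose (j : ℕ) : ℤ)).det

theorem sum_Ico_choose (u v j : ℕ) (h : u ≤ v) :
    ∑ x ∈ Finset.Ico u v, (x.choose j : ℤ) = (v.choose (j + 1) : ℤ) - (u.choose (j + 1) : ℤ) := by
  induction v, h using Nat.le_induction with
  | base => simp
  | succ v h ih =>
    rw [Finset.sum_Ico_succ_top h, ih, Nat.choose_succ_succ' v j]
    push_cast
    ring

/-- Subtracting each row from the next one leaves a single nonzero entry in the first column. By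
`sum_Ico_choose` the remaining minor has entries that are sums of binomial coefficients over the
interlacing intervals, and multilinearity in the rows takes the sums out. This is the recurrence
obeyed by the number of patterns with top row `l`. -/
theorem chooseDet_succ (n : ℕ) (l : Fin (n + 1) → ℕ) (hl : Monotone l) :
    chooseDet (n + 1) l =
      ∑ μ ∈ Fintype.piFinset fun i : Fin n => Finset.Ico (l i.castSucc) (l i.succ),
        chooseDet n μ := by
  classical
  have h1 : chooseDet (n + 1) l = (Matrix.of fun i j : Fin (n + 1) =>
      Fin.cases ((l 0).choose (j : ℕ) : ℤ) (fun i : Fin n =>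
        ((l i.succ).choose (j : ℕ) : ℤ) - ((l i.castSucc).choose (j : ℕ) : ℤ)) i).det := by
    refine Matrix.det_eq_of_forall_row_eq_smul_add_pred (fun _ => 1) (fun j => rfl) fun i j => ?_
    simp
  have h2 : chooseDet (n + 1) l = (Matrix.of fun i j : Fin n =>
      ∑ x ∈ Finset.Ico (l i.castSucc) (l i.succ), (x.choose (j : ℕ) : ℤ)).det := by
    rw [h1, Matrix.det_succ_column_zero, Fin.sum_univ_succ]
    rw [Finset.sum_eq_zero (s := Finset.univ)]
    · simp only [Fin.val_zero, pow_zero, one_mul, add_zero, Matrix.of_apply, Fin.cases_zero,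
        Nat.choose_zero_right, Nat.cast_one]
      congr 1
      ext i j
      simp only [Matrix.submatrix_apply, Matrix.of_apply, Fin.zero_succAbove, Fin.cases_succ]
      rw [sum_Ico_choose _ _ _ (hl (Fin.castSucc_lt_succ).le)]
      simp
    · intro i _
      simp
  rw [h2]
  have h3 := (Matrix.detRowAlternating (n := Fin n) (R := ℤ)).toMultilinearMap.map_sum_finset
    (fun (_ : Fin n) (x : ℕ) (j : Fin n) => (x.choose (j : ℕ) : ℤ))
    (fun i : Fin n => Finset.Ico (l i.castSucc) (l i.succ))
  convert! h3 using 1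
  congr 1
  ext i j
  simp [Finset.sum_apply]

/-- The falling factorials are monic of degrees `0, 1, 2, …`, so their determinant is the
Vandermonde determinant; on the other hand they are factorials times binomial coefficients. -/
theorem chooseDet_mul_factorials (n : ℕ) (l : Fin n → ℕ) :
    (∏ i : Fin n, ((i : ℕ).factorial : ℤ)) * chooseDet n l =
      ∏ i : Fin n, ∏ j ∈ Finset.Ioi i, ((l j : ℤ) - l i) := by
  rw [← Matrix.det_vandermonde (fun i : Fin n => (l i : ℤ)),
    Matrix.det_eval_matrixOfPolynomials_eq_det_vandermonde (fun i : Fin n => (l i : ℤ))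
      (fun i => descPochhammer ℤ i) (fun i => descPochhammer_natDegree ℤ i)
      (fun i => monic_descPochhammer ℤ i)]
  rw [chooseDet, ← Matrix.det_mul_row]
  congr 1
  ext i j
  simp only [Matrix.of_apply]
  rw [descPochhammer_eval_eq_descFactorial ℤ _ _]
  exact_mod_cast (Nat.descFactorial_eq_factorial_mul_choose _ _).symm

theorem chooseDet_id (n : ℕ) : chooseDet n (fun i => (i : ℕ)) = 1 := by
  rw [chooseDet, Matrix.det_of_isLowerTriangular]
  · simp
  · intro i j hij
    simp only [Matrix.of_apply, Nat.cast_eq_zero]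
    exact Nat.choose_eq_zero_of_lt hij

/-- The product of factorials is eliminated by comparison with the row `0, …, n - 1`, for which the
determinant is `1`. -/
theorem chooseDet_eq_prod (n : ℕ) (l : Fin n → ℕ) :
    (chooseDet n l : ℚ) =
      ∏ i : Fin n, ∏ j ∈ Finset.Ioi i, (((l j : ℚ) - l i) / ((j : ℚ) - i)) := by
  have h1 := chooseDet_mul_factorials n l
  have h2 := chooseDet_mul_factorials n (fun i => (i : ℕ))
  rw [chooseDet_id, mul_one] at h2
  rw [h2] at h1
  have h3 : (∏ i : Fin n, ∏ j ∈ Finset.Ioi i, ((j : ℚ) - i)) * (chooseDet n l : ℚ) =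
      ∏ i : Fin n, ∏ j ∈ Finset.Ioi i, ((l j : ℚ) - l i) := by exact_mod_cast h1
  simp_rw [Finset.prod_div_distrib]
  rw [← h3, mul_div_cancel_left₀]
  refine Finset.prod_ne_zero_iff.2 fun i _ => Finset.prod_ne_zero_iff.2 fun j hj => ?_
  have : (i : ℕ) < j := by simpa using hj
  exact sub_ne_zero.2 (by exact_mod_cast this.ne')

/-- Gelfand–Tsetlin patterns (in the strict normalization) with `n` rows and top row `l`. -/
abbrev GTPattern (n : ℕ) (l : ℕ → ℕ) : Type :=
  {P : ℕ → ℕ → ℕ // (∀ i, i < n → P n i = l i) ∧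
    (∀ m i, i < m → m < n → P (m + 1) i ≤ P m i ∧ P m i < P (m + 1) (i + 1)) ∧
    ∀ m i, (n < m ∨ m ≤ i) → P m i = 0}

/-- Extension by zero. -/
def extendRow {n : ℕ} (μ : Fin n → ℕ) (i : ℕ) : ℕ := if h : i < n then μ ⟨i, h⟩ else 0

/-- Splitting off the top row of a pattern. -/
def GTPattern.succEquiv (n : ℕ) (l : ℕ → ℕ) :
    GTPattern (n + 1) l ≃
      Σ μ : {μ : Fin n → ℕ // μ ∈ Fintype.piFinset fun i : Fin n =>
        Finset.Ico (l i) (l (i + 1))}, GTPattern n (extendRow μ.1) where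
  toFun P := ⟨⟨fun i => P.1 n i, by
      rw [Fintype.mem_piFinset]
      intro i
      have h := P.2.2.1 n i i.2 (Nat.lt_succ_self n)
      rw [P.2.1 i (by omega), P.2.1 (i + 1) (by omega)] at h
      exact Finset.mem_Ico.2 h⟩,
    ⟨fun m i => if m ≤ n then P.1 m i else 0, by
      refine ⟨?_, ?_, ?_⟩
      · intro i hi
        simp [extendRow, hi]
      · intro m i hi hm
        have := P.2.2.1 m i hi (by omega)
        dsimp only
        rwa [if_pos (by omega), if_pos (by omega), if_pos (by omega)]
      · rintro m i h
        dsimp only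
        split_ifs with h1
        · exact P.2.2.2 m i (Or.inr (by omega))
        · rfl⟩⟩
  invFun Q := ⟨fun m i => if m = n + 1 then (if i < n + 1 then l i else 0) else Q.2.1 m i, by
    have hQ := Q.1.2
    rw [Fintype.mem_piFinset] at hQ
    refine ⟨?_, ?_, ?_⟩
    · intro i hi
      simp [hi]
    · intro m i hi hm
      dsimp only
      by_cases hmn : m = n
      · subst hmn
        have h1 := Finset.mem_Ico.1 (hQ ⟨i, hi⟩)
        have h2 := Q.2.2.1 i hi
        simp only [extendRow, hi, dif_pos] at h2
        rw [if_pos rfl, if_pos (by omega), if_neg (by omega), if_pos rfl, if_pos (by omega), h2]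
        exact h1
      · rw [if_neg (by omega), if_neg (by omega), if_neg (by omega)]
        exact Q.2.2.2.1 m i hi (by omega)
    · intro m i h
      dsimp only
      split_ifs with h1 h2
      · omega
      · rfl
      · exact Q.2.2.2.2 m i (by omega)⟩
  left_inv P := by
    apply Subtype.ext
    funext m i
    dsimp only
    split_ifs with h1 h2 h3
    · rw [h1, P.2.1 i h2]
    · exact (P.2.2.2 m i (by omega)).symm
    · rfl
    · exact (P.2.2.2 m i (by omega)).symm
  right_inv Q := by
    obtain ⟨⟨μ, hμ⟩, Q, hQ⟩ := Q
    have h : (fun i : Fin n => (if n = n + 1 then (if (i : ℕ) < n + 1 then l i else 0)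
        else Q n i)) = μ := by
      funext i
      rw [if_neg (by omega), hQ.1 i i.2]
      simp [extendRow]
    have h' : (fun m i => if m ≤ n then (if m = n + 1 then (if i < n + 1 then l i else 0)
        else Q m i) else 0) = Q := by
      funext m i
      split_ifs with h1 h2 h3
      · omega
      · omega
      · rfl
      · exact (hQ.2.2 m i (by omega)).symm
    subst h
    exact Sigma.ext rfl (heq_of_eq (Subtype.ext h'))

/-- Removing the top row gives the recurrence of `chooseDet_succ`. Weak monotonicity of the top row
suffices: two equal entries leave an empty interval for the row below. -/
theorem GTPattern.card (n : ℕ) : ∀ l : ℕ → ℕ, (∀ i, i + 1 < n → l i ≤ l (i + 1)) →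
    Finite (GTPattern n l) ∧ (Nat.card (GTPattern n l) : ℤ) = chooseDet n fun i => l i := by
  induction n with
  | zero =>
    intro l _
    have : Unique (GTPattern 0 l) :=
      { default := ⟨fun _ _ => 0, by simp⟩
        uniq := fun P => Subtype.ext <| by
          funext m i
          exact P.2.2.2 m i (by omega) }
    exact ⟨inferInstance, by simp [chooseDet]⟩
  | succ n ih =>
    intro l hl
    have hmono : Monotone fun i : Fin (n + 1) => l i :=
      Fin.monotone_iff_le_succ.2 fun i => hl i (by omega)
    have hrow : ∀ μ : {μ : Fin n → ℕ // μ ∈ Fintype.piFinset fun i : Fin n =>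
        Finset.Ico (l i) (l (i + 1))}, Finite (GTPattern n (extendRow μ.1)) ∧
        (Nat.card (GTPattern n (extendRow μ.1)) : ℤ) = chooseDet n μ.1 := by
      intro μ
      have hμ := μ.2
      rw [Fintype.mem_piFinset] at hμ
      obtain ⟨h1, h2⟩ := ih (extendRow μ.1) fun i hi => by
        have e1 := Finset.mem_Ico.1 (hμ ⟨i, by omega⟩)
        have e2 := Finset.mem_Ico.1 (hμ ⟨i + 1, by omega⟩)
        simp only [extendRow, hi, dif_pos, show i < n by omega]
        simp only at e1 e2
        omega
      refine ⟨h1, h2.trans ?_⟩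
      congr 1
      funext i
      simp [extendRow]
    have : ∀ μ : {μ : Fin n → ℕ // μ ∈ Fintype.piFinset fun i : Fin n =>
        Finset.Ico (l i) (l (i + 1))}, Finite (GTPattern n (extendRow μ.1)) := fun μ => (hrow μ).1
    refine ⟨Finite.of_equiv _ (GTPattern.succEquiv n l).symm, ?_⟩
    rw [Nat.card_congr (GTPattern.succEquiv n l), Nat.card_sigma, chooseDet_succ n _ hmono]
    push_cast
    rw [Finset.sum_congr rfl fun μ _ => (hrow μ).2]
    exact Finset.sum_coe_sort (Fintype.piFinset fun i : Fin n => Finset.Ico (l i) (l (i + 1)))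
      (fun μ => chooseDet n μ)

end FullyPackedLoops

/-! ### Plane partitions as Gelfand–Tsetlin patterns, and MacMahon's product -/

namespace FullyPackedLoops

/-- The top row of the patterns that represent the plane partitions in an `a × b × c` box. -/
def boxRow (b c i : ℕ) : ℕ := if i < b then i else i + c

/-- The two interlacing inequalities, iterated `d` times along the two directions of the triangle.
-/
theorem GTPattern.shift_le {n : ℕ} {l : ℕ → ℕ} (P : GTPattern n l) {m i : ℕ} (him : i < m)
    (d : ℕ) (hd : m + d ≤ n) :
    P.1 (m + d) i ≤ P.1 m i ∧ P.1 m i + d ≤ P.1 (m + d) (i + d) := by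
  induction d with
  | zero => simp
  | succ d ih =>
    have h1 := ih (by omega)
    have h2 := P.2.2.1 (m + d) i (by omega) (by omega)
    have h3 := P.2.2.1 (m + d) (i + d) (by omega) (by omega)
    change P.1 (m + d + 1) i ≤ _ ∧ _ ≤ P.1 (m + d + 1) (i + d + 1)
    omega

/-- Comparison with the top row. It forces the value `i + c` when `b ≤ i` and the value `i` when `i
+ a < m`, so that the free entries form an `a × b` rectangle. -/
theorem GTPattern.bounds {a b c : ℕ} (P : GTPattern (a + b) (boxRow b c)) {m i : ℕ} (him : i < m)
    (hm : m ≤ a + b) :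
    boxRow b c i ≤ P.1 m i ∧ P.1 m i + (a + b - m) ≤ boxRow b c (i + (a + b - m)) := by
  have h := P.shift_le him (a + b - m) (by omega)
  rw [show m + (a + b - m) = a + b by omega, P.2.1 _ (by omega), P.2.1 _ (by omega)] at h
  exact h

theorem PlanePartition.le {a b c : ℕ} (π : PlanePartition a b c) (i : Fin a) (j : Fin b) :
    π.1 i j ≤ c := π.2.1 i j

theorem PlanePartition.anti {a b c : ℕ} (π : PlanePartition a b c) {i i' : Fin a} {j j' : Fin b}
    (hi : i ≤ i') (hj : j ≤ j') : π.1 i' j' ≤ π.1 i j := π.2.2 i i' j j' hi hj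

/-- The pattern that represents a plane partition. -/
def patternOfPartition {a b c : ℕ} (π : PlanePartition a b c) (m i : ℕ) : ℕ :=
  if i < m ∧ m ≤ a + b then
    if b ≤ i then i + c
    else if h : m - 1 - i < a ∧ b - 1 - i < b then i + π.1 ⟨m - 1 - i, h.1⟩ ⟨b - 1 - i, h.2⟩ else i
  else 0

/-- The Gelfand–Tsetlin patterns with top row `boxRow` are the plane partitions in a box. -/
def GTPattern.boxEquiv (a b c : ℕ) :
    GTPattern (a + b) (boxRow b c) ≃ PlanePartition a b c where
  -- The column `j` is read at the index `i = b - 1 - j`, reversed because the entries of a pattern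
  -- increase with the index; subtracting `i` turns the strict increase into a weak one.
  toFun P := ⟨fun w j => P.1 (b - 1 - j + w + 1) (b - 1 - j) - (b - 1 - j), by
    have hstep1 : ∀ w i : ℕ, i + w + 2 ≤ a + b → P.1 (i + (w + 1) + 1) i ≤ P.1 (i + w + 1) i :=
      fun w i h => (P.2.2.1 (i + w + 1) i (by omega) (by omega)).1
    have hstep2 : ∀ w i : ℕ, i + w + 2 ≤ a + b →
        P.1 (i + w + 1) i < P.1 (i + 1 + w + 1) (i + 1) := fun w i h => by
      have := (P.2.2.1 (i + w + 1) i (by omega) (by omega)).2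
      rwa [show i + 1 + w + 1 = i + w + 1 + 1 by omega]
    refine ⟨?_, ?_⟩
    · intro w j
      have h := P.bounds (m := b - 1 - j + w + 1) (i := b - 1 - j) (by omega) (by omega)
      simp only [boxRow] at h
      dsimp only
      split_ifs at h <;> omega
    · intro w w' j j' hw hj
      have e1 : ∀ d : ℕ, ∀ w i : ℕ, i + w + d + 1 ≤ a + b →
          P.1 (i + (w + d) + 1) i ≤ P.1 (i + w + 1) i := by
        intro d
        induction d with
        | zero => intro w i _; exact le_rfl
        | succ d ih =>
          intro w i h
          exact (hstep1 (w + d) i (by omega)).trans (ih w i (by omega))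
      have e2 : ∀ d : ℕ, ∀ w i : ℕ, i + w + d + 1 ≤ a + b →
          P.1 (i + w + 1) i + d ≤ P.1 (i + d + w + 1) (i + d) := by
        intro d
        induction d with
        | zero => intro w i _; exact le_rfl
        | succ d ih =>
          intro w i h
          have h1 := ih w i (by omega)
          have h2 := hstep2 w (i + d) (by omega)
          rw [← Nat.add_assoc i d 1]
          omega
      have f1 := e1 (w' - w) w (b - 1 - j') (by omega)
      have f2 := e2 (j' - j) w (b - 1 - j') (by omega)
      have hj2 : (j : ℕ) ≤ j' := hj
      have hw2 : (w : ℕ) ≤ w' := hw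
      rw [show (w : ℕ) + (w' - w) = w' by omega] at f1
      rw [show b - 1 - (j' : ℕ) + (j' - j) = b - 1 - j by omega] at f2
      have h := P.bounds (m := b - 1 - j' + w' + 1) (i := b - 1 - j') (by omega) (by omega)
      dsimp only
      omega⟩
  invFun π := ⟨patternOfPartition π, by
    refine ⟨?_, ?_, ?_⟩
    · intro i hi
      simp only [patternOfPartition, boxRow]
      split_ifs <;> omega
    · intro m i hi hm
      simp only [patternOfPartition, if_pos (show i < m + 1 ∧ m + 1 ≤ a + b by omega),
        if_pos (show i < m ∧ m ≤ a + b by omega),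
        if_pos (show i + 1 < m + 1 ∧ m + 1 ≤ a + b by omega)]
      by_cases hbi : b ≤ i
      · simp only [if_pos hbi, if_pos (show b ≤ i + 1 by omega)]
        omega
      simp only [if_neg hbi]
      constructor
      · split_ifs with h1 h2
        · have := π.anti (i := ⟨m - 1 - i, h2.1⟩) (i' := ⟨m + 1 - 1 - i, h1.1⟩)
            (j := ⟨b - 1 - i, h2.2⟩) (j' := ⟨b - 1 - i, h2.2⟩)
            (by simp only [Fin.mk_le_mk]; omega) le_rfl
          omega
        · omega
        · omega
        · omega
      · by_cases hbi' : b ≤ i + 1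
        · simp only [if_pos hbi']
          split_ifs with h1
          · have := π.le ⟨m - 1 - i, h1.1⟩ ⟨b - 1 - i, h1.2⟩
            omega
          · omega
        · simp only [if_neg hbi']
          split_ifs with h1 h2
          · have := π.anti (i := ⟨m - 1 - i, h1.1⟩) (i' := ⟨m - 1 - i, h1.1⟩)
              (j := ⟨b - 1 - (i + 1), h2.2⟩) (j' := ⟨b - 1 - i, h1.2⟩)
              le_rfl (by simp only [Fin.mk_le_mk]; omega)
            simp only [show m + 1 - 1 - (i + 1) = m - 1 - i by omega]
            omega
          · omega
          · omega
          · omega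
    · intro m i h
      rw [patternOfPartition, if_neg (by omega)]⟩
  left_inv P := by
    apply Subtype.ext
    funext m i
    simp only [patternOfPartition]
    by_cases h : i < m ∧ m ≤ a + b
    · rw [if_pos h]
      have hb := P.bounds h.1 h.2
      simp only [boxRow] at hb
      by_cases hbi : b ≤ i
      · rw [if_pos hbi]
        split_ifs at hb <;> omega
      · rw [if_neg hbi]
        split_ifs with h1
        · simp only [show b - 1 - (b - 1 - i) = i by omega,
            show i + (m - 1 - i) + 1 = m by omega]
          split_ifs at hb <;> omega
        · split_ifs at hb <;> omega
    · rw [if_neg h]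
      exact (P.2.2.2 m i (by omega)).symm
  right_inv π := by
    apply Subtype.ext
    funext w j
    simp only [patternOfPartition]
    rw [if_pos (by omega), if_neg (by omega), dif_pos (by omega), Nat.add_sub_cancel_left]
    exact congrArg₂ π.1 (Fin.ext (by dsimp only; omega)) (Fin.ext (by dsimp only; omega))

theorem prod_Icc_one {M : Type*} [CommMonoid M] (n : ℕ) (f : ℕ → M) :
    ∏ i ∈ Finset.Icc 1 n, f i = ∏ i ∈ Finset.range n, f (i + 1) := by
  induction n with
  | zero => simp
  | succ n ih => rw [Finset.prod_Icc_succ_top (by omega), ih, Finset.prod_range_succ]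

/-- The product over `k` telescopes. -/
theorem prod_Icc_div_eq (i j c : ℕ) (hij : 2 ≤ i + j) :
    ∏ k ∈ Finset.Icc 1 c, (((i : ℚ) + j + k - 1) / ((i : ℚ) + j + k - 2)) =
      ((i : ℚ) + j + c - 1) / ((i : ℚ) + j - 1) := by
  have h2 : (2 : ℚ) ≤ i + j := by exact_mod_cast hij
  induction c with
  | zero =>
    simp only [Finset.Icc_eq_empty_of_lt Nat.zero_lt_one, Finset.prod_empty, Nat.cast_zero,
      add_zero]
    rw [div_self (by linarith)]
  | succ c ih =>
    rw [Finset.prod_Icc_succ_top (by omega), ih]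
    have h3 : ((i : ℚ) + j + c - 1) ≠ 0 := by
      have : (0 : ℚ) ≤ c := Nat.cast_nonneg c
      linarith
    push_cast
    rw [show (i : ℚ) + j + (c + 1) - 2 = i + j + c - 1 by ring, div_mul_div_comm,
      mul_comm ((i : ℚ) + j + c - 1), mul_div_mul_right _ _ h3]

theorem finite_planePartition (a b c : ℕ) : Finite (PlanePartition a b c) := by
  have h := GTPattern.card (a + b) (boxRow b c) fun i _ => by
    simp only [boxRow]; split_ifs <;> omega
  have := h.1
  exact Finite.of_equiv _ (GTPattern.boxEquiv a b c)

/-- MacMahon's formula for the number of plane partitions in a box. -/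
theorem card_planePartition (a b c : ℕ) :
    (Nat.card (PlanePartition a b c) : ℚ) =
      ∏ i ∈ Finset.Icc 1 a, ∏ j ∈ Finset.Icc 1 b, ∏ k ∈ Finset.Icc 1 c,
        ((i : ℚ) + j + k - 1) / ((i : ℚ) + j + k - 2) := by
  have h := (GTPattern.card (a + b) (boxRow b c) fun i _ => by
    simp only [boxRow]; split_ifs <;> omega).2
  rw [Nat.card_congr (GTPattern.boxEquiv a b c)] at h
  have h' : (Nat.card (PlanePartition a b c) : ℚ) =
      chooseDet (a + b) fun i => boxRow b c i := by exact_mod_cast h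
  rw [h', chooseDet_eq_prod]
  have h1 : ∀ i : Fin (a + b), ∏ j ∈ Finset.Ioi i,
      (((boxRow b c j : ℚ) - boxRow b c i) / ((j : ℚ) - i)) =
      ∏ j ∈ Finset.range (a + b), if (i : ℕ) < j then
        (((boxRow b c j : ℚ) - boxRow b c i) / ((j : ℚ) - i)) else 1 := by
    intro i
    rw [← Fin.prod_univ_eq_prod_range (fun j => if (i : ℕ) < j then
        (((boxRow b c j : ℚ) - boxRow b c i) / ((j : ℚ) - i)) else 1), ← Finset.prod_filter]
    congr 1
    ext j
    simp
  rw [Finset.prod_congr rfl fun i _ => h1 i, Fin.prod_univ_eq_prod_range (fun i =>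
    ∏ j ∈ Finset.range (a + b), if i < j then
        (((boxRow b c j : ℚ) - boxRow b c i) / ((j : ℚ) - i)) else 1)]
  -- The top row consists of two runs of consecutive integers, so a pair on one side of `b`
  -- contributes `1`; only the pairs `i < b ≤ j = b + w` remain.
  have h2 : ∀ i ∈ Finset.range (a + b), (∏ j ∈ Finset.range (a + b), if i < j then
      (((boxRow b c j : ℚ) - boxRow b c i) / ((j : ℚ) - i)) else 1) =
      if i < b then ∏ w ∈ Finset.range a, (((b - i : ℕ) : ℚ) + w + c) / (((b - i : ℕ) : ℚ) + w)
      else 1 := by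
    intro i hi
    have hlt : ∀ j ∈ Finset.range b, (if i < j then
        (((boxRow b c j : ℚ) - boxRow b c i) / ((j : ℚ) - i)) else 1) = 1 := by
      intro j hj
      rw [Finset.mem_range] at hj
      split_ifs with hij
      · simp only [boxRow, hj, hij.trans hj, if_true]
        exact div_self (sub_ne_zero.2 (by exact_mod_cast hij.ne'))
      · rfl
    rw [add_comm a b, Finset.prod_range_add, Finset.prod_eq_one hlt, one_mul]
    split_ifs with hib
    · refine Finset.prod_congr rfl fun w _ => ?_
      rw [if_pos (by omega)]
      simp only [boxRow, hib, if_true, if_neg (show ¬ b + w < b by omega)]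
      rw [Nat.cast_sub hib.le]
      push_cast
      congr 1 <;> ring
    · refine Finset.prod_eq_one fun w _ => ?_
      split_ifs with hw
      · simp only [boxRow, hib, if_false, if_neg (show ¬ b + w < b by omega)]
        push_cast
        rw [show ((b : ℚ) + w + c - (i + c)) = b + w - i by ring]
        refine div_self (sub_ne_zero.2 ?_)
        exact_mod_cast hw.ne'
      · rfl
  rw [Finset.prod_congr rfl h2, ← Finset.prod_filter]
  have h3 : (Finset.range (a + b)).filter (fun i => i < b) = Finset.range b := by
    ext i
    simp only [Finset.mem_filter, Finset.mem_range]
    omega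
  -- With `x = b - 1 - i` the factor becomes `(w + x + 1 + c) / (w + x + 1)`, the telescoped product
  -- over `k`.
  rw [h3, ← Finset.prod_range_reflect, Finset.prod_comm, prod_Icc_one]
  refine Finset.prod_congr rfl fun w _ => ?_
  rw [prod_Icc_one]
  refine Finset.prod_congr rfl fun x hx => ?_
  rw [Finset.mem_range] at hx
  rw [prod_Icc_div_eq _ _ _ (by omega), show b - (b - 1 - x) = x + 1 by omega]
  push_cast
  congr 1 <;> ring

end FullyPackedLoops

namespace FullyPackedLoops

/-! ### Height functions -/

/-- The height functions of the lozenge tilings of the `(a, b, c)` hexagon. The stepped surface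
meets the line of direction `(1, 1, 1)` through `(α, β, 0)` in the point
`(α + h, β + h, h)`, where `h = h α β`. -/
structure IsHeight (a b c : ℕ) (h : ℤ → ℤ → ℤ) : Prop where
  anti_left : ∀ α β, h (α + 1) β ≤ h α β
  anti_right : ∀ α β, h α (β + 1) ≤ h α β
  diag : ∀ α β, h α β ≤ h (α + 1) (β + 1) + 1
  lower : ∀ α β, 0 ≤ h α β ∧ -α ≤ h α β ∧ -β ≤ h α β
  upper : ∀ α β, h α β = 0 ∨ h α β = -α ∨ h α β = -β ∨
    (α + h α β ≤ a ∧ β + h α β ≤ b ∧ h α β ≤ c)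

/-- The cubes of the pile of a plane partition, together with those behind the walls. -/
def InPile {a b c : ℕ} (π : PlanePartition a b c) (x y z : ℤ) : Prop :=
  x < 0 ∨ y < 0 ∨ z < 0 ∨ ∃ (i : Fin a) (j : Fin b), x = i ∧ y = j ∧ z < π.1 i j

/-- The monotonicity of `π` says that the pile, together with everything behind the walls, is closed
downwards. -/
theorem InPile.mono {a b c : ℕ} {π : PlanePartition a b c} {x y z x' y' z' : ℤ}
    (h : InPile π x y z) (hx : x' ≤ x) (hy : y' ≤ y) (hz : z' ≤ z) : InPile π x' y' z' := by
  rcases h with h | h | h | ⟨i, j, hi, hj, hk⟩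
  · exact Or.inl (by omega)
  · exact Or.inr (Or.inl (by omega))
  · exact Or.inr (Or.inr (Or.inl (by omega)))
  · by_cases hx0 : x' < 0
    · exact Or.inl hx0
    by_cases hy0 : y' < 0
    · exact Or.inr (Or.inl hy0)
    refine Or.inr (Or.inr (Or.inr ⟨⟨x'.toNat, by omega⟩, ⟨y'.toNat, by omega⟩, by simp; omega,
      by simp; omega, ?_⟩))
    have := π.anti (i := ⟨x'.toNat, by omega⟩) (i' := i) (j := ⟨y'.toNat, by omega⟩) (j' := j)
      (by rw [Fin.le_def]; dsimp only; omega) (by rw [Fin.le_def]; dsimp only; omega)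
    omega

/-- On a line of direction `(1, 1, 1)` the pile is closed downwards, contains all points below the
floor, and is bounded by the box and the walls. Hence it is a half-line. -/
theorem exists_height {a b c : ℕ} (π : PlanePartition a b c) (α β : ℤ) :
    ∃ t : ℤ, ∀ z : ℤ, InPile π (α + z) (β + z) z ↔ z < t := by
  obtain ⟨t, ht, hmin⟩ := Int.exists_least_of_bdd
    (P := fun z : ℤ => ¬ InPile π (α + z) (β + z) z)
    ⟨0, fun z hz => by
      by_contra hneg
      exact hz (Or.inr (Or.inr (Or.inl (by omega))))⟩
    ⟨max c (max (-α) (-β)), by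
      rintro (h | h | h | ⟨i, j, hi, hj, hk⟩)
      · omega
      · omega
      · omega
      · have := π.le i j
        omega⟩
  refine ⟨t, fun z => ⟨fun hz => ?_, fun hz => ?_⟩⟩
  · by_contra hneg
    exact ht (hz.mono (by omega) (by omega) (by omega))
  · by_contra hneg
    have := hmin z hneg
    omega

/-- The height function of a plane partition. -/
noncomputable def heightOf {a b c : ℕ} (π : PlanePartition a b c) (α β : ℤ) : ℤ :=
  (exists_height π α β).choose

theorem inPile_iff {a b c : ℕ} (π : PlanePartition a b c) (x y z : ℤ) :
    InPile π x y z ↔ z < heightOf π (x - z) (y - z) := by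
  have h := (exists_height π (x - z) (y - z)).choose_spec z
  rwa [sub_add_cancel, sub_add_cancel] at h

theorem inPile_add_iff {a b c : ℕ} (π : PlanePartition a b c) (α β z : ℤ) :
    InPile π (α + z) (β + z) z ↔ z < heightOf π α β :=
  (exists_height π α β).choose_spec z

/-- The three monotonicity conditions express that the pile is closed downwards in the three
directions. For `upper`, the last cube of the pile on the line lies behind a wall or in the box. -/
theorem isHeight_heightOf {a b c : ℕ} (π : PlanePartition a b c) :
    IsHeight a b c (heightOf π) where
  anti_left α β := by
    by_contra hcon
    rw [not_le, ← inPile_add_iff] at hcon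
    exact lt_irrefl _ ((inPile_add_iff π α β _).1 (hcon.mono (by omega) le_rfl le_rfl))
  anti_right α β := by
    by_contra hcon
    rw [not_le, ← inPile_add_iff] at hcon
    exact lt_irrefl _ ((inPile_add_iff π α β _).1 (hcon.mono le_rfl (by omega) le_rfl))
  diag α β := by
    by_contra hcon
    rw [not_le, ← inPile_add_iff] at hcon
    exact lt_irrefl _ ((inPile_add_iff π (α + 1) (β + 1) _).1
      (hcon.mono (by omega) (by omega) (by omega)))
  lower α β := by
    refine ⟨?_, ?_, ?_⟩ <;> by_contra hcon <;> rw [not_le] at hcon <;>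
      refine lt_irrefl _ ((inPile_add_iff π α β _).1 ?_)
    · exact Or.inr (Or.inr (Or.inl hcon))
    · exact Or.inl (by omega)
    · exact Or.inr (Or.inl (by omega))
  upper α β := by
    have h1 : InPile π _ _ _ := (inPile_add_iff π α β (heightOf π α β - 1)).2 (by omega)
    have h2 : ¬ InPile π _ _ _ := fun h => lt_irrefl _ ((inPile_add_iff π α β _).1 h)
    simp only [InPile, not_or] at h2
    rcases h1 with h | h | h | ⟨i, j, hi, hj, hk⟩
    · exact Or.inr (Or.inl (by omega))
    · exact Or.inr (Or.inr (Or.inl (by omega)))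
    · exact Or.inl (by omega)
    · refine Or.inr (Or.inr (Or.inr ⟨by omega, by omega, ?_⟩))
      have := π.le i j
      omega

namespace IsHeight

variable {a b c : ℕ} {h : ℤ → ℤ → ℤ}

theorem le_left (H : IsHeight a b c h) {α α' : ℤ} (β : ℤ) (hα : α ≤ α') : h α' β ≤ h α β :=
  antitone_int_of_succ_le (f := fun α => h α β) (fun α => H.anti_left α β) hα

theorem le_right (H : IsHeight a b c h) (α : ℤ) {β β' : ℤ} (hβ : β ≤ β') : h α β' ≤ h α β :=
  antitone_int_of_succ_le (f := fun β => h α β) (fun β => H.anti_right α β) hβ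

/-- A height function is the height function of a plane partition. -/
theorem exists_planePartition (H : IsHeight a b c h) :
    ∃ π : PlanePartition a b c, heightOf π = h := by
  -- The cube `(i, j, z)` lies on the line through `(i - z, j - z, 0)`, hence belongs to the pile
  -- when `z < h (i - z) (j - z)`. By `diag` these `z` form an initial segment, whose length is the
  -- entry of the partition.
  have key : ∀ (i : Fin a) (j : Fin b), ∃ t : ℕ, t ≤ c ∧
      ∀ z : ℕ, (z : ℤ) < h (i - z) (j - z) ↔ z < t := by
    intro i j
    have hex : ∃ z : ℕ, ¬ (z : ℤ) < h (i - z) (j - z) := ⟨c, by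
      have := H.upper (i - c) (j - c)
      omega⟩
    classical
    have hanti : ∀ z : ℕ, ((z + 1 : ℕ) : ℤ) < h (i - (z + 1 : ℕ)) (j - (z + 1 : ℕ)) →
        (z : ℤ) < h (i - z) (j - z) := by
      intro z hz
      have := H.diag (i - (z + 1 : ℕ)) (j - (z + 1 : ℕ))
      push_cast at this hz
      rw [show (i : ℤ) - (z + 1) + 1 = i - z by ring, show (j : ℤ) - (z + 1) + 1 = j - z by ring]
        at this
      omega
    refine ⟨Nat.find hex, Nat.find_min' hex ?_, fun z => ⟨fun hz => ?_, fun hz => ?_⟩⟩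
    · have := H.upper (i - c) (j - c)
      omega
    · by_contra hcon
      rw [not_lt] at hcon
      obtain ⟨d, rfl⟩ := Nat.exists_eq_add_of_le hcon
      have : ∀ d : ℕ, ((Nat.find hex + d : ℕ) : ℤ) <
          h (i - (Nat.find hex + d : ℕ)) (j - (Nat.find hex + d : ℕ)) → False := by
        intro d
        induction d with
        | zero => exact Nat.find_spec hex
        | succ d ih => exact fun hd => ih (hanti _ hd)
      exact this d hz
    · exact not_not.1 (Nat.find_min hex hz)
  choose t htc ht using key
  have hanti : ∀ i i' j j', i ≤ i' → j ≤ j' → t i' j' ≤ t i j := by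
    intro i i' j j' hi hj
    by_contra hcon
    rw [not_le, ← ht] at hcon
    refine lt_irrefl _ ((ht i j _).1 (hcon.trans_le ?_))
    rw [Fin.le_def] at hi hj
    exact (H.le_left _ (by omega)).trans (H.le_right _ (by omega))
  obtain ⟨π, hπ⟩ : ∃ π : PlanePartition a b c, ∀ i j, π.1 i j = t i j :=
    ⟨⟨t, htc, hanti⟩, fun _ _ => rfl⟩
  refine ⟨π, ?_⟩
  · funext α β
    have hiff : ∀ z, z < heightOf π α β ↔ z < h α β := by
      intro z
      rw [← inPile_add_iff]
      have hl := H.lower α β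
      have hu := H.upper α β
      constructor
      · rintro (hz | hz | hz | ⟨i, j, hi, hj, hk⟩)
        · omega
        · omega
        · omega
        · by_cases hz : z < 0
          · omega
          lift z to ℕ using by omega
          have := (ht i j z).2 (by rw [hπ] at hk; exact_mod_cast hk)
          rwa [show (i : ℤ) - z = α by omega, show (j : ℤ) - z = β by omega] at this
      · intro hz
        by_cases hx : α + z < 0
        · exact Or.inl hx
        by_cases hy : β + z < 0
        · exact Or.inr (Or.inl hy)
        by_cases hz0 : z < 0
        · exact Or.inr (Or.inr (Or.inl hz0))
        refine Or.inr (Or.inr (Or.inr ⟨⟨(α + z).toNat, by omega⟩, ⟨(β + z).toNat, by omega⟩,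
          by simp; omega, by simp; omega, ?_⟩))
        rw [hπ]
        lift z to ℕ using by omega
        have := (ht ⟨(α + z).toNat, by omega⟩ ⟨(β + z).toNat, by omega⟩ z).1 (by
          dsimp only
          rwa [show (((α + z).toNat : ℕ) : ℤ) - z = α by omega,
            show (((β + z).toNat : ℕ) : ℤ) - z = β by omega])
        exact_mod_cast this
    have h1 := hiff (h α β)
    have h2 := hiff (h α β - 1)
    omega

end IsHeight

/-- The height function determines the pile, and the cube at level `π'.1 i j` of a column detects
whether `π` is larger there. -/
theorem heightOf_injective {a b c : ℕ} :
    Function.Injective (heightOf : PlanePartition a b c → ℤ → ℤ → ℤ) := by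
  intro π π' hh
  have key : ∀ π π' : PlanePartition a b c, heightOf π = heightOf π' →
      ∀ i j, π.1 i j ≤ π'.1 i j := by
    intro π π' hh i j
    by_contra hcon
    rw [not_le] at hcon
    have h1 : InPile π i j (π'.1 i j) := Or.inr (Or.inr (Or.inr ⟨i, j, rfl, rfl, by omega⟩))
    rw [inPile_iff, hh, ← inPile_iff] at h1
    rcases h1 with h | h | h | ⟨i', j', hi, hj, hk⟩
    · omega
    · omega
    · omega
    · have e1 : i = i' := Fin.ext (by omega)
      have e2 : j = j' := Fin.ext (by omega)
      subst e1 e2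
      omega
  exact Subtype.ext (funext fun i => funext fun j =>
    le_antisymm (key π π' hh i j) (key π' π hh.symm i j))

/-- The lozenges of the tiling with height function `h`. -/
def LozengeRel (a c : ℕ) (h : ℤ → ℤ → ℤ) (u v : ℤ × ℤ × ℤ) : Prop :=
  (v = u + (1, 0, 0) ∧ h (a - 1 - v.2.1) (v.1 - c) = h (a - v.2.1) (v.1 - c) + 1) ∨
  (v = u + (0, 1, 0) ∧ h (a - v.2.1) (v.1 - c) = h (a - v.2.1) (v.1 - c + 1) + 1) ∨
  (v = u + (0, 0, 1) ∧ h (a - 1 - v.2.1) (v.1 - c) = h (a - v.2.1) (v.1 - c + 1))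

end FullyPackedLoops

namespace FullyPackedLoops

/-! ### Lozenge tilings and height functions -/

/-- A triangle at which the sum of the strip numbers is `a + b + c - 1` has corners `(α, β)`, `(α +
1, β)`, `(α + 1, β + 1)`. The three alternatives say which of its sides is crossed by a lozenge. -/
theorem lozengeRel_upper_iff {a c : ℕ} {h : ℤ → ℤ → ℤ} {u : ℤ × ℤ × ℤ} {p q r α β : ℤ}
    (hα : α = a - 1 - q) (hβ : β = p - c) :
    LozengeRel a c h u (p, q, r) ↔
      (u = (p - 1, q, r) ∧ h α β = h (α + 1) β + 1) ∨
      (u = (p, q - 1, r) ∧ h (α + 1) β = h (α + 1) (β + 1) + 1) ∨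
      (u = (p, q, r - 1) ∧ h α β = h (α + 1) (β + 1)) := by
  obtain ⟨p', q', r'⟩ := u
  subst hα hβ
  simp only [LozengeRel, Prod.mk_add_mk, Prod.mk.injEq, add_zero,
    show (a : ℤ) - 1 - q + 1 = a - q by ring]
  refine or_congr (and_congr_left fun _ => ?_) (or_congr (and_congr_left fun _ => ?_)
    (and_congr_left fun _ => ?_)) <;> omega

/-- For the other orientation, with sum `a + b + c - 2`, the corners are `(α, β)`, `(α, β + 1)`, `(α
+ 1, β + 1)`. -/
theorem lozengeRel_lower_iff {a c : ℕ} {h : ℤ → ℤ → ℤ} {v : ℤ × ℤ × ℤ} {p q r α β : ℤ}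
    (hα : α = a - 1 - q) (hβ : β = p - c) :
    LozengeRel a c h (p, q, r) v ↔
      (v = (p + 1, q, r) ∧ h α (β + 1) = h (α + 1) (β + 1) + 1) ∨
      (v = (p, q + 1, r) ∧ h α β = h α (β + 1) + 1) ∨
      (v = (p, q, r + 1) ∧ h α β = h (α + 1) (β + 1)) := by
  subst hα hβ
  simp only [LozengeRel, Prod.mk_add_mk, add_zero]
  refine or_congr (and_congr_right ?_) (or_congr (and_congr_right ?_) (and_congr_right ?_)) <;>
    rintro rfl <;> dsimp only
  · rw [show p + 1 - (c : ℤ) = p - c + 1 by ring, show (a : ℤ) - 1 - q + 1 = a - q by ring]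
  · rw [show (a : ℤ) - (q + 1) = a - 1 - q by ring]
  · rw [show (a : ℤ) - 1 - q + 1 = a - q by ring]

/-- The lozenge tiling with height function `h`, as a set of edges of the hexagonal graph. -/
def tilingOf (a b c : ℕ) (h : ℤ → ℤ → ℤ) : (hexGraph a b c).Subgraph where
  verts := Set.univ
  Adj u v := LozengeRel a c h u.1 v.1 ∨ LozengeRel a c h v.1 u.1
  adj_sub := by
    rintro u v (h | h)
    · exact Or.inl (by rcases h with h | h | h <;> simp [UnitStep, h.1])
    · exact Or.inr (by rcases h with h | h | h <;> simp [UnitStep, h.1])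
  edge_vert _ := Set.mem_univ _
  symm := ⟨fun _ _ h => h.symm⟩

theorem LozengeRel.sum {a c : ℕ} {h : ℤ → ℤ → ℤ} {u v : ℤ × ℤ × ℤ} (H : LozengeRel a c h u v) :
    v.1 + v.2.1 + v.2.2 = u.1 + u.2.1 + u.2.2 + 1 := by
  rcases H with H | H | H <;> rw [H.1] <;> simp <;> ring

/-- In a triangle the drops of `h` along the two short sides are nonnegative and add up to the drop
along the diagonal side, which is `0` or `1`. So exactly one of the three crossings occurs. It does
not lead out of the hexagon, because on the border the bounds of `IsHeight` leave only the heights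
of the walls. -/
theorem isPerfectMatching_tilingOf {a b c : ℕ} {h : ℤ → ℤ → ℤ} (H : IsHeight a b c h) :
    (tilingOf a b c h).IsPerfectMatching := by
  refine ⟨fun v _ => ?_, fun _ => Set.mem_univ _⟩
  obtain ⟨⟨p, q, r⟩, ⟨hp0, hp⟩, ⟨hq0, hq⟩, ⟨hr0, hr⟩, hs⟩ := v
  simp only at hp0 hp hq0 hq hr0 hr hs
  obtain ⟨α, hα⟩ : ∃ α : ℤ, α = a - 1 - q := ⟨_, rfl⟩
  obtain ⟨β, hβ⟩ : ∃ β : ℤ, β = p - c := ⟨_, rfl⟩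
  have a1 := H.anti_left α β
  have a2 := H.anti_right (α + 1) β
  have a3 := H.diag α β
  have a4 := H.anti_right α β
  have a5 := H.anti_left α (β + 1)
  have l1 := H.lower α β
  have l2 := H.lower (α + 1) β
  have l3 := H.lower (α + 1) (β + 1)
  have l4 := H.lower α (β + 1)
  have u1 := H.upper α β
  have u2 := H.upper (α + 1) β
  have u3 := H.upper (α + 1) (β + 1)
  have u4 := H.upper α (β + 1)
  change ∃! w : HexVertex a b c, LozengeRel a c h (p, q, r) w.1 ∨ LozengeRel a c h w.1 (p, q, r)
  rcases hs with hs | hs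
  · have key : ∀ w : HexVertex a b c, (LozengeRel a c h (p, q, r) w.1 ∨
        LozengeRel a c h w.1 (p, q, r)) ↔ LozengeRel a c h (p, q, r) w.1 := by
      refine fun w => ⟨fun hw => hw.resolve_right fun hw' => ?_, Or.inl⟩
      have h1 := hw'.sum
      have h2 := w.2.2.2.2
      simp only at h1
      omega
    rw [existsUnique_congr fun w => (key w).trans (lozengeRel_lower_iff hα hβ)]
    by_cases t3 : h α β = h (α + 1) (β + 1)
    · refine ⟨⟨(p, q, r + 1), ⟨hp0, hp⟩, ⟨hq0, hq⟩, ⟨by dsimp only; omega, by dsimp only; omega⟩,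
        Or.inr (by dsimp only; omega)⟩, Or.inr (Or.inr ⟨rfl, t3⟩), ?_⟩
      rintro w (hw | hw | hw)
      · omega
      · omega
      · exact Subtype.ext hw.1
    by_cases t2 : h α β = h α (β + 1) + 1
    · refine ⟨⟨(p, q + 1, r), ⟨hp0, hp⟩, ⟨by dsimp only; omega, by dsimp only; omega⟩, ⟨hr0, hr⟩,
        Or.inr (by dsimp only; omega)⟩, Or.inr (Or.inl ⟨rfl, t2⟩), ?_⟩
      rintro w (hw | hw | hw)
      · omega
      · exact Subtype.ext hw.1
      · omega
    · refine ⟨⟨(p + 1, q, r), ⟨by dsimp only; omega, by dsimp only; omega⟩, ⟨hq0, hq⟩, ⟨hr0, hr⟩,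
        Or.inr (by dsimp only; omega)⟩, Or.inl ⟨rfl, by omega⟩, ?_⟩
      rintro w (hw | hw | hw)
      · exact Subtype.ext hw.1
      · omega
      · omega
  · have key : ∀ w : HexVertex a b c, (LozengeRel a c h (p, q, r) w.1 ∨
        LozengeRel a c h w.1 (p, q, r)) ↔ LozengeRel a c h w.1 (p, q, r) := by
      refine fun w => ⟨fun hw => hw.resolve_left fun hw' => ?_, Or.inr⟩
      have h1 := hw'.sum
      have h2 := w.2.2.2.2
      simp only at h1
      omega
    rw [existsUnique_congr fun w => (key w).trans (lozengeRel_upper_iff hα hβ)]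
    by_cases t3 : h α β = h (α + 1) (β + 1)
    · refine ⟨⟨(p, q, r - 1), ⟨hp0, hp⟩, ⟨hq0, hq⟩, ⟨by dsimp only; omega, by dsimp only; omega⟩,
        Or.inl (by dsimp only; omega)⟩, Or.inr (Or.inr ⟨rfl, t3⟩), ?_⟩
      rintro w (hw | hw | hw)
      · omega
      · omega
      · exact Subtype.ext hw.1
    by_cases t2 : h (α + 1) β = h (α + 1) (β + 1) + 1
    · refine ⟨⟨(p, q - 1, r), ⟨hp0, hp⟩, ⟨by dsimp only; omega, by dsimp only; omega⟩, ⟨hr0, hr⟩,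
        Or.inl (by dsimp only; omega)⟩, Or.inr (Or.inl ⟨rfl, t2⟩), ?_⟩
      rintro w (hw | hw | hw)
      · omega
      · exact Subtype.ext hw.1
      · omega
    · refine ⟨⟨(p - 1, q, r), ⟨by dsimp only; omega, by dsimp only; omega⟩, ⟨hq0, hq⟩, ⟨hr0, hr⟩,
        Or.inl (by dsimp only; omega)⟩, Or.inl ⟨rfl, by omega⟩, ?_⟩
      rintro w (hw | hw | hw)
      · exact Subtype.ext hw.1
      · omega
      · omega

end FullyPackedLoops

/-! ### The height function of a perfect matching -/

namespace FullyPackedLoops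

/-- The height function of the empty pile. -/
def wallHeight (α β : ℤ) : ℤ := max 0 (max (-α) (-β))

/-- Outside the interior of the hexagon the line of direction `(1, 1, 1)` has no room in the box
above the walls. -/
theorem IsHeight.eq_wallHeight {a b c : ℕ} {h : ℤ → ℤ → ℤ} (H : IsHeight a b c h) {α β : ℤ}
    (hout : β ≤ -c ∨ b ≤ β ∨ a ≤ α ∨ α ≤ -c ∨ α - β ≤ -b ∨ a ≤ α - β) :
    h α β = wallHeight α β := by
  have l := H.lower α β
  have u := H.upper α β
  unfold wallHeight
  omega

/-- The triangles of the hexagon. -/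
def IsHexPoint (a b c : ℕ) (v : ℤ × ℤ × ℤ) : Prop :=
  (0 ≤ v.1 ∧ v.1 < b + c) ∧ (0 ≤ v.2.1 ∧ v.2.1 < c + a) ∧ (0 ≤ v.2.2 ∧ v.2.2 < a + b) ∧
    (v.1 + v.2.1 + v.2.2 = a + b + c - 2 ∨ v.1 + v.2.1 + v.2.2 = a + b + c - 1)

/-- The lozenges across the diagonal sides tell whether `h α β` and `h (α + 1) (β + 1)` are equal or
differ by `1`. Hence the tiling determines `h` along each diagonal, starting from `α ≥ a`, where `h`
is the height of the walls. -/
theorem tilingOf_injective {a b c : ℕ} {h h' : ℤ → ℤ → ℤ} (H : IsHeight a b c h)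
    (H' : IsHeight a b c h') (heq : tilingOf a b c h = tilingOf a b c h') : h = h' := by
  have key : ∀ N : ℕ, ∀ α β : ℤ, (a : ℤ) - α ≤ N → h α β = h' α β := by
    intro N
    induction N with
    | zero =>
      intro α β hN
      rw [H.eq_wallHeight (by omega), H'.eq_wallHeight (by omega)]
    | succ N ih =>
      intro α β hN
      by_cases hout : β ≤ -c ∨ b ≤ β ∨ a ≤ α ∨ α ≤ -c ∨ α - β ≤ -b ∨ a ≤ α - β
      · rw [H.eq_wallHeight hout, H'.eq_wallHeight hout]
      · have hnext := ih (α + 1) (β + 1) (by push_cast at hN; omega)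
        have hadj : (tilingOf a b c h).Adj
            ⟨(β + c, a - 1 - α, b - 1 + α - β), by dsimp only; omega⟩
            ⟨(β + c, a - 1 - α, b + α - β), by dsimp only; omega⟩ ↔ (tilingOf a b c h').Adj
            ⟨(β + c, a - 1 - α, b - 1 + α - β), by dsimp only; omega⟩
            ⟨(β + c, a - 1 - α, b + α - β), by dsimp only; omega⟩ := by rw [heq]
        have hrel : ∀ h : ℤ → ℤ → ℤ, (tilingOf a b c h).Adj
            ⟨(β + c, a - 1 - α, b - 1 + α - β), by dsimp only; omega⟩
            ⟨(β + c, a - 1 - α, b + α - β), by dsimp only; omega⟩ ↔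
              h α β = h (α + 1) (β + 1) := by
          intro h
          refine Iff.trans (b := LozengeRel a c h (β + c, a - 1 - α, b - 1 + α - β)
            (β + c, a - 1 - α, b + α - β)) ⟨fun hw => hw.resolve_right fun hw' => ?_, Or.inl⟩ ?_
          · have := hw'.sum
            dsimp only at this
            omega
          · rw [lozengeRel_lower_iff (α := α) (β := β) (by omega) (by omega)]
            simp only [Prod.mk.injEq]
            refine ⟨fun hw => ?_, fun hw => Or.inr (Or.inr ⟨⟨trivial, trivial, by ring⟩, hw⟩)⟩
            rcases hw with hw | hw | hw <;> omega
        rw [hrel, hrel] at hadj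
        have d := H.diag α β
        have d' := H'.diag α β
        have e := (H.anti_left α β).trans' (H.anti_right (α + 1) β)
        have e' := (H'.anti_left α β).trans' (H'.anti_right (α + 1) β)
        omega
  funext α β
  exact key (a - α).toNat α β (by omega)

section OfMatching

variable {a b c : ℕ} (M : (hexGraph a b c).Subgraph)

/-- Two triangles which are matched. -/
def Matched (u v : ℤ × ℤ × ℤ) : Prop :=
  ∃ (hu : IsHexPoint a b c u) (hv : IsHexPoint a b c v), M.Adj ⟨u, hu⟩ ⟨v, hv⟩

open Classical in
/-- The indicator of the matched pairs. -/
noncomputable def matchInd (u v : ℤ × ℤ × ℤ) : ℤ := if Matched M u v then 1 else 0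

variable {M}

theorem matchInd_eq_zero_left {u v : ℤ × ℤ × ℤ} (hu : ¬ IsHexPoint a b c u) :
    matchInd M u v = 0 := if_neg fun h => hu h.1

theorem matchInd_eq_zero_right {u v : ℤ × ℤ × ℤ} (hv : ¬ IsHexPoint a b c v) :
    matchInd M u v = 0 := if_neg fun h => hv h.2.1

theorem matchInd_cases (u v : ℤ × ℤ × ℤ) : 0 ≤ matchInd M u v ∧ matchInd M u v ≤ 1 := by
  unfold matchInd
  split_ifs <;> omega

theorem sum_matchInd_upper (hM : M.IsPerfectMatching) {p q r : ℤ}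
    (hv : IsHexPoint a b c (p, q, r)) (hs : p + q + r = a + b + c - 1) :
    matchInd M (p - 1, q, r) (p, q, r) + matchInd M (p, q - 1, r) (p, q, r) +
      matchInd M (p, q, r - 1) (p, q, r) = 1 := by
  obtain ⟨w, hw, huniq⟩ := hM.1 (hM.2 ⟨(p, q, r), hv⟩)
  have hmem : ∀ u, Matched M u (p, q, r) ↔ u = w.1 := by
    refine fun u => ⟨fun ⟨hu, _, hadj⟩ => ?_, fun h => ?_⟩
    · rw [← huniq ⟨u, hu⟩ hadj.symm]
    · subst h
      exact ⟨w.2, hv, hw.symm⟩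
  have hstep : w.1 = (p - 1, q, r) ∨ w.1 = (p, q - 1, r) ∨ w.1 = (p, q, r - 1) := by
    obtain ⟨⟨p', q', r'⟩, hw'⟩ := w
    have h2 := hw'.2.2.2
    rcases M.adj_sub hw with h | h <;> rcases h with h | h | h <;>
      simp only [Prod.mk_add_mk, Prod.mk.injEq, add_zero] at h ⊢ <;> dsimp only at h2 <;> omega
  unfold matchInd
  simp only [hmem]
  rcases hstep with h | h | h <;> rw [h] <;> simp

theorem sum_matchInd_lower (hM : M.IsPerfectMatching) {p q r : ℤ}
    (hv : IsHexPoint a b c (p, q, r)) (hs : p + q + r = a + b + c - 2) :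
    matchInd M (p, q, r) (p + 1, q, r) + matchInd M (p, q, r) (p, q + 1, r) +
      matchInd M (p, q, r) (p, q, r + 1) = 1 := by
  obtain ⟨w, hw, huniq⟩ := hM.1 (hM.2 ⟨(p, q, r), hv⟩)
  have hmem : ∀ u, Matched M (p, q, r) u ↔ u = w.1 := by
    refine fun u => ⟨fun ⟨_, hu, hadj⟩ => ?_, fun h => ?_⟩
    · rw [← huniq ⟨u, hu⟩ hadj]
    · subst h
      exact ⟨hv, w.2, hw⟩
  have hstep : w.1 = (p + 1, q, r) ∨ w.1 = (p, q + 1, r) ∨ w.1 = (p, q, r + 1) := by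
    obtain ⟨⟨p', q', r'⟩, hw'⟩ := w
    have h2 := hw'.2.2.2
    rcases M.adj_sub hw with h | h <;> rcases h with h | h | h <;>
      simp only [Prod.mk_add_mk, Prod.mk.injEq, add_zero] at h ⊢ <;> dsimp only at h2 <;> omega
  unfold matchInd
  simp only [hmem]
  rcases hstep with h | h | h <;> rw [h] <;> simp

open Classical in
/-- The indicator of the matched pairs, extended to the plane by the tiling of the empty room;
`d` is the value outside the hexagon. -/
noncomputable def crossing (M : (hexGraph a b c).Subgraph) (u v : ℤ × ℤ × ℤ) (d : ℤ) : ℤ :=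
  if IsHexPoint a b c u ∧ IsHexPoint a b c v then matchInd M u v else d

/-- Meant for the sides of a triangle of the hexagon. There the default value vanishes on the
border, as no lozenge of the walls sticks out of the hexagon, and so does the indicator. -/
theorem crossing_eq_matchInd {u v : ℤ × ℤ × ℤ} {d : ℤ}
    (h : ¬ (IsHexPoint a b c u ∧ IsHexPoint a b c v) → d = 0) :
    crossing M u v d = matchInd M u v := by
  unfold crossing
  split_ifs with h1
  · rfl
  · rw [h h1]
    by_cases hu : IsHexPoint a b c u
    · exact (matchInd_eq_zero_right fun hv => h1 ⟨hu, hv⟩).symm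
    · exact (matchInd_eq_zero_left hu).symm

variable (M)

/-- Whether the tiling crosses the edge from `(α, β)` to `(α + 1, β)`. -/
noncomputable def crossingLeft (α β : ℤ) : ℤ :=
  crossing M (β + c - 1, a - 1 - α, b + α - β) (β + c, a - 1 - α, b + α - β)
    (wallHeight α β - wallHeight (α + 1) β)

/-- Whether the tiling crosses the edge from `(α, β)` to `(α, β + 1)`. -/
noncomputable def crossingRight (α β : ℤ) : ℤ :=
  crossing M (β + c, a - 1 - α, b - 1 + α - β) (β + c, a - α, b - 1 + α - β)
    (wallHeight α β - wallHeight α (β + 1))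

/-- Whether the tiling crosses the edge from `(α, β)` to `(α + 1, β + 1)`. -/
noncomputable def crossingDiag (α β : ℤ) : ℤ :=
  crossing M (β + c, a - 1 - α, b - 1 + α - β) (β + c, a - 1 - α, b + α - β)
    (1 - (wallHeight α β - wallHeight (α + 1) (β + 1)))

variable {M}

/-- Inside the hexagon this holds because the triangle is matched exactly once; outside, the three
default values are differences of `wallHeight` and cancel. Together with `crossing_lower` it makes
the sum that defines the height independent of the path. -/
theorem crossing_upper (hM : M.IsPerfectMatching) (α β : ℤ) :
    crossingDiag M α β + crossingLeft M α β + crossingRight M (α + 1) β = 1 := by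
  unfold crossingDiag crossingLeft crossingRight
  rw [show (a : ℤ) - 1 - (α + 1) = a - 1 - α - 1 by ring,
    show (b : ℤ) - 1 + (α + 1) - β = b + α - β by ring, show (a : ℤ) - (α + 1) = a - 1 - α by ring]
  by_cases hv : IsHexPoint a b c (β + c, a - 1 - α, b + α - β)
  · rw [crossing_eq_matchInd, crossing_eq_matchInd, crossing_eq_matchInd]
    · have := sum_matchInd_upper hM hv (by ring)
      rw [show (b : ℤ) - 1 + α - β = b + α - β - 1 by ring]
      omega
    all_goals
      intro hn
      simp only [IsHexPoint] at hn hv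
      simp only [wallHeight]
      omega
  · simp only [crossing, hv, and_false, if_false]
    ring

theorem crossing_lower (hM : M.IsPerfectMatching) (α β : ℤ) :
    crossingDiag M α β + crossingRight M α β + crossingLeft M α (β + 1) = 1 := by
  unfold crossingDiag crossingLeft crossingRight
  rw [show β + 1 + (c : ℤ) - 1 = β + c by ring, show β + 1 + (c : ℤ) = β + c + 1 by ring,
    show (b : ℤ) + α - (β + 1) = b - 1 + α - β by ring]
  by_cases hv : IsHexPoint a b c (β + c, a - 1 - α, b - 1 + α - β)
  · rw [crossing_eq_matchInd, crossing_eq_matchInd, crossing_eq_matchInd]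
    · have := sum_matchInd_lower hM hv (by ring)
      rw [show (b : ℤ) + α - β = b - 1 + α - β + 1 by ring, show (a : ℤ) - α = a - 1 - α + 1 by ring]
      omega
    all_goals
      intro hn
      simp only [IsHexPoint] at hn hv
      simp only [wallHeight]
      omega
  · simp only [crossing, hv, false_and, if_false]
    ring

theorem crossing_nonneg {u v : ℤ × ℤ × ℤ} {d : ℤ} (hd : 0 ≤ d) : 0 ≤ crossing M u v d := by
  unfold crossing
  split_ifs
  · exact (matchInd_cases u v).1
  · exact hd

theorem crossing_eq_of_not {u v : ℤ × ℤ × ℤ} {d : ℤ}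
    (h : ¬ (IsHexPoint a b c u ∧ IsHexPoint a b c v)) : crossing M u v d = d := if_neg h

variable (M)

/-- The height function of a perfect matching, obtained by following the lines of direction
`(0, 0, 1)` from the floor. -/
noncomputable def matchingHeight (α β : ℤ) : ℤ :=
  wallHeight (α + (a - α).toNat) (β + (a - α).toNat) +
    ∑ i ∈ Finset.range (a - α).toNat, (1 - crossingDiag M (α + i) (β + i))

variable {M}

theorem matchingHeight_of_le {α : ℤ} (β : ℤ) (hα : (a : ℤ) ≤ α) :
    matchingHeight M α β = wallHeight α β := by
  unfold matchingHeight
  rw [show ((a : ℤ) - α).toNat = 0 by omega]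
  simp

theorem matchingHeight_diag (α β : ℤ) :
    matchingHeight M α β = matchingHeight M (α + 1) (β + 1) + 1 - crossingDiag M α β := by
  by_cases hα : (a : ℤ) ≤ α
  · rw [matchingHeight_of_le _ hα, matchingHeight_of_le _ (by omega), crossingDiag,
      crossing_eq_of_not]
    · ring
    · simp only [IsHexPoint]
      omega
  · unfold matchingHeight
    rw [show ((a : ℤ) - α).toNat = ((a : ℤ) - (α + 1)).toNat + 1 by omega,
      Finset.sum_range_succ']
    push_cast
    simp only [add_zero, add_assoc, add_comm (1 : ℤ)]
    ring

/-- The parallelogram with corners `(α, β)`, `(α, β + 1)`, `(α + 1, β + 2)`, `(α + 1, β + 1)`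
consists of a lower and an upper triangle. Their crossing identities transfer the claim from `(α +
1, β + 1)` to `(α, β)`. -/
theorem matchingHeight_right (hM : M.IsPerfectMatching) (α β : ℤ) :
    matchingHeight M α β - matchingHeight M α (β + 1) = crossingRight M α β := by
  have key : ∀ N : ℕ, ∀ α β : ℤ, (a : ℤ) - α ≤ N →
      matchingHeight M α β - matchingHeight M α (β + 1) = crossingRight M α β := by
    intro N
    induction N with
    | zero =>
      intro α β hN
      rw [matchingHeight_of_le _ (by omega), matchingHeight_of_le _ (by omega), crossingRight,
        crossing_eq_of_not]
      simp only [IsHexPoint]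
      omega
    | succ N ih =>
      intro α β hN
      have h1 := ih (α + 1) (β + 1) (by push_cast at hN; omega)
      have h2 := matchingHeight_diag (M := M) α β
      have h3 := matchingHeight_diag (M := M) α (β + 1)
      have h4 := crossing_upper hM α (β + 1)
      have h5 := crossing_lower hM α β
      omega
  exact key (a - α).toNat α β (by omega)

theorem matchingHeight_left (hM : M.IsPerfectMatching) (α β : ℤ) :
    matchingHeight M α β - matchingHeight M (α + 1) β = crossingLeft M α β := by
  have h1 := matchingHeight_right hM (α + 1) β
  have h2 := matchingHeight_diag (M := M) α β
  have h3 := crossing_upper hM α β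
  omega

/-- Outside the hexagon the height is that of the walls. -/
theorem matchingHeight_eq_wallHeight (hM : M.IsPerfectMatching) {α β : ℤ}
    (hout : β ≤ -c ∨ b ≤ β ∨ α ≤ -c) : matchingHeight M α β = wallHeight α β := by
  -- The known values propagate along edges outside the hexagon: from `a ≤ α` to `b ≤ β` along the
  -- diagonals, from there to `α ≤ -c` by steps in `β`, and from `a ≤ α` to `β ≤ -c` by steps in
  -- `α`.
  have h1 : ∀ N : ℕ, ∀ α β : ℤ, (a : ℤ) - α ≤ N → b ≤ β →
      matchingHeight M α β = wallHeight α β := by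
    intro N
    induction N with
    | zero => exact fun α β hN _ => matchingHeight_of_le _ (by omega)
    | succ N ih =>
      intro α β hN hβ
      rw [matchingHeight_diag, ih _ _ (by push_cast at hN; omega) (by omega), crossingDiag,
        crossing_eq_of_not]
      · ring
      · simp only [IsHexPoint]
        omega
  have h2 : ∀ N : ℕ, ∀ α β : ℤ, (b : ℤ) - β ≤ N → α ≤ -c →
      matchingHeight M α β = wallHeight α β := by
    intro N
    induction N with
    | zero => exact fun α β hN _ => h1 (a - α).toNat _ _ (by omega) (by omega)
    | succ N ih =>
      intro α β hN hα
      have h3 := matchingHeight_right hM α β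
      rw [ih _ (β + 1) (by push_cast at hN; omega) hα, crossingRight, crossing_eq_of_not] at h3
      · omega
      · simp only [IsHexPoint]
        omega
  have h3 : ∀ N : ℕ, ∀ α β : ℤ, (a : ℤ) - α ≤ N → β ≤ -c →
      matchingHeight M α β = wallHeight α β := by
    intro N
    induction N with
    | zero => exact fun α β hN _ => matchingHeight_of_le _ (by omega)
    | succ N ih =>
      intro α β hN hβ
      have h3 := matchingHeight_left hM α β
      rw [ih (α + 1) _ (by push_cast at hN; omega) hβ, crossingLeft, crossing_eq_of_not] at h3
      · omega
      · simp only [IsHexPoint]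
        omega
  rcases hout with h | h | h
  · exact h3 (a - α).toNat _ _ (by omega) h
  · exact h1 (a - α).toNat _ _ (by omega) h
  · exact h2 (b - β).toNat _ _ (by omega) h

/-- Nonnegative crossings give the monotonicity. The bounds follow by comparing with points far
enough out, where the height is that of the walls. -/
theorem isHeight_matchingHeight (hM : M.IsPerfectMatching) :
    IsHeight a b c (matchingHeight M) := by
  have hl : ∀ α β, matchingHeight M (α + 1) β ≤ matchingHeight M α β := fun α β => by
    have h1 := matchingHeight_left hM α β
    have h2 : 0 ≤ crossingLeft M α β := crossing_nonneg (by simp only [wallHeight]; omega)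
    omega
  have hr : ∀ α β, matchingHeight M α (β + 1) ≤ matchingHeight M α β := fun α β => by
    have h1 := matchingHeight_right hM α β
    have h2 : 0 ≤ crossingRight M α β := crossing_nonneg (by simp only [wallHeight]; omega)
    omega
  have hd : ∀ α β, matchingHeight M α β ≤ matchingHeight M (α + 1) (β + 1) + 1 := fun α β => by
    have h1 := matchingHeight_diag (M := M) α β
    have h2 : 0 ≤ crossingDiag M α β := crossing_nonneg (by simp only [wallHeight]; omega)
    omega
  have hl' : ∀ β, Antitone fun α => matchingHeight M α β := fun β =>
    antitone_int_of_succ_le fun α => hl α β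
  have hr' : ∀ α, Antitone fun β => matchingHeight M α β := fun α =>
    antitone_int_of_succ_le fun β => hr α β
  have hd' : ∀ α β, Monotone fun τ => matchingHeight M (α + τ) (β + τ) + τ := fun α β =>
    monotone_int_of_le_succ fun τ => by
      have := hd (α + τ) (β + τ)
      simp only [← add_assoc]
      omega
  refine ⟨hl, hr, hd, fun α β => ?_, fun α β => ?_⟩
  · have h1 := hl' β (show α ≤ max α a by omega)
    have h2 := hr' α (show β ≤ max β b by omega)
    simp only at h1 h2
    rw [matchingHeight_of_le _ (by omega)] at h1
    rw [matchingHeight_eq_wallHeight hM (by omega)] at h2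
    simp only [wallHeight] at h1 h2
    omega
  · by_contra hcon
    have hx := hl' β (show α ≤ max α a by omega)
    have hy := hr' α (show β ≤ max β b by omega)
    simp only at hx hy
    rw [matchingHeight_of_le _ (by omega)] at hx
    rw [matchingHeight_eq_wallHeight hM (by omega)] at hy
    simp only [wallHeight] at hx hy
    -- If the height is not a wall height, `(α + τ, β + τ, τ)` is the last cube on the line, with
    -- nonnegative coordinates. Moving to the coordinate planes through it keeps the height above
    -- that of the walls, so each of its coordinates is smaller than the corresponding side of the
    -- box.
    obtain ⟨τ, hτ⟩ : ∃ τ, τ = matchingHeight M α β - 1 := ⟨_, rfl⟩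
    have e1 := hd' α β (show (0 : ℤ) ≤ τ by omega)
    simp only [add_zero] at e1
    have e2 := hr' (α + τ) (show 0 ≤ β + τ by omega)
    have e3 := hl' (β + τ) (show 0 ≤ α + τ by omega)
    have e4 := hl' β (show -τ ≤ α by omega)
    have e5 := hr' (-τ) (show -τ ≤ β by omega)
    simp only at e2 e3 e4 e5
    have f1 : α + τ < a := by
      by_contra hneg
      rw [matchingHeight_of_le (α := α + τ) 0 (by omega)] at e2
      simp only [wallHeight] at e2
      omega
    have f2 : β + τ < b := by
      by_contra hneg
      rw [matchingHeight_eq_wallHeight hM (α := 0) (β := β + τ) (by omega)] at e3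
      simp only [wallHeight] at e3
      omega
    have f3 : τ < c := by
      by_contra hneg
      rw [matchingHeight_eq_wallHeight hM (α := -τ) (β := -τ) (by omega)] at e5
      simp only [wallHeight] at e5
      omega
    omega

end OfMatching

end FullyPackedLoops

/-! ### Recovering a matching from its height function -/

namespace FullyPackedLoops

theorem crossing_eq_one_iff {a b c : ℕ} {M : (hexGraph a b c).Subgraph} {u v : ℤ × ℤ × ℤ} {d : ℤ}
    (hu : IsHexPoint a b c u) (hv : IsHexPoint a b c v) :
    crossing M u v d = 1 ↔ M.Adj ⟨u, hu⟩ ⟨v, hv⟩ := by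
  rw [crossing, if_pos ⟨hu, hv⟩, matchInd]
  split_ifs with h
  · exact iff_of_true rfl h.2.2
  · exact iff_of_false (by norm_num) fun h' => h ⟨hu, hv, h'⟩

/-- The differences of `matchingHeight` along the three directions are given by the crossing
indicators, and on an edge inside the hexagon these are the indicators of `M`. -/
theorem tilingOf_matchingHeight {a b c : ℕ} {M : (hexGraph a b c).Subgraph}
    (hM : M.IsPerfectMatching) : tilingOf a b c (matchingHeight M) = M := by
  have key : ∀ u v : HexVertex a b c, UnitStep u.1 v.1 →
      (LozengeRel a c (matchingHeight M) u.1 v.1 ↔ M.Adj u v) := by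
    rintro ⟨⟨p, q, r⟩, hu⟩ ⟨v, hv⟩ huv
    dsimp only at huv
    rw [lozengeRel_lower_iff (α := a - 1 - q) (β := p - c) rfl rfl]
    have hs : p + q + r = a + b + c - 2 := by
      have h1 := hu.2.2.2
      have h2 := hv.2.2.2
      rcases huv with h | h | h <;> subst h <;> dsimp at h1 h2 <;> omega
    have e1 := matchingHeight_left hM (a - 1 - q) (p - c + 1)
    have e2 := matchingHeight_right hM (a - 1 - q) (p - c)
    have e3 := matchingHeight_diag (M := M) (a - 1 - q) (p - c)
    rcases huv with h | h | h
    · simp only [Prod.mk_add_mk, add_zero] at h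
      subst h
      rw [← crossing_eq_one_iff hu hv (d := wallHeight (a - 1 - q) (p - c + 1) -
        wallHeight (a - 1 - q + 1) (p - c + 1))]
      unfold crossingLeft at e1
      rw [show p - (c : ℤ) + 1 + c - 1 = p by ring, show p - (c : ℤ) + 1 + c = p + 1 by ring,
        show (a : ℤ) - 1 - (a - 1 - q) = q by ring,
        show (b : ℤ) + (a - 1 - q) - (p - c + 1) = r by omega] at e1
      rw [← e1]
      dsimp only
      constructor
      · rintro (h | h | h)
        · omega
        · simp at h
        · simp at h
      · exact fun h => Or.inl ⟨rfl, by omega⟩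
    · simp only [Prod.mk_add_mk, add_zero] at h
      subst h
      rw [← crossing_eq_one_iff hu hv (d := wallHeight (a - 1 - q) (p - c) -
        wallHeight (a - 1 - q) (p - c + 1))]
      unfold crossingRight at e2
      rw [show p - (c : ℤ) + c = p by ring, show (a : ℤ) - (a - 1 - q) = q + 1 by ring,
        show (a : ℤ) - 1 - (a - 1 - q) = q by ring,
        show (b : ℤ) - 1 + (a - 1 - q) - (p - c) = r by omega] at e2
      rw [← e2]
      dsimp only
      constructor
      · rintro (h | h | h)
        · simp at h
        · omega
        · simp at h
      · exact fun h => Or.inr (Or.inl ⟨rfl, by omega⟩)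
    · simp only [Prod.mk_add_mk, add_zero] at h
      subst h
      rw [← crossing_eq_one_iff hu hv (d := 1 - (wallHeight (a - 1 - q) (p - c) -
        wallHeight (a - 1 - q + 1) (p - c + 1)))]
      unfold crossingDiag at e3
      rw [show p - (c : ℤ) + c = p by ring,
        show (a : ℤ) - 1 - (a - 1 - q) = q by ring,
        show (b : ℤ) - 1 + (a - 1 - q) - (p - c) = r by omega,
        show (b : ℤ) + (a - 1 - q) - (p - c) = r + 1 by omega] at e3
      constructor
      · rintro (h | h | h)
        · simp at h
        · simp at h
        · omega
      · exact fun h => Or.inr (Or.inr ⟨rfl, by omega⟩)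
  have hstep : ∀ u v : HexVertex a b c, LozengeRel a c (matchingHeight M) u.1 v.1 →
      UnitStep u.1 v.1 := by
    rintro u v (h | h | h) <;> simp [UnitStep, h.1]
  refine SimpleGraph.Subgraph.ext ?_ ?_
  · exact (SimpleGraph.Subgraph.isSpanning_iff.1 hM.2).symm
  · funext u v
    refine propext ⟨fun h => ?_, fun h => ?_⟩
    · rcases h with h | h
      · exact (key u v (hstep _ _ h)).1 h
      · exact ((key v u (hstep _ _ h)).1 h).symm
    · rcases M.adj_sub h with h' | h'
      · exact Or.inl ((key u v h').2 h)
      · exact Or.inr ((key v u h').2 h.symm)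

/-! ### The picture of a plane partition -/

theorem card_filter_eq_of_iff {m : ℕ} {P : Fin m → Prop} [DecidablePred P] {t : ℕ} (ht : t ≤ m)
    (h : ∀ i : Fin m, P i ↔ (i : ℕ) < t) : (Finset.univ.filter P).card = t := by
  simp only [h]
  rw [Fin.card_filter_val_lt, min_eq_right ht]

theorem lt_card_filter_iff {m : ℕ} {P : Fin m → Prop} [DecidablePred P]
    (hP : ∀ i j : Fin m, i ≤ j → P j → P i) (i : Fin m) :
    (i : ℕ) < (Finset.univ.filter P).card ↔ P i := by
  constructor
  · intro h
    by_contra hi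
    have hsub : Finset.univ.filter P ⊆ Finset.univ.filter fun j : Fin m => (j : ℕ) < i := by
      intro j hj
      simp only [Finset.mem_filter, Finset.mem_univ, true_and] at hj ⊢
      by_contra hji
      exact hi (hP i j (by rw [Fin.le_def]; omega) hj)
    have := Finset.card_le_card hsub
    rw [Fin.card_filter_val_lt] at this
    omega
  · intro h
    have hsub : (Finset.univ.filter fun j : Fin m => (j : ℕ) < i + 1) ⊆ Finset.univ.filter P := by
      intro j hj
      simp only [Finset.mem_filter, Finset.mem_univ, true_and] at hj ⊢
      exact hP j i (by rw [Fin.le_def]; omega) h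
    have := Finset.card_le_card hsub
    rw [Fin.card_filter_val_lt] at this
    omega

theorem inPile_fin_iff {a b c : ℕ} {π : PlanePartition a b c} (i : Fin a) (j : Fin b) (k : ℕ) :
    InPile π i j k ↔ k < π.1 i j := by
  constructor
  · rintro (h | h | h | ⟨i', j', hi, hj, hk⟩)
    · omega
    · omega
    · omega
    · have e1 : i = i' := Fin.ext (by omega)
      have e2 : j = j' := Fin.ext (by omega)
      subst e1 e2
      omega
  · exact fun h => Or.inr (Or.inr (Or.inr ⟨i, j, rfl, rfl, by omega⟩))

/-- A unit square of the picture separates a cube of the pile, or behind a wall, from a cube that is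
not there. `h1` and `h2` record these two cubes. `inPile_iff` turns them into inequalities for the
height on neighbouring lines, and monotonicity makes these equalities. -/
theorem lozengeRel_of_lozengeOf {a b c : ℕ} {π : PlanePartition a b c} {u v : ℤ × ℤ × ℤ}
    (h : LozengeOf π u v) : LozengeRel a c (heightOf π) u v := by
  have H := isHeight_heightOf π
  rcases h with ⟨i, j, z, hz, rfl, rfl⟩ | ⟨j, k, t, ht, rfl, rfl⟩ | ⟨i, k, t, ht, rfl, rfl⟩
  · rw [lozengeRel_lower_iff (α := i - z) (β := j - z) (by ring) (by ring)]
    refine Or.inr (Or.inr ⟨by simp, ?_⟩)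
    have h1 : ¬ InPile π i j z := by rw [inPile_fin_iff]; omega
    have h2 : InPile π i j (z - 1) := by
      rcases Nat.eq_zero_or_pos z with h0 | h0
      · exact Or.inr (Or.inr (Or.inl (by omega)))
      · have := (inPile_fin_iff (π := π) i j (z - 1)).2 (by omega)
        rwa [Nat.cast_sub h0, Nat.cast_one] at this
    rw [inPile_iff] at h1 h2
    rw [show (i : ℤ) - (z - 1) = i - z + 1 by ring, show (j : ℤ) - (z - 1) = j - z + 1 by ring] at h2
    have h3 := H.anti_left (i - z) (j - z)
    have h4 := H.anti_right (i - z + 1) (j - z)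
    omega
  · rw [lozengeRel_lower_iff (α := t - k - 1) (β := j - k - 1) (by ring) (by ring)]
    refine Or.inl ⟨by simp, ?_⟩
    have hP : ∀ i i' : Fin a, i ≤ i' → (k : ℕ) < π.1 i' j → (k : ℕ) < π.1 i j :=
      fun i i' hi h => h.trans_le (π.anti hi le_rfl)
    have hta : t ≤ a := by
      rw [ht]
      exact (Finset.card_le_univ _).trans (by simp)
    have h1 : ¬ InPile π t j k := by
      rcases hta.lt_or_eq with h0 | h0
      · have h5 := lt_card_filter_iff hP ⟨t, h0⟩
        rw [← ht] at h5
        have h6 := inPile_fin_iff (π := π) ⟨t, h0⟩ j k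
        dsimp only at h5 h6
        rw [h6, ← h5]
        omega
      · rintro (h | h | h | ⟨i', j', hi, hj, hk⟩) <;> omega
    have h2 : InPile π (t - 1) j k := by
      rcases Nat.eq_zero_or_pos t with h0 | h0
      · exact Or.inl (by omega)
      · have h5 := lt_card_filter_iff hP ⟨t - 1, by omega⟩
        rw [← ht] at h5
        have h6 := inPile_fin_iff (π := π) ⟨t - 1, by omega⟩ j k
        dsimp only at h5 h6
        rw [Nat.cast_sub h0, Nat.cast_one] at h6
        rw [h6, ← h5]
        omega
    rw [inPile_iff] at h1 h2
    rw [show (t : ℤ) - 1 - k = t - k - 1 by ring] at h2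
    rw [show (t : ℤ) - k - 1 + 1 = t - k by ring, show (j : ℤ) - k - 1 + 1 = j - k by ring]
    have h3 := H.diag (t - k - 1) (j - k)
    have h4 := H.anti_right (t - k) (j - k)
    rw [show (t : ℤ) - k - 1 + 1 = t - k by ring] at h3
    omega
  · rw [lozengeRel_lower_iff (α := i - k) (β := t - k - 1) (by ring) (by ring)]
    refine Or.inr (Or.inl ⟨by simp, ?_⟩)
    have hP : ∀ j j' : Fin b, j ≤ j' → (k : ℕ) < π.1 i j' → (k : ℕ) < π.1 i j :=
      fun j j' hj h => h.trans_le (π.anti le_rfl hj)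
    have htb : t ≤ b := by
      rw [ht]
      exact (Finset.card_le_univ _).trans (by simp)
    have h1 : ¬ InPile π i t k := by
      rcases htb.lt_or_eq with h0 | h0
      · have h5 := lt_card_filter_iff hP ⟨t, h0⟩
        rw [← ht] at h5
        have h6 := inPile_fin_iff (π := π) i ⟨t, h0⟩ k
        dsimp only at h5 h6
        rw [h6, ← h5]
        omega
      · rintro (h | h | h | ⟨i', j', hi, hj, hk⟩) <;> omega
    have h2 : InPile π i (t - 1) k := by
      rcases Nat.eq_zero_or_pos t with h0 | h0
      · exact Or.inr (Or.inl (by omega))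
      · have h5 := lt_card_filter_iff hP ⟨t - 1, by omega⟩
        rw [← ht] at h5
        have h6 := inPile_fin_iff (π := π) i ⟨t - 1, by omega⟩ k
        dsimp only at h5 h6
        rw [Nat.cast_sub h0, Nat.cast_one] at h6
        rw [h6, ← h5]
        omega
    rw [inPile_iff] at h1 h2
    rw [show (t : ℤ) - 1 - k = t - k - 1 by ring] at h2
    rw [show (t : ℤ) - k - 1 + 1 = t - k by ring]
    have h3 := H.diag (i - k - 1) (t - k - 1)
    have h4 := H.anti_left (i - k - 1) (t - k - 1)
    rw [show (i : ℤ) - k - 1 + 1 = i - k by ring, show (t : ℤ) - k - 1 + 1 = t - k by ring] at h3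
    rw [show (i : ℤ) - k - 1 + 1 = i - k by ring] at h4
    omega

/-- The height at a corner of the lozenge gives the position in space of the corresponding square.
The bounds of `IsHeight` place it in the box, and the cubes on its two sides identify the count `t`,
or the entry of the partition. -/
theorem lozengeOf_of_lozengeRel {a b c : ℕ} {π : PlanePartition a b c} {u v : ℤ × ℤ × ℤ}
    (hu : IsHexPoint a b c u) (hv : IsHexPoint a b c v) (h : LozengeRel a c (heightOf π) u v) :
    LozengeOf π u v := by
  have H := isHeight_heightOf π
  obtain ⟨p, q, r⟩ := u
  have hs : p + q + r = a + b + c - 2 := by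
    have h1 := h.sum
    have h2 := hu.2.2.2
    have h3 := hv.2.2.2
    dsimp only at h1 h2
    omega
  simp only [IsHexPoint] at hu
  obtain ⟨α, hα⟩ : ∃ α : ℤ, α = a - 1 - q := ⟨_, rfl⟩
  obtain ⟨β, hβ⟩ : ∃ β : ℤ, β = p - c := ⟨_, rfl⟩
  rw [lozengeRel_lower_iff hα hβ] at h
  have l1 := H.lower α β
  have l2 := H.lower (α + 1) β
  have l3 := H.lower (α + 1) (β + 1)
  have l4 := H.lower α (β + 1)
  have u1 := H.upper α β
  have u3 := H.upper (α + 1) (β + 1)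
  have u4 := H.upper α (β + 1)
  have pile := inPile_add_iff π
  rcases h with ⟨rfl, h⟩ | ⟨rfl, h⟩ | ⟨rfl, h⟩
  · simp only [IsHexPoint] at hv
    obtain ⟨z, hz⟩ : ∃ z, z = heightOf π (α + 1) (β + 1) := ⟨_, rfl⟩
    obtain ⟨j, hj⟩ : ∃ j : Fin b, (j : ℤ) = β + 1 + z := ⟨⟨(β + 1 + z).toNat, by omega⟩, by
      dsimp only; omega⟩
    obtain ⟨k, hk⟩ : ∃ k : Fin c, (k : ℤ) = z := ⟨⟨z.toNat, by omega⟩, by dsimp only; omega⟩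
    obtain ⟨t, ht⟩ : ∃ t : ℕ, (t : ℤ) = α + 1 + z := ⟨(α + 1 + z).toNat, by omega⟩
    refine Or.inr (Or.inl ⟨j, k, t, ?_, ?_, ?_⟩)
    · refine (card_filter_eq_of_iff (by omega) fun i => ?_).symm
      rw [← inPile_fin_iff]
      have h1 : ¬ InPile π t j k := by
        rw [ht, hj, hk, pile]
        omega
      have h2 : InPile π (t - 1) j k := by
        rw [ht, hj, hk, show α + 1 + z - 1 = α + z by ring, pile]
        omega
      exact ⟨fun h3 => by_contra fun h4 => h1 (h3.mono (by omega) le_rfl le_rfl),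
        fun h3 => h2.mono (by omega) le_rfl le_rfl⟩
    · simp only [Prod.mk.injEq]
      omega
    · simp
  · simp only [IsHexPoint] at hv
    obtain ⟨z, hz⟩ : ∃ z, z = heightOf π α (β + 1) := ⟨_, rfl⟩
    obtain ⟨i, hi⟩ : ∃ i : Fin a, (i : ℤ) = α + z := ⟨⟨(α + z).toNat, by omega⟩, by
      dsimp only; omega⟩
    obtain ⟨k, hk⟩ : ∃ k : Fin c, (k : ℤ) = z := ⟨⟨z.toNat, by omega⟩, by dsimp only; omega⟩
    obtain ⟨t, ht⟩ : ∃ t : ℕ, (t : ℤ) = β + 1 + z := ⟨(β + 1 + z).toNat, by omega⟩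
    refine Or.inr (Or.inr ⟨i, k, t, ?_, ?_, ?_⟩)
    · refine (card_filter_eq_of_iff (by omega) fun j => ?_).symm
      rw [← inPile_fin_iff]
      have h1 : ¬ InPile π i t k := by
        rw [ht, hi, hk, pile]
        omega
      have h2 : InPile π i (t - 1) k := by
        rw [ht, hi, hk, show β + 1 + z - 1 = β + z by ring, pile]
        omega
      exact ⟨fun h3 => by_contra fun h4 => h1 (h3.mono le_rfl (by omega) le_rfl),
        fun h3 => h2.mono le_rfl (by omega) le_rfl⟩
    · simp only [Prod.mk.injEq]
      omega
    · simp
  · simp only [IsHexPoint] at hv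
    obtain ⟨z, hz⟩ : ∃ z : ℕ, (z : ℤ) = heightOf π α β := ⟨(heightOf π α β).toNat, by omega⟩
    obtain ⟨i, hi⟩ : ∃ i : Fin a, (i : ℤ) = α + z := ⟨⟨(α + z).toNat, by omega⟩, by
      dsimp only; omega⟩
    obtain ⟨j, hj⟩ : ∃ j : Fin b, (j : ℤ) = β + z := ⟨⟨(β + z).toNat, by omega⟩, by
      dsimp only; omega⟩
    refine Or.inl ⟨i, j, z, ?_, ?_, ?_⟩
    · have h1 : ¬ InPile π i j z := by
        rw [hi, hj, pile]
        omega
      have h2 : InPile π i j (z - 1) := by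
        rw [hi, hj, show α + (z : ℤ) = α + 1 + (z - 1) by ring,
          show β + (z : ℤ) = β + 1 + (z - 1) by ring, pile]
        omega
      rw [inPile_fin_iff] at h1
      rcases h2 with h2 | h2 | h2 | ⟨i', j', hi', hj', hk⟩
      · omega
      · omega
      · omega
      · have e1 : i = i' := Fin.ext (by omega)
        have e2 : j = j' := Fin.ext (by omega)
        subst e1 e2
        omega
    · simp only [Prod.mk.injEq]
      omega
    · simp

/-- The lozenge tiling that represents a plane partition. -/
noncomputable def pictureEquiv (a b c : ℕ) : PlanePartition a b c ≃ HexDimer a b c :=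
  Equiv.ofBijective (fun π => (⟨tilingOf a b c (heightOf π),
    isPerfectMatching_tilingOf (isHeight_heightOf π)⟩ : HexDimer a b c))
  ⟨fun π π' h => heightOf_injective (tilingOf_injective (isHeight_heightOf π)
      (isHeight_heightOf π') (congrArg Subtype.val h)), fun M => by
    obtain ⟨π, hπ⟩ := (isHeight_matchingHeight M.2).exists_planePartition
    refine ⟨π, Subtype.ext ?_⟩
    dsimp only
    rw [hπ, tilingOf_matchingHeight M.2]⟩

theorem pictureEquiv_adj {a b c : ℕ} (π : PlanePartition a b c) (u v : HexVertex a b c) :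
    (pictureEquiv a b c π).1.Adj u v ↔ LozengeOf π u.1 v.1 ∨ LozengeOf π v.1 u.1 :=
  or_congr ⟨lozengeOf_of_lozengeRel u.2 v.2, lozengeRel_of_lozengeOf⟩
    ⟨lozengeOf_of_lozengeRel v.2 u.2, lozengeRel_of_lozengeOf⟩

end FullyPackedLoops

namespace FullyPackedLoops

/-! ### The polygon in normalized position

The external edge `C` has number `k`, on the bottom side, and `a ≤ k < a + c`. -/

/-- The normalized position of the external edge `C`. -/
structure Normalized (a b c : ℕ) (k : ℤ) : Prop where
  ha : 0 < a
  hb : 0 < b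
  hc : 0 < c
  le : a ≤ k
  lt : k < a + c

/-- The innermost endpoint of `A`. -/
def centreA (a b c : ℕ) (k : ℤ) : ℤ × ℤ :=
  if k + b < c + a then (c + a - b - k, a + b + c) else (1, 2 * (c + a) - k)

/-- The innermost endpoint of `B`. -/
def centreB (a b c : ℕ) (k : ℤ) : ℤ × ℤ :=
  if k < 2 * a then (a + b + c, k + 1 + b + c - a) else (3 * a + b + c - k, a + b + c)

/-- The point of the `(a, b, c)` hexagon corresponding to a grid point, which is defined by
different formulas in the right, left and upper parts. -/
def toHex (a b c : ℕ) (k : ℤ) (p : ℤ × ℤ) : ℤ × ℤ × ℤ :=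
  if 2 * (a - k) ≤ p.1 - p.2 - k then
    (p.1 - 1 - a, -((p.1 - p.2 - k + 1) / 2),
      2 * a + b + c - 1 - k - (p.1 + p.2 - k - 1) / 2)
  else if p.1 + p.2 - k - 2 ≤ 2 * (c + a - k - 1) then
    ((p.1 + p.2 - k - 2) / 2, a + c - p.1, (p.1 - p.2 - k) / 2 + b + k)
  else
    ((p.1 + p.2 - k - 2) / 2, -((p.1 - p.2 - k + 1) / 2), a + b + c - p.2)

/-- The grid points which correspond to points of the hexagon. -/
def IsHexSite (a b c : ℕ) (k : ℤ) (p : ℤ × ℤ) : Prop :=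
  IsHexPoint a b c (toHex a b c k p) ∧
    (p.1 - p.2 - k < 2 * (a - k) ∨ 2 * (c + a - k - 1) < p.1 + p.2 - k - 2)

/-- The grid point corresponding to a point of the hexagon. -/
def ofHex (a b c : ℕ) (k : ℤ) (v : ℤ × ℤ × ℤ) : ℤ × ℤ :=
  if v.1 ≤ c + a - k - 1 then
    (a + c - v.2.1, 2 * v.1 + (a + b + c - 1 - (v.1 + v.2.1 + v.2.2)) + k + 2 - (a + c - v.2.1))
  else if v.2.1 + (a + b + c - 1 - (v.1 + v.2.1 + v.2.2)) < k - a + 1 then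
    (v.1 + 1 + a,
     v.1 + 1 + a - k + 2 * v.2.1 + (a + b + c - 1 - (v.1 + v.2.1 + v.2.2)))
  else
    (2 * v.1 + (a + b + c - 1 - (v.1 + v.2.1 + v.2.2)) + k + 2 - (a + b + c - v.2.2),
      a + b + c - v.2.2)

variable {a b c : ℕ} {k : ℤ}

/-- The expression `a + b + c - 1 - (v.1 + v.2.1 + v.2.2)` in `ofHex` is `0` or `1`. It is the
parity of `x + y - k`, the bit lost in the halvings of `toHex`. -/
theorem toHex_ofHex (N : Normalized a b c k) {v : ℤ × ℤ × ℤ} (hv : IsHexPoint a b c v) :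
    toHex a b c k (ofHex a b c k v) = v ∧ IsHexSite a b c k (ofHex a b c k v) := by
  obtain ⟨ha, hb, hc, h1, h2⟩ := N
  have key : toHex a b c k (ofHex a b c k v) = v := by
    obtain ⟨p, q, r⟩ := v
    obtain ⟨hp, hq, hr, hs⟩ := hv
    dsimp only at hp hq hr hs
    unfold ofHex
    dsimp only
    split_ifs <;> unfold toHex <;> dsimp only <;> split_ifs <;> simp only [Prod.mk.injEq] <;> omega
  refine ⟨key, ?_⟩
  unfold IsHexSite
  rw [key]
  refine ⟨hv, ?_⟩
  obtain ⟨p, q, r⟩ := v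
  obtain ⟨hp, hq, hr, hs⟩ := hv
  dsimp only at hp hq hr hs
  unfold ofHex
  dsimp only
  split_ifs <;> dsimp only <;> omega

theorem ofHex_toHex (N : Normalized a b c k) {p : ℤ × ℤ} (hp : IsHexSite a b c k p) :
    ofHex a b c k (toHex a b c k p) = p := by
  obtain ⟨ha, hb, hc, h1, h2⟩ := N
  obtain ⟨x, y⟩ := p
  obtain ⟨hp, h3⟩ := hp
  unfold toHex at hp ⊢
  dsimp only at hp h3 ⊢
  split_ifs at hp ⊢ <;> obtain ⟨hp, hq, hr, hs⟩ := hp <;> dsimp only at hp hq hr hs <;>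
    unfold ofHex <;> dsimp only <;> split_ifs <;> simp only [Prod.mk.injEq] <;> omega

theorem toHex_injOn (N : Normalized a b c k) {p q : ℤ × ℤ} (hp : IsHexSite a b c k p)
    (hq : IsHexSite a b c k q) (h : toHex a b c k p = toHex a b c k q) : p = q := by
  rw [← ofHex_toHex N hp, h, ofHex_toHex N hq]

/-- The vertices of an elementary hexagon in cyclic order. -/
def hexFaceVertex (p q r : ℤ) : Fin 6 → ℤ × ℤ × ℤ :=
  ![(p + 1, q, r), (p + 1, q + 1, r), (p, q + 1, r), (p, q + 1, r + 1), (p, q, r + 1),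
    (p + 1, q, r + 1)]

/-- The bounds of the polygon in normalized position, apart from the removed rectangle. -/
def InStrip (a b c : ℕ) (k x y : ℤ) : Prop :=
  (1 ≤ x ∧ x ≤ a + b + c ∧ 1 ≤ y ∧ y ≤ a + b + c) ∧
    k + 2 ≤ x + y ∧ x + y - k - 2 ≤ 2 * (b + c) - 1 ∧ x + y - k - 2 ≤ 2 * (2 * a + b + c - 1 - k) ∧
    - 2 * (b + k) ≤ x - y - k ∧ 1 - 2 * (c + a) ≤ x - y - k ∧ x - y ≤ k

/-- In the coordinates `x + y - k - 2` and `x - y - k`, which vanish at `C`, the bounds by `A` and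
by `B` have two forms, according to the side on which these edges lie. `InStrip` imposes both; the
superfluous one already holds in the grid. -/
theorem inPolygon_of {x y : ℤ} (h : InStrip a b c k x y)
    (h' : 2 * (c + a - k - 1) < x + y - k - 2 ∨ x - y - k < 2 * (a - k)) :
    InPolygon (a + b + c) (centreA a b c k) (centreB a b c k) (k + 1, 1) (x, y) := by
  unfold InPolygon InGrid centreA centreB
  unfold InStrip at h
  dsimp only
  push_cast
  split_ifs <;> dsimp only <;> omega

/-- Only weak inequalities come out for the removed rectangle, because points on its border may
belong to `P'` without lying on any domino. -/
theorem InPolygon.inStrip (N : Normalized a b c k) {x y : ℤ}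
    (h : InPolygon (a + b + c) (centreA a b c k) (centreB a b c k) (k + 1, 1) (x, y)) :
    InStrip a b c k x y ∧
      (2 * (c + a - k - 1) ≤ x + y - k - 2 ∨ x - y - k ≤ 2 * (a - k)) := by
  obtain ⟨ha, hb, hc, h1, h2⟩ := N
  unfold InPolygon InGrid centreA centreB at h
  unfold InStrip
  dsimp only at h
  push_cast at h
  split_ifs at h <;> dsimp only at h <;> omega

/-- The middle edges of the paving, in coordinates. -/
def IsMiddle (a _b c : ℕ) (k : ℤ) (hor : Bool) (x y : ℤ) : Prop :=
  (hor = true ∧ x + y - k - 2 < 2 * (c + a - k - 1) ∧ (x + y - k) % 2 = 1) ∨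
  (hor = false ∧ 2 * (c + a - k - 1) < x + y - k - 2 ∧
    x - y - k < 2 * (a - k) ∧ (x + y - k) % 2 = 1) ∨
  (hor = true ∧ 2 * (a - k) ≤ x - y - k ∧ (x + y - k) % 2 = 0)

/-- The lines through `A` and `B` that cut `P'` move by one unit when `A` or `B` changes side. The
parity condition on the middle edges absorbs this, so the same even thresholds serve in all cases.
-/
theorem isPaving_iff (a b c : ℕ) (k : ℤ) (hor : Bool) (x y : ℤ) :
    IsPaving (a + b + c) (centreA a b c k) (centreB a b c k) (k + 1, 1) ⟨hor, x, y⟩ ↔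
      (∀ i, InPolygon (a + b + c) (centreA a b c k) (centreB a b c k) (k + 1, 1)
        ((⟨hor, x, y⟩ : Domino).vertex i)) ∧ IsMiddle a b c k hor x y := by
  unfold IsPaving IsMiddle
  refine and_congr_right fun _ => ?_
  dsimp only
  rw [Int.odd_iff, Int.even_iff]
  unfold centreA centreB
  refine or_congr (and_congr_right fun _ => ?_) (or_congr (and_congr_right fun _ => ?_)
    (and_congr_right fun _ => ?_))
  · split_ifs <;> dsimp only <;> omega
  · split_ifs <;> dsimp only <;> omega
  · split_ifs <;> dsimp only <;> omega

/-- The position of an elementary hexagon in the `(a, b, c)` hexagon. -/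
def IsFacePos (a b c : ℕ) (p q r : ℤ) : Prop :=
  (0 ≤ p ∧ p + 1 < b + c) ∧ (0 ≤ q ∧ q + 1 < c + a) ∧ (0 ≤ r ∧ r + 1 < a + b) ∧
    p + q + r = a + b + c - 3

theorem isHexPoint_hexFaceVertex {p q r : ℤ} (h : IsFacePos a b c p q r) (i : Fin 6) :
    IsHexPoint a b c (hexFaceVertex p q r i) := by
  unfold IsFacePos at h
  unfold IsHexPoint
  fin_cases i <;> simp [hexFaceVertex] <;> omega

/-- The formulas for two parts agree next to the cut between them. This and the two following lemmas
extend each formula a little beyond its part, so that a domino meeting a cut is treated by a single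
formula. -/
theorem toHex_left {x y : ℤ} (h1 : x - y - k < 2 * (a - k))
    (h2 : x + y - k - 2 ≤ 2 * (c + a - k - 1) + 1) :
    toHex a b c k (x, y) = ((x + y - k - 2) / 2, a + c - x, (x - y - k) / 2 + b + k) := by
  unfold toHex
  dsimp only
  rw [if_neg (by omega)]
  split_ifs with h
  · rfl
  · obtain rfl : x = 2 * (c + a - k - 1) + 1 + k + 2 - y := by omega
    refine Prod.ext ?_ (Prod.ext ?_ ?_) <;> dsimp only <;> omega

theorem toHex_upper {x y : ℤ} (h1 : x - y - k ≤ 2 * (a - k))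
    (h2 : 2 * (c + a - k - 1) ≤ x + y - k - 2) (h3 : x - y - k < 2 * (a - k) ∨
      2 * (c + a - k - 1) < x + y - k - 2) :
    toHex a b c k (x, y) =
      ((x + y - k - 2) / 2, -((x - y - k + 1) / 2), a + b + c - y) := by
  unfold toHex
  dsimp only
  split_ifs with h h'
  · obtain rfl : x = 2 * (a - k) + y + k := by omega
    refine Prod.ext ?_ (Prod.ext ?_ ?_) <;> dsimp only <;> omega
  · obtain rfl : x = 2 * (c + a - k - 1) + k + 2 - y := by omega
    refine Prod.ext ?_ (Prod.ext ?_ ?_) <;> dsimp only <;> omega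
  · rfl

theorem toHex_right {x y : ℤ} (h1 : 2 * (a - k) ≤ x - y - k + 1)
    (h2 : 2 * (c + a - k - 1) < x + y - k - 2) :
    toHex a b c k (x, y) =
     (x - 1 - a, -((x - y - k + 1) / 2), 2 * a + b + c - 1 - k - (x + y - k - 1) / 2) := by
  unfold toHex
  dsimp only
  split_ifs with h h'
  · rfl
  · omega
  · obtain rfl : x = 2 * (a - k) - 1 + y + k := by omega
    refine Prod.ext ?_ (Prod.ext ?_ ?_) <;> dsimp only <;> omega

end FullyPackedLoops

/-! ### Dominos and elementary hexagons -/

namespace FullyPackedLoops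
variable {a b c : ℕ} {k : ℤ}

/-- The cyclic order along the border is preserved, up to a shift of the starting vertex; this one
statement yields both the correspondence of faces and that of edges. -/
theorem toHex_hor_left {x y : ℤ} (ht : x - y - k + 2 < 2 * (a - k))
    (hs : x + y - k - 2 < 2 * (c + a - k - 1)) (hodd : (x + y - k) % 2 = 1) (i : Fin 6) :
    toHex a b c k ((⟨true, x, y⟩ : Domino).vertex i) =
      hexFaceVertex ((x + y - k - 3) / 2) (a + c - x - 1) ((x - y - k - 1) / 2 + b + k) (i + 3) := by
  fin_cases i <;>
    simp only [Domino.vertex, reduceIte, Fin.isValue, Fin.reduceFinMk,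
      Fin.reduceAdd, Matrix.cons_val, hexFaceVertex] <;>
    rw [toHex_left (by omega) (by omega)] <;>
    refine Prod.ext ?_ (Prod.ext ?_ ?_) <;> dsimp only <;> omega

theorem toHex_ver {x y : ℤ} (ht : x - y - k < 2 * (a - k))
    (hs : 2 * (c + a - k - 1) < x + y - k - 2) (hodd : (x + y - k) % 2 = 1) (i : Fin 6) :
    toHex a b c k ((⟨false, x, y⟩ : Domino).vertex i) =
      hexFaceVertex ((x + y - k - 3) / 2) (-((x - y - k + 1) / 2)) (a + b + c - y - 1) (i + 3) := by
  fin_cases i <;>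
    simp only [Domino.vertex, reduceIte, Bool.false_eq_true, Fin.isValue, Fin.reduceFinMk,
      Fin.reduceAdd, Matrix.cons_val, hexFaceVertex] <;>
    rw [toHex_upper (by omega) (by omega) (by omega)] <;>
    refine Prod.ext ?_ (Prod.ext ?_ ?_) <;> dsimp only <;> omega

theorem toHex_hor_right {x y : ℤ} (ht : 2 * (a - k) ≤ x - y - k)
    (hs : 2 * (c + a - k - 1) < x + y - k - 3) (hodd : (x + y - k) % 2 = 0) (i : Fin 6) :
    toHex a b c k ((⟨true, x, y⟩ : Domino).vertex i) =
      hexFaceVertex (x - 1 - a) (-((x - y - k + 2) / 2))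
        (2 * a + b + c - 1 - k - (x + y - k) / 2) (i + 4) := by
  fin_cases i <;>
    simp only [Domino.vertex, reduceIte, Fin.isValue, Fin.reduceFinMk,
      Fin.reduceAdd, Matrix.cons_val, hexFaceVertex] <;>
    rw [toHex_right (by omega) (by omega)] <;>
    refine Prod.ext ?_ (Prod.ext ?_ ?_) <;> dsimp only <;> omega

theorem isHexSite_of_face {d : Domino} {p q r : ℤ} {e : Fin 6} (hf : IsFacePos a b c p q r)
    (h : ∀ i, toHex a b c k (d.vertex i) = hexFaceVertex p q r (i + e))
    (h' : ∀ i, (d.vertex i).1 - (d.vertex i).2 - k < 2 * (a - k) ∨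
      2 * (c + a - k - 1) < (d.vertex i).1 + (d.vertex i).2 - k - 2) (i : Fin 6) :
    IsHexSite a b c k (d.vertex i) := by
  refine ⟨?_, h' i⟩
  rw [h i]
  exact isHexPoint_hexFaceVertex hf _

/-- One case for each part of `P'`. The six vertices lying in `P'` give exactly the inequalities
that keep the elementary hexagon inside the big one. -/
theorem exists_face_of_isPaving (N : Normalized a b c k) {d : Domino}
    (hd : IsPaving (a + b + c) (centreA a b c k) (centreB a b c k) (k + 1, 1) d) :
    (∀ i, IsHexSite a b c k (d.vertex i)) ∧ ∃ p q r, IsFacePos a b c p q r ∧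
      ∃ e, ∀ i, toHex a b c k (d.vertex i) = hexFaceVertex p q r (i + e) := by
  obtain ⟨hor, x, y⟩ := d
  rw [isPaving_iff] at hd
  obtain ⟨hp, hm⟩ := hd
  have p0 := hp 0
  have p1 := hp 1
  have p2 := hp 2
  have p3 := hp 3
  have p4 := hp 4
  have p5 := hp 5
  clear hp
  obtain rfl | rfl := Bool.eq_false_or_eq_true hor
  all_goals
    simp only [Domino.vertex, reduceIte, Bool.false_eq_true, Fin.isValue,
      Matrix.cons_val] at p0 p1 p2 p3 p4 p5
    replace p0 := p0.inStrip N
    replace p1 := p1.inStrip N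
    replace p2 := p2.inStrip N
    replace p3 := p3.inStrip N
    replace p4 := p4.inStrip N
    replace p5 := p5.inStrip N
    unfold InStrip at p0 p1 p2 p3 p4 p5
    obtain ⟨ha, hb, hc, h1, h2⟩ := N
    simp only [IsMiddle, reduceCtorEq, false_and, or_false, true_and, false_or] at hm
  · rcases hm with hm | hm
    · have e := toHex_hor_left (a := a) (b := b) (c := c) (k := k) (x := x) (y := y) (by omega)
        (by omega) (by omega)
      have hf : IsFacePos a b c ((x + y - k - 3) / 2) (a + c - x - 1)
        ((x - y - k - 1) / 2 + b + k) := by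
        unfold IsFacePos
        refine ⟨⟨?_, ?_⟩, ⟨?_, ?_⟩, ⟨?_, ?_⟩, ?_⟩ <;> omega
      refine ⟨isHexSite_of_face hf e fun i => Or.inl ?_, _, _, _, hf, _, e⟩
      fin_cases i <;> simp [Domino.vertex] <;> omega
    · have e := toHex_hor_right (a := a) (b := b) (c := c) (k := k) (x := x) (y := y) (by omega)
        (by omega) (by omega)
      have hf : IsFacePos a b c (x - 1 - a) (-((x - y - k + 2) / 2))
        (2 * a + b + c - 1 - k - (x + y - k) / 2) := by
        unfold IsFacePos
        refine ⟨⟨?_, ?_⟩, ⟨?_, ?_⟩, ⟨?_, ?_⟩, ?_⟩ <;> omega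
      refine ⟨isHexSite_of_face hf e fun i => Or.inr ?_, _, _, _, hf, _, e⟩
      fin_cases i <;> simp [Domino.vertex] <;> omega
  · have e := toHex_ver (a := a) (b := b) (c := c) (k := k) (x := x) (y := y) (by omega)
      (by omega) (by omega)
    have hf : IsFacePos a b c ((x + y - k - 3) / 2) (-((x - y - k + 1) / 2))
        (a + b + c - y - 1) := by
      unfold IsFacePos
      refine ⟨⟨?_, ?_⟩, ⟨?_, ?_⟩, ⟨?_, ?_⟩, ?_⟩ <;> omega
    refine ⟨isHexSite_of_face hf e fun i => ?_, _, _, _, hf, _, e⟩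
    fin_cases i <;> simp [Domino.vertex] <;> omega

theorem exists_isPaving_of_face (N : Normalized a b c k) {p q r : ℤ} (hf : IsFacePos a b c p q r) :
    ∃ d, IsPaving (a + b + c) (centreA a b c k) (centreB a b c k) (k + 1, 1) d ∧
      ∃ e, ∀ i, toHex a b c k (d.vertex i) = hexFaceVertex p q r (i + e) := by
  obtain ⟨ha, hb, hc, h1, h2⟩ := N
  unfold IsFacePos at hf
  -- The position of the hexagon decides the part of `P'`, and the middle edge is found by inverting
  -- the formula for the position in that part.
  by_cases hL : p ≤ c + a - k - 2
  · obtain ⟨x, hx⟩ : ∃ x, x = a + c - q - 1 := ⟨_, rfl⟩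
    obtain ⟨y, hy⟩ : ∃ y, y = 2 * p + 3 + k - x := ⟨_, rfl⟩
    refine ⟨⟨true, x, y⟩, ?_, 3, fun i => ?_⟩
    · rw [isPaving_iff]
      refine ⟨fun i => ?_, Or.inl ⟨rfl, by omega, by omega⟩⟩
      fin_cases i <;>
        simp only [Domino.vertex, reduceIte, Fin.reduceFinMk, Matrix.cons_val] <;>
        refine inPolygon_of ?_ (by omega) <;> unfold InStrip <;>
        refine ⟨⟨?_, ?_, ?_, ?_⟩, ?_, ?_, ?_, ?_, ?_, ?_⟩ <;> omega
    · rw [toHex_hor_left (by omega) (by omega) (by omega)]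
      congr 1 <;> omega
  · by_cases hR : q ≤ k - a - 1
    · obtain ⟨x, hx⟩ : ∃ x, x = p + 1 + a := ⟨_, rfl⟩
      obtain ⟨y, hy⟩ : ∃ y, y = x - k + 2 * q + 2 := ⟨_, rfl⟩
      refine ⟨⟨true, x, y⟩, ?_, 4, fun i => ?_⟩
      · rw [isPaving_iff]
        refine ⟨fun i => ?_, Or.inr (Or.inr ⟨rfl, by omega, by omega⟩)⟩
        fin_cases i <;>
          simp only [Domino.vertex, reduceIte, Fin.reduceFinMk, Matrix.cons_val] <;>
          refine inPolygon_of ?_ (by omega) <;> unfold InStrip <;>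
          refine ⟨⟨?_, ?_, ?_, ?_⟩, ?_, ?_, ?_, ?_, ?_, ?_⟩ <;> omega
      · rw [toHex_hor_right (by omega) (by omega) (by omega)]
        congr 1 <;> omega
    · obtain ⟨y, hy⟩ : ∃ y, y = a + b + c - r - 1 := ⟨_, rfl⟩
      obtain ⟨x, hx⟩ : ∃ x, x = 2 * p + 3 + k - y := ⟨_, rfl⟩
      refine ⟨⟨false, x, y⟩, ?_, 3, fun i => ?_⟩
      · rw [isPaving_iff]
        refine ⟨fun i => ?_, Or.inr (Or.inl ⟨rfl, by omega, by omega, by omega⟩)⟩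
        fin_cases i <;>
          simp only [Domino.vertex, reduceIte, Bool.false_eq_true, Fin.reduceFinMk,
            Matrix.cons_val] <;>
          refine inPolygon_of ?_ (by omega) <;> unfold InStrip <;>
          refine ⟨⟨?_, ?_, ?_, ?_⟩, ?_, ?_, ?_, ?_, ?_, ?_⟩ <;> omega
      · rw [toHex_ver (by omega) (by omega) (by omega)]
        congr 1 <;> omega

end FullyPackedLoops

/-! ### The isomorphism between the domino graph and the hexagonal graph -/

namespace FullyPackedLoops
variable {a b c : ℕ} {k : ℤ}

theorem unitStep_hexFaceVertex (p q r : ℤ) (i : Fin 6) :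
    UnitStep (hexFaceVertex p q r i) (hexFaceVertex p q r (i + 1)) ∨
      UnitStep (hexFaceVertex p q r (i + 1)) (hexFaceVertex p q r i) := by
  fin_cases i <;> simp [hexFaceVertex, UnitStep]

/-- An edge borders two elementary hexagons of the infinite lattice. As `a`, `b`, `c` are positive,
at least one of them lies in the `(a, b, c)` hexagon. -/
theorem exists_face_of_unitStep (N : Normalized a b c k) {u v : ℤ × ℤ × ℤ}
    (hu : IsHexPoint a b c u) (hv : IsHexPoint a b c v) (h : UnitStep u v) :
    ∃ p q r, IsFacePos a b c p q r ∧ ∃ i, (u = hexFaceVertex p q r i ∧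
      v = hexFaceVertex p q r (i + 1)) ∨ (v = hexFaceVertex p q r i ∧
      u = hexFaceVertex p q r (i + 1)) := by
  obtain ⟨ha, hb, hc, -, -⟩ := N
  obtain ⟨p, q, r⟩ := u
  unfold IsHexPoint at hu hv
  dsimp only at hu
  unfold IsFacePos
  rcases h with rfl | rfl | rfl <;> simp only [Prod.mk_add_mk, add_zero] at hv ⊢
  · by_cases h : 1 ≤ q ∧ r + 1 < a + b
    · exact ⟨p, q - 1, r, by omega, 1, Or.inr ⟨by simp [hexFaceVertex], by simp [hexFaceVertex]⟩⟩
    · exact ⟨p, q, r - 1, by omega, 4, Or.inl ⟨by simp [hexFaceVertex], by simp [hexFaceVertex]⟩⟩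
  · by_cases h : 1 ≤ p ∧ r + 1 < a + b
    · exact ⟨p - 1, q, r, by omega, 0, Or.inl ⟨by simp [hexFaceVertex], by simp [hexFaceVertex]⟩⟩
    · exact ⟨p, q, r - 1, by omega, 3, Or.inr ⟨by simp [hexFaceVertex], by simp [hexFaceVertex]⟩⟩
  · by_cases h : 1 ≤ p ∧ q + 1 < c + a
    · exact ⟨p - 1, q, r, by omega, 5, Or.inr ⟨by simp [hexFaceVertex], by simp [hexFaceVertex]⟩⟩
    · exact ⟨p, q - 1, r, by omega, 2, Or.inl ⟨by simp [hexFaceVertex], by simp [hexFaceVertex]⟩⟩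

theorem exists_face_of_isHexPoint (N : Normalized a b c k) {u : ℤ × ℤ × ℤ}
    (hu : IsHexPoint a b c u) :
    ∃ p q r, IsFacePos a b c p q r ∧ ∃ i, u = hexFaceVertex p q r i := by
  suffices h : ∃ v, IsHexPoint a b c v ∧ (UnitStep u v ∨ UnitStep v u) by
    obtain ⟨v, hv, h | h⟩ := h
    · obtain ⟨p, q, r, hf, i, h | h⟩ := exists_face_of_unitStep N hu hv h
      exacts [⟨p, q, r, hf, i, h.1⟩, ⟨p, q, r, hf, i + 1, h.2⟩]
    · obtain ⟨p, q, r, hf, i, h | h⟩ := exists_face_of_unitStep N hv hu h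
      exacts [⟨p, q, r, hf, i + 1, h.2⟩, ⟨p, q, r, hf, i, h.1⟩]
  obtain ⟨ha, hb, hc, -, -⟩ := N
  obtain ⟨p, q, r⟩ := u
  unfold IsHexPoint at hu ⊢
  dsimp only at hu
  by_cases hs : p + q + r = a + b + c - 2
  · by_cases h1 : p + 1 < b + c
    · exact ⟨(p + 1, q, r), by dsimp only; omega, Or.inl (Or.inl (by simp))⟩
    by_cases h2 : q + 1 < c + a
    · exact ⟨(p, q + 1, r), by dsimp only; omega, Or.inl (Or.inr (Or.inl (by simp)))⟩
    · exact ⟨(p, q, r + 1), by dsimp only; omega, Or.inl (Or.inr (Or.inr (by simp)))⟩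
  · by_cases h1 : 1 ≤ p
    · exact ⟨(p - 1, q, r), by dsimp only; omega, Or.inr (Or.inl (by simp))⟩
    by_cases h2 : 1 ≤ q
    · exact ⟨(p, q - 1, r), by dsimp only; omega, Or.inr (Or.inr (Or.inl (by simp)))⟩
    · exact ⟨(p, q, r - 1), by dsimp only; omega, Or.inr (Or.inr (Or.inr (by simp)))⟩

theorem isHexFace_iff (S : Set (HexVertex a b c)) :
    IsHexFace a b c S ↔ ∃ p q r, IsFacePos a b c p q r ∧
      S = {v | ∃ i, v.1 = hexFaceVertex p q r i} := by
  have key : ∀ p q r, IsFacePos a b c p q r →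
      {v : HexVertex a b c | (v.1.1 = p ∨ v.1.1 = p + 1) ∧ (v.1.2.1 = q ∨ v.1.2.1 = q + 1) ∧
        (v.1.2.2 = r ∨ v.1.2.2 = r + 1)} = {v | ∃ i, v.1 = hexFaceVertex p q r i} := by
    rintro p q r ⟨-, -, -, hs⟩
    ext ⟨⟨x, y, z⟩, -, -, -, hv⟩
    dsimp only at hv
    change (x = p ∨ x = p + 1) ∧ (y = q ∨ y = q + 1) ∧ (z = r ∨ z = r + 1) ↔
      ∃ i, (x, y, z) = hexFaceVertex p q r i
    constructor
    · rintro ⟨rfl | rfl, rfl | rfl, rfl | rfl⟩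
      · omega
      · exact ⟨4, rfl⟩
      · exact ⟨2, rfl⟩
      · exact ⟨3, rfl⟩
      · exact ⟨0, rfl⟩
      · exact ⟨5, rfl⟩
      · exact ⟨1, rfl⟩
      · omega
    · rintro ⟨i, hi⟩
      fin_cases i <;> simp [hexFaceVertex] at hi <;> simp [hi]
  unfold IsHexFace
  constructor
  · rintro ⟨p, q, r, hp, hq, hr, hs, rfl⟩
    exact ⟨p, q, r, ⟨hp, hq, hr, hs⟩, key p q r ⟨hp, hq, hr, hs⟩⟩
  · rintro ⟨p, q, r, hf, rfl⟩
    exact ⟨p, q, r, hf.1, hf.2.1, hf.2.2.1, hf.2.2.2, (key p q r hf).symm⟩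

/-- The vertices of the dominos in normalized position. -/
abbrev PavingVertex (a b c : ℕ) (k : ℤ) : Type :=
  DominoVertex (a + b + c) (centreA a b c k) (centreB a b c k) (k + 1, 1)

theorem PavingVertex.isHexSite (N : Normalized a b c k) (p : PavingVertex a b c k) :
    IsHexSite a b c k p.1 := by
  obtain ⟨p, d, hd, i, rfl⟩ := p
  exact (exists_face_of_isPaving N hd).1 i

theorem exists_pavingVertex (N : Normalized a b c k) {p : ℤ × ℤ} (hp : IsHexSite a b c k p) :
    ∃ d, IsPaving (a + b + c) (centreA a b c k) (centreB a b c k) (k + 1, 1) d ∧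
      ∃ i, p = d.vertex i := by
  obtain ⟨u, v, w, hf, i, hi⟩ := exists_face_of_isHexPoint N hp.1
  obtain ⟨d, hd, e, he⟩ := exists_isPaving_of_face N hf
  refine ⟨d, hd, i - e, toHex_injOn N hp ((exists_face_of_isPaving N hd).1 _) ?_⟩
  rw [hi, he, sub_add_cancel]

/-- The vertices of the dominos correspond to the vertices of the hexagonal graph. -/
noncomputable def pavingVertexEquiv (N : Normalized a b c k) :
    PavingVertex a b c k ≃ HexVertex a b c where
  toFun p := ⟨toHex a b c k p.1, (p.isHexSite N).1⟩
  invFun v := ⟨ofHex a b c k v.1, exists_pavingVertex N (toHex_ofHex N v.2).2⟩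
  left_inv p := Subtype.ext (ofHex_toHex N (p.isHexSite N))
  right_inv v := Subtype.ext (toHex_ofHex N v.2).1

/-- In both graphs the edges are the pairs of consecutive vertices of a face, and faces correspond
with their cyclic order. -/
theorem pavingVertexEquiv_adj_iff (N : Normalized a b c k) (p q : PavingVertex a b c k) :
    (hexGraph a b c).Adj (pavingVertexEquiv N p) (pavingVertexEquiv N q) ↔
      (dominoGraph (a + b + c) (centreA a b c k) (centreB a b c k) (k + 1, 1)).Adj p q := by
  constructor
  · intro h
    refine ⟨fun hpq => h.ne (congrArg _ hpq), ?_⟩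
    have key : ∃ u v w, IsFacePos a b c u v w ∧ ∃ i,
        (toHex a b c k p.1 = hexFaceVertex u v w i ∧
          toHex a b c k q.1 = hexFaceVertex u v w (i + 1)) ∨
        (toHex a b c k q.1 = hexFaceVertex u v w i ∧
          toHex a b c k p.1 = hexFaceVertex u v w (i + 1)) := by
      rcases h with h | h
      · exact exists_face_of_unitStep N (p.isHexSite N).1 (q.isHexSite N).1 h
      · obtain ⟨u, v, w, hf, i, hi⟩ :=
          exists_face_of_unitStep N (q.isHexSite N).1 (p.isHexSite N).1 h
        exact ⟨u, v, w, hf, i, hi.symm⟩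
    obtain ⟨u, v, w, hf, i, hi⟩ := key
    obtain ⟨d, hd, e, he⟩ := exists_isPaving_of_face N hf
    have inj : ∀ (p : PavingVertex a b c k) (j : Fin 6),
        toHex a b c k p.1 = hexFaceVertex u v w j → p.1 = d.vertex (j - e) := fun p j hj =>
      toHex_injOn N (p.isHexSite N) ((exists_face_of_isPaving N hd).1 _) (by
        rw [hj, he, sub_add_cancel])
    refine ⟨d, hd, i - e, ?_⟩
    rw [sub_add_eq_add_sub]
    exact hi.imp (fun h => ⟨inj _ _ h.1, inj _ _ h.2⟩) fun h => ⟨inj _ _ h.1, inj _ _ h.2⟩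
  · rintro ⟨-, d, hd, i, hi⟩
    obtain ⟨hs, u, v, w, hf, e, he⟩ := exists_face_of_isPaving N hd
    have h := unitStep_hexFaceVertex u v w (i + e)
    rw [add_right_comm, ← he, ← he] at h
    rcases hi with ⟨h1, h2⟩ | ⟨h1, h2⟩
    · rw [← h1, ← h2] at h
      exact h
    · rw [← h1, ← h2] at h
      exact h.symm

/-- The graph of the borders of the dominos is the hexagonal graph. -/
noncomputable def pavingIso (N : Normalized a b c k) :
    dominoGraph (a + b + c) (centreA a b c k) (centreB a b c k) (k + 1, 1) ≃g hexGraph a b c :=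
  ⟨pavingVertexEquiv N, pavingVertexEquiv_adj_iff N _ _⟩

theorem isDominoFace_iff_isHexFace (N : Normalized a b c k) (S : Set (PavingVertex a b c k)) :
    IsDominoFace (a + b + c) (centreA a b c k) (centreB a b c k) (k + 1, 1) S ↔
      IsHexFace a b c (pavingIso N '' S) := by
  have key : ∀ {d : Domino} {u v w : ℤ} {e : Fin 6},
      IsPaving (a + b + c) (centreA a b c k) (centreB a b c k) (k + 1, 1) d →
      (∀ i, toHex a b c k (d.vertex i) = hexFaceVertex u v w (i + e)) →
      pavingIso N '' {p | ∃ i, p.1 = d.vertex i} = {x | ∃ i, x.1 = hexFaceVertex u v w i} := by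
    intro d u v w e hd he
    ext x
    constructor
    · rintro ⟨p, ⟨i, hi⟩, rfl⟩
      refine ⟨i + e, ?_⟩
      rw [← he, ← hi]
      rfl
    · rintro ⟨i, hi⟩
      refine ⟨⟨d.vertex (i - e), d, hd, _, rfl⟩, ⟨_, rfl⟩, Subtype.ext ?_⟩
      rw [hi, ← sub_add_cancel i e, ← he]
      rw [sub_add_cancel]
      rfl
  rw [isHexFace_iff]
  constructor
  · rintro ⟨d, hd, rfl⟩
    obtain ⟨hs, u, v, w, hf, e, he⟩ := exists_face_of_isPaving N hd
    exact ⟨u, v, w, hf, key hd he⟩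
  · rintro ⟨u, v, w, hf, h⟩
    obtain ⟨d, hd, e, he⟩ := exists_isPaving_of_face N hf
    exact ⟨d, hd, Set.image_injective.2 (pavingIso N).injective (h.trans (key hd he).symm)⟩

end FullyPackedLoops

/-! ### The sites in grid coordinates -/

namespace FullyPackedLoops
variable {a b c : ℕ} {k : ℤ}

/-- In each part, the bounds of the hexagon are those of the strip seen through `toHex`. The removed
rectangle is taken here with its border. -/
theorem isHexSite_iff (N : Normalized a b c k) (x y : ℤ) : IsHexSite a b c k (x, y) ↔
    InStrip a b c k x y ∧ (x - y - k < 2 * (a - k) ∨ 2 * (c + a - k - 1) < x + y - k - 2) := by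
  obtain ⟨ha, hb, hc, h1, h2⟩ := N
  unfold IsHexSite
  refine and_congr_left fun h => ?_
  dsimp only at h
  unfold InStrip
  by_cases hR : 2 * (a - k) ≤ x - y - k
  · rw [toHex_right (by omega) (by omega)]
    unfold IsHexPoint
    dsimp only
    constructor
    · rintro ⟨⟨_, _⟩, ⟨_, _⟩, ⟨_, _⟩, _⟩
      refine ⟨⟨?_, ?_, ?_, ?_⟩, ?_, ?_, ?_, ?_, ?_, ?_⟩ <;> omega
    · rintro ⟨⟨_, _, _, _⟩, _, _, _, _, _, _⟩
      refine ⟨⟨?_, ?_⟩, ⟨?_, ?_⟩, ⟨?_, ?_⟩, ?_⟩ <;> omega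
  · by_cases hL : x + y - k - 2 ≤ 2 * (c + a - k - 1)
    · rw [toHex_left (by omega) (by omega)]
      unfold IsHexPoint
      dsimp only
      constructor
      · rintro ⟨⟨_, _⟩, ⟨_, _⟩, ⟨_, _⟩, _⟩
        refine ⟨⟨?_, ?_, ?_, ?_⟩, ?_, ?_, ?_, ?_, ?_, ?_⟩ <;> omega
      · rintro ⟨⟨_, _, _, _⟩, _, _, _, _, _, _⟩
        refine ⟨⟨?_, ?_⟩, ⟨?_, ?_⟩, ⟨?_, ?_⟩, ?_⟩ <;> omega
    · rw [toHex_upper (by omega) (by omega) (by omega)]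
      unfold IsHexPoint
      dsimp only
      constructor
      · rintro ⟨⟨_, _⟩, ⟨_, _⟩, ⟨_, _⟩, _⟩
        refine ⟨⟨?_, ?_, ?_, ?_⟩, ?_, ?_, ?_, ?_, ?_, ?_⟩ <;> omega
      · rintro ⟨⟨_, _, _, _⟩, _, _, _, _, _, _⟩
        refine ⟨⟨?_, ?_⟩, ⟨?_, ?_⟩, ⟨?_, ?_⟩, ?_⟩ <;> omega

/-! ### The fixed edges -/

/-- The edge from `(x, y)` to `(x + 1, y)` is a fixed edge. -/
def FixedRight (a b c : ℕ) (k x y : ℤ) : Prop :=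
  ((x + y - k) % 2 = 1 ∧ (x + y - k - 2 < 2 * (c + a - k - 1) ∧ x - y - k < 0 ∨
    x - y - k < -2 * (b + k) ∨ x - y - k < 1 - 2 * (c + a))) ∨
  ((x + y - k) % 2 = 0 ∧ (2 * (a - k) ≤ x - y - k ∧ 0 ≤ x + y - k - 2 ∨
    2 * (b + c) - 1 < x + y - k - 2 ∨ 2 * (2 * a + b + c - 1 - k) < x + y - k - 2))

/-- The edge from `(x, y)` to `(x, y + 1)` is a fixed edge. -/
def FixedUp (a b c : ℕ) (k x y : ℤ) : Prop :=
  ((x + y - k) % 2 = 1 ∧ (2 * (c + a - k - 1) < x + y - k - 2 ∧ x - y - k < 2 * (a - k) ∨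
    x - y - k < -2 * (b + k) ∨ x - y - k < 1 - 2 * (c + a) ∨
    2 * (b + c) - 1 < x + y - k - 2 ∨ 2 * (2 * a + b + c - 1 - k) < x + y - k - 2)) ∨
  ((x + y - k) % 2 = 0 ∧ (x + y - k - 2 < 0 ∨ 0 < x - y - k))

open Classical in
/-- The indicator of a proposition. -/
noncomputable def ind (P : Prop) : ℤ := if P then 1 else 0

theorem ind_eq_one {P : Prop} : ind P = 1 ↔ P := by unfold ind; split_ifs with h <;> simp [h]

theorem ind_cases (P : Prop) : (P ∧ ind P = 1) ∨ (¬ P ∧ ind P = 0) := by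
  unfold ind; split_ifs with h <;> simp [h]

/-- The number of fixed edges at a grid point. -/
noncomputable def fixedDegree (a b c : ℕ) (k x y : ℤ) : ℤ :=
  ind (FixedRight a b c k x y) + ind (FixedRight a b c k (x - 1) y) +
    ind (FixedUp a b c k x y) + ind (FixedUp a b c k x (y - 1))

theorem fixedRight_odd {x y : ℤ} (h : (x + y - k) % 2 = 1) : FixedRight a b c k x y ↔
    x + y - k - 2 < 2 * (c + a - k - 1) ∧ x - y - k < 0 ∨
    x - y - k < -2 * (b + k) ∨ x - y - k < 1 - 2 * (c + a) := by
  simp [FixedRight, h]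

theorem fixedRight_even {x y : ℤ} (h : (x + y - k) % 2 = 0) : FixedRight a b c k x y ↔
    2 * (a - k) ≤ x - y - k ∧ 0 ≤ x + y - k - 2 ∨
    2 * (b + c) - 1 < x + y - k - 2 ∨ 2 * (2 * a + b + c - 1 - k) < x + y - k - 2 := by
  simp [FixedRight, h]

theorem fixedUp_odd {x y : ℤ} (h : (x + y - k) % 2 = 1) : FixedUp a b c k x y ↔
    2 * (c + a - k - 1) < x + y - k - 2 ∧ x - y - k < 2 * (a - k) ∨
    x - y - k < -2 * (b + k) ∨ x - y - k < 1 - 2 * (c + a) ∨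
    2 * (b + c) - 1 < x + y - k - 2 ∨ 2 * (2 * a + b + c - 1 - k) < x + y - k - 2 := by
  simp [FixedUp, h]

theorem fixedUp_even {x y : ℤ} (h : (x + y - k) % 2 = 0) : FixedUp a b c k x y ↔
    x + y - k - 2 < 0 ∨ 0 < x - y - k := by
  simp [FixedUp, h]

theorem fixedDegree_even (a b c : ℕ) {k x y : ℤ} (h : (x + y - k) % 2 = 0) :
    fixedDegree a b c k x y =
      ind (2 * (a - k) ≤ x - y - k ∧ 0 ≤ x + y - k - 2 ∨
        2 * (b + c) - 1 < x + y - k - 2 ∨ 2 * (2 * a + b + c - 1 - k) < x + y - k - 2) +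
      ind (x + y - k - 3 < 2 * (c + a - k - 1) ∧ x - y - k - 1 < 0 ∨
        x - y - k - 1 < -2 * (b + k) ∨ x - y - k - 1 < 1 - 2 * (c + a)) +
      ind (x + y - k - 2 < 0 ∨ 0 < x - y - k) +
      ind (2 * (c + a - k - 1) < x + y - k - 3 ∧ x - y - k + 1 < 2 * (a - k) ∨
        x - y - k + 1 < -2 * (b + k) ∨ x - y - k + 1 < 1 - 2 * (c + a) ∨
        2 * (b + c) - 1 < x + y - k - 3 ∨ 2 * (2 * a + b + c - 1 - k) < x + y - k - 3) := by
  unfold fixedDegree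
  rw [fixedRight_even h, fixedRight_odd (by omega), fixedUp_even h, fixedUp_odd (by omega)]
  ring_nf

theorem fixedDegree_odd (a b c : ℕ) {k x y : ℤ} (h : (x + y - k) % 2 = 1) :
    fixedDegree a b c k x y =
      ind (x + y - k - 2 < 2 * (c + a - k - 1) ∧ x - y - k < 0 ∨
        x - y - k < -2 * (b + k) ∨ x - y - k < 1 - 2 * (c + a)) +
      ind (2 * (a - k) ≤ x - y - k - 1 ∧ 0 ≤ x + y - k - 3 ∨
        2 * (b + c) - 1 < x + y - k - 3 ∨ 2 * (2 * a + b + c - 1 - k) < x + y - k - 3) +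
      ind (2 * (c + a - k - 1) < x + y - k - 2 ∧ x - y - k < 2 * (a - k) ∨
        x - y - k < -2 * (b + k) ∨ x - y - k < 1 - 2 * (c + a) ∨
        2 * (b + c) - 1 < x + y - k - 2 ∨ 2 * (2 * a + b + c - 1 - k) < x + y - k - 2) +
      ind (x + y - k - 3 < 0 ∨ 0 < x - y - k + 1) := by
  unfold fixedDegree
  rw [fixedRight_odd h, fixedRight_even (by omega), fixedUp_odd h, fixedUp_even (by omega)]
  ring_nf

/-- A check by parity and by the position of the point relative to the diagonals. This single fixed
edge, inside a domino its middle edge, leaves one edge to be chosen. -/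
theorem fixedDegree_of_isHexSite (N : Normalized a b c k) {x y : ℤ}
    (h : IsHexSite a b c k (x, y)) : fixedDegree a b c k x y = 1 := by
  rw [isHexSite_iff N] at h
  obtain ⟨ha, hb, hc, h1, h2⟩ := N
  unfold InStrip at h
  rcases Int.emod_two_eq_zero_or_one (x + y - k) with hp | hp
  · rw [fixedDegree_even a b c hp]
    unfold ind
    split_ifs <;> first | rfl | (exfalso; omega)
  · rw [fixedDegree_odd a b c hp]
    unfold ind
    split_ifs <;> first | rfl | (exfalso; omega)

/-- At these points nothing is left to be chosen. -/
theorem fixedDegree_of_not_isHexSite (N : Normalized a b c k) {x y : ℤ}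
    (hg : InGrid (a + b + c) (x, y))
    (h : ¬ IsHexSite a b c k (x, y)) : fixedDegree a b c k x y = 2 := by
  rw [isHexSite_iff N] at h
  unfold InGrid at hg
  push_cast at hg
  obtain ⟨ha, hb, hc, h1, h2⟩ := N
  unfold InStrip at h
  rcases Int.emod_two_eq_zero_or_one (x + y - k) with hp | hp
  · rw [fixedDegree_even a b c hp]
    unfold ind
    split_ifs <;> first | rfl | (exfalso; omega)
  · rw [fixedDegree_odd a b c hp]
    unfold ind
    split_ifs <;> first | rfl | (exfalso; omega)
end FullyPackedLoops

/-! ### Grid edges between sites -/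

namespace FullyPackedLoops
variable {a b c : ℕ} {k : ℤ}

theorem unitStep_iff (p q r p' q' r' : ℤ) : UnitStep (p, q, r) (p', q', r') ↔
    (p' = p + 1 ∧ q' = q ∧ r' = r) ∨ (p' = p ∧ q' = q + 1 ∧ r' = r) ∨
      (p' = p ∧ q' = q ∧ r' = r + 1) := by
  simp [UnitStep]

/-- Two points of the hexagon are neighbours. -/
def HexNeighbours (u v : ℤ × ℤ × ℤ) : Prop := UnitStep u v ∨ UnitStep v u

/-- The grid edges between sites split into the fixed ones and those on the borders of dominos. The
formula for `toHex` used in each case is one that is valid at both endpoints. -/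
theorem hexNeighbours_right (N : Normalized a b c k) {x y : ℤ} (h : IsHexSite a b c k (x, y))
    (h' : IsHexSite a b c k (x + 1, y)) :
    HexNeighbours (toHex a b c k (x, y)) (toHex a b c k (x + 1, y)) ↔ ¬ FixedRight a b c k x y := by
  rw [isHexSite_iff N] at h h'
  unfold InStrip at h h'
  unfold HexNeighbours
  rcases Int.emod_two_eq_zero_or_one (x + y - k) with hp | hp
  · rw [fixedRight_even hp]
    by_cases hR : 2 * (a - k) ≤ x - y - k
    · rw [toHex_right (by omega) (by omega), toHex_right (by omega) (by omega), unitStep_iff,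
        unitStep_iff]
      refine iff_of_false ?_ ?_ <;> omega
    · refine iff_of_true (Or.inr ?_) (by omega)
      by_cases hL : x + y - k - 2 ≤ 2 * (c + a - k - 1)
      · rw [toHex_left (by omega) (by omega), toHex_left (by omega) (by omega), unitStep_iff]
        refine Or.inr (Or.inl ⟨?_, ?_, ?_⟩) <;> omega
      · rw [toHex_upper (by omega) (by omega) (by omega),
          toHex_upper (by omega) (by omega) (by omega), unitStep_iff]
        refine Or.inr (Or.inl ⟨?_, ?_, ?_⟩) <;> omega
  · rw [fixedRight_odd hp]
    by_cases hL : x + y - k - 2 < 2 * (c + a - k - 1)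
    · rw [toHex_left (by omega) (by omega), toHex_left (by omega) (by omega), unitStep_iff,
        unitStep_iff]
      refine iff_of_false ?_ ?_ <;> omega
    · refine iff_of_true (Or.inl ?_) (by omega)
      by_cases hR : 2 * (a - k) ≤ x - y - k
      · rw [toHex_right (by omega) (by omega), toHex_right (by omega) (by omega), unitStep_iff]
        refine Or.inl ⟨?_, ?_, ?_⟩ <;> omega
      · rw [toHex_upper (by omega) (by omega) (by omega),
          toHex_upper (by omega) (by omega) (by omega), unitStep_iff]
        refine Or.inl ⟨?_, ?_, ?_⟩ <;> omega

theorem hexNeighbours_up (N : Normalized a b c k) {x y : ℤ} (h : IsHexSite a b c k (x, y))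
    (h' : IsHexSite a b c k (x, y + 1)) :
    HexNeighbours (toHex a b c k (x, y)) (toHex a b c k (x, y + 1)) ↔ ¬ FixedUp a b c k x y := by
  rw [isHexSite_iff N] at h h'
  unfold InStrip at h h'
  unfold HexNeighbours
  rcases Int.emod_two_eq_zero_or_one (x + y - k) with hp | hp
  · rw [fixedUp_even hp]
    refine iff_of_true (Or.inr ?_) (by omega)
    by_cases hR : 2 * (a - k) ≤ x - y - k
    · rw [toHex_right (by omega) (by omega), toHex_right (by omega) (by omega), unitStep_iff]
      refine Or.inr (Or.inr ⟨?_, ?_, ?_⟩) <;> omega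
    · by_cases hL : x + y - k - 2 ≤ 2 * (c + a - k - 1)
      · rw [toHex_left (by omega) (by omega), toHex_left (by omega) (by omega), unitStep_iff]
        refine Or.inr (Or.inr ⟨?_, ?_, ?_⟩) <;> omega
      · rw [toHex_upper (by omega) (by omega) (by omega),
          toHex_upper (by omega) (by omega) (by omega), unitStep_iff]
        refine Or.inr (Or.inr ⟨?_, ?_, ?_⟩) <;> omega
  · rw [fixedUp_odd hp]
    by_cases hU : 2 * (c + a - k - 1) < x + y - k - 2 ∧ x - y - k < 2 * (a - k)
    · rw [toHex_upper (by omega) (by omega) (by omega),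
          toHex_upper (by omega) (by omega) (by omega), unitStep_iff, unitStep_iff]
      refine iff_of_false ?_ ?_ <;> omega
    · refine iff_of_true (Or.inl ?_) (by omega)
      by_cases hR : 2 * (a - k) ≤ x - y - k
      · rw [toHex_right (by omega) (by omega), toHex_right (by omega) (by omega), unitStep_iff]
        refine Or.inr (Or.inl ⟨?_, ?_, ?_⟩) <;> omega
      · rw [toHex_left (by omega) (by omega), toHex_left (by omega) (by omega), unitStep_iff]
        refine Or.inl ⟨?_, ?_, ?_⟩ <;> omega

theorem latticeAdj_iff (p q : ℤ × ℤ) : LatticeAdj p q ↔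
    q = (p.1 + 1, p.2) ∨ p = (q.1 + 1, q.2) ∨ q = (p.1, p.2 + 1) ∨ p = (q.1, q.2 + 1) := by
  obtain ⟨x, y⟩ := p
  obtain ⟨x', y'⟩ := q
  unfold LatticeAdj
  simp only [Prod.mk.injEq]
  rcases abs_cases (x - x') with ⟨h1, _⟩ | ⟨h1, _⟩ <;>
  rcases abs_cases (y - y') with ⟨h2, _⟩ | ⟨h2, _⟩ <;> rw [h1, h2] <;> omega

theorem LatticeAdj.symm {p q : ℤ × ℤ} (h : LatticeAdj p q) : LatticeAdj q p := by
  rw [latticeAdj_iff] at h ⊢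
  tauto

/-- The elements of a family of edges of the grid, given by the edges to the right and upwards. -/
def edgeGraph (n : ℕ) (R U : ℤ → ℤ → Prop) : SimpleGraph (ℤ × ℤ) where
  Adj p q := (InGrid n p ∨ InGrid n q) ∧
    (q = (p.1 + 1, p.2) ∧ R p.1 p.2 ∨ p = (q.1 + 1, q.2) ∧ R q.1 q.2 ∨
      q = (p.1, p.2 + 1) ∧ U p.1 p.2 ∨ p = (q.1, q.2 + 1) ∧ U q.1 q.2)
  symm := ⟨fun _ _ h => ⟨h.1.symm, by tauto⟩⟩
  loopless := ⟨fun p h => by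
    rcases h.2 with h | h | h | h <;> have := congrArg Prod.fst h.1 <;>
      have := congrArg Prod.snd h.1 <;> dsimp only at * <;> omega⟩

/-- The degree as a sum of indicators of the four edges turns degree conditions into linear
arithmetic. -/
theorem ncard_neighborSet {G : SimpleGraph (ℤ × ℤ)} (hG : ∀ p q, G.Adj p q → LatticeAdj p q)
    (x y : ℤ) : ((G.neighborSet (x, y)).ncard : ℤ) =
      ind (G.Adj (x, y) (x + 1, y)) + ind (G.Adj (x - 1, y) (x, y)) +
        ind (G.Adj (x, y) (x, y + 1)) + ind (G.Adj (x, y - 1) (x, y)) := by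
  classical
  have h : G.neighborSet (x, y) =
      (({(x + 1, y), (x - 1, y), (x, y + 1), (x, y - 1)} : Finset (ℤ × ℤ)).filter
        fun q => G.Adj (x, y) q : Finset (ℤ × ℤ)) := by
    ext q
    simp only [SimpleGraph.mem_neighborSet, Finset.coe_filter, Finset.mem_insert,
      Finset.mem_singleton, Set.mem_ofPred_eq]
    refine ⟨fun h => ⟨?_, h⟩, fun h => h.2⟩
    obtain ⟨x', y'⟩ := q
    have := (latticeAdj_iff _ _).1 (hG _ _ h)
    simp only [Prod.mk.injEq] at this ⊢
    omega
  rw [h, Set.ncard_coe_finset, Finset.card_filter]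
  rw [Finset.sum_insert, Finset.sum_insert, Finset.sum_insert, Finset.sum_singleton]
  · simp only [G.adj_comm (x - 1, y), G.adj_comm (x, y - 1), ind]
    push_cast
    ring
  all_goals simp
  all_goals omega
end FullyPackedLoops

namespace FullyPackedLoops

/-! ### The external edges -/

section External

variable {n : ℕ}

theorem side_of_eq {j q r : ℤ} (hj : j = n * q + r) (h0 : 0 ≤ r) (h1 : r < n) :
    side n j = (q % 4).toNat ∧ j % n = r := by
  have hq : j / n = q := by
    rw [hj, Int.mul_add_ediv_left _ _ (by omega), Int.ediv_eq_zero_of_lt h0 h1, add_zero]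
  have hr : j % n = r := by
    rw [hj, Int.mul_add_emod_self_left, Int.emod_eq_of_lt h0 h1]
  unfold side
  rw [hq]
  exact ⟨rfl, hr⟩

theorem outer_inner_bottom {j : ℤ} (h0 : 0 ≤ j) (h1 : j < n) :
    outer n j = (j + 1, 0) ∧ inner n j = (j + 1, 1) := by
  obtain ⟨h2, h3⟩ := side_of_eq (n := n) (j := j) (q := 0) (r := j) (by ring) h0 h1
  unfold outer inner
  rw [h2, h3]
  simp

theorem outer_inner_right {j : ℤ} (h0 : n ≤ j) (h1 : j < 2 * n) :
    outer n j = ((n : ℤ) + 1, j - n + 1) ∧ inner n j = ((n : ℤ), j - n + 1) := by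
  obtain ⟨h2, h3⟩ := side_of_eq (n := n) (j := j) (q := 1) (r := j - n) (by ring) (by omega)
    (by omega)
  unfold outer inner
  rw [h2, h3]
  simp

theorem outer_inner_top {j : ℤ} (h0 : 2 * n ≤ j) (h1 : j < 3 * n) :
    outer n j = (3 * n - j, (n : ℤ) + 1) ∧ inner n j = (3 * n - j, (n : ℤ)) := by
  obtain ⟨h2, h3⟩ := side_of_eq (n := n) (j := j) (q := 2) (r := j - 2 * n) (by ring) (by omega)
    (by omega)
  unfold outer inner
  rw [h2, h3]
  simp
  ring

theorem outer_inner_top_neg {j : ℤ} (h0 : -2 * n ≤ j) (h1 : j < -n) :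
    outer n j = (-n - j, (n : ℤ) + 1) ∧ inner n j = (-n - j, (n : ℤ)) := by
  obtain ⟨h2, h3⟩ := side_of_eq (n := n) (j := j) (q := -2) (r := j + 2 * n) (by ring) (by omega)
    (by omega)
  unfold outer inner
  rw [h2, h3]
  simp
  ring

theorem outer_inner_left_neg {j : ℤ} (h0 : -n ≤ j) (h1 : j < 0) :
    outer n j = (0, -j) ∧ inner n j = (1, -j) := by
  obtain ⟨h2, h3⟩ := side_of_eq (n := n) (j := j) (q := -1) (r := j + n) (by ring) (by omega)
    (by omega)
  unfold outer inner
  rw [h2, h3]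
  simp

theorem side_add_period (n : ℕ) (j m : ℤ) : side n (j + 4 * n * m) = side n j := by
  rcases n.eq_zero_or_pos with rfl | hn
  · simp
  · unfold side
    rw [show j + 4 * n * m = j + n * (4 * m) by ring, Int.add_mul_ediv_left _ _ (by omega),
      Int.add_mul_emod_self_left]

theorem emod_add_period (n : ℕ) (j m : ℤ) : (j + 4 * n * m) % n = j % n := by
  rw [show j + 4 * n * m = j + n * (4 * m) by ring, Int.add_mul_emod_self_left]

theorem outer_add_period (n : ℕ) (j m : ℤ) : outer n (j + 4 * n * m) = outer n j := by
  unfold outer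
  rw [side_add_period, emod_add_period]

theorem inner_add_period (n : ℕ) (j m : ℤ) : inner n (j + 4 * n * m) = inner n j := by
  unfold inner
  rw [side_add_period, emod_add_period]

theorem exists_add_period (n : ℕ) {i j : ℤ} (h : i ≡ j [ZMOD 4 * n]) : ∃ m, j = i + 4 * n * m := by
  obtain ⟨m, hm⟩ := h.dvd
  exact ⟨m, by linarith⟩

theorem outer_congr {i j : ℤ} (h : i ≡ j [ZMOD 4 * n]) : outer n i = outer n j := by
  obtain ⟨m, rfl⟩ := exists_add_period n h
  rw [outer_add_period]

theorem inner_congr {i j : ℤ} (h : i ≡ j [ZMOD 4 * n]) : inner n i = inner n j := by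
  obtain ⟨m, rfl⟩ := exists_add_period n h
  rw [inner_add_period]

/-- Every index is equivalent to one in any given interval of length `4 n`. -/
theorem exists_index (hn : 0 < n) (lo j : ℤ) :
    ∃ i, lo ≤ i ∧ i < lo + 4 * n ∧ i ≡ j [ZMOD 4 * n] := by
  have h4 : (0 : ℤ) < 4 * n := by omega
  refine ⟨lo + (j - lo) % (4 * n), ?_, ?_, ?_⟩
  · have := Int.emod_nonneg (j - lo) h4.ne'
    omega
  · have := Int.emod_lt_of_pos (j - lo) h4
    omega
  · exact ((Int.mod_modEq _ _).add_left lo).trans (by rw [add_sub_cancel])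

/-- The positions of the external edges with index between `-2 n` and `2 n`. -/
theorem outer_inner_cases {j : ℤ} (h0 : -2 * n ≤ j) (h1 : j < 2 * n) :
    (0 ≤ j ∧ j < n ∧ outer n j = (j + 1, 0) ∧ inner n j = (j + 1, 1)) ∨
    (n ≤ j ∧ outer n j = ((n : ℤ) + 1, j - n + 1) ∧ inner n j = ((n : ℤ), j - n + 1)) ∨
    (j < -n ∧ outer n j = (-n - j, (n : ℤ) + 1) ∧ inner n j = (-n - j, (n : ℤ))) ∨
    (-n ≤ j ∧ j < 0 ∧ outer n j = (0, -j) ∧ inner n j = (1, -j)) := by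
  by_cases h2 : j < -n
  · exact Or.inr (Or.inr (Or.inl ⟨h2, outer_inner_top_neg h0 h2⟩))
  by_cases h3 : j < 0
  · exact Or.inr (Or.inr (Or.inr ⟨by omega, h3, outer_inner_left_neg (by omega) h3⟩))
  by_cases h4 : j < n
  · exact Or.inl ⟨by omega, h4, outer_inner_bottom (by omega) h4⟩
  · exact Or.inr (Or.inl ⟨by omega, outer_inner_right (by omega) h1⟩)

theorem outer_eq_iff (hn : 0 < n) {i j : ℤ} : outer n i = outer n j ↔ i ≡ j [ZMOD 4 * n] := by
  refine ⟨fun h => ?_, outer_congr⟩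
  obtain ⟨i', hi0, hi1, hi⟩ := exists_index hn (-2 * n) i
  obtain ⟨j', hj0, hj1, hj⟩ := exists_index hn (-2 * n) j
  rw [← outer_congr hi, ← outer_congr hj] at h
  suffices i' = j' from hi.symm.trans (this ▸ hj)
  rcases outer_inner_cases hi0 (by omega) with ⟨_, _, h1, _⟩ | ⟨_, h1, _⟩ | ⟨_, h1, _⟩ | ⟨_, _, h1, _⟩ <;>
  rcases outer_inner_cases hj0 (by omega) with ⟨_, _, h2, _⟩ | ⟨_, h2, _⟩ | ⟨_, h2, _⟩ | ⟨_, _, h2, _⟩ <;>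
  rw [h1, h2, Prod.mk.injEq] at h <;> omega

theorem outer_ne {i j : ℤ} (h1 : i < j) (h2 : j < i + 4 * n) : outer n i ≠ outer n j := by
  have hn : 0 < n := by omega
  rw [Ne, outer_eq_iff hn, Int.modEq_iff_dvd]
  intro h
  have := Int.le_of_dvd (by omega) h
  omega

theorem outer_inner_spec (hn : 0 < n) (j : ℤ) : ¬ InGrid n (outer n j) ∧ InGrid n (inner n j) ∧
    LatticeAdj (outer n j) (inner n j) ∧
    ∀ q, InGrid n q → LatticeAdj (outer n j) q → q = inner n j := by
  obtain ⟨j', hj0, hj1, hj⟩ := exists_index hn (-2 * n) j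
  rw [← outer_congr hj, ← inner_congr hj]
  rcases outer_inner_cases hj0 (by omega) with ⟨_, _, h1, h2⟩ | ⟨_, h1, h2⟩ | ⟨_, h1, h2⟩ |
    ⟨_, _, h1, h2⟩ <;> rw [h1, h2] <;> unfold InGrid <;>
  refine ⟨by dsimp only; omega, by dsimp only; omega, by rw [latticeAdj_iff]; simp, ?_⟩ <;>
  rintro ⟨x, y⟩ hq hadj <;> rw [latticeAdj_iff] at hadj <;>
  simp only [Prod.mk.injEq] at hadj ⊢ <;> dsimp only at hq <;> omega

theorem exists_outer {p q : ℤ × ℤ} (hp : ¬ InGrid n p) (hq : InGrid n q) (h : LatticeAdj p q) :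
    ∃ j : ℤ, -2 * n ≤ j ∧ j < 2 * n ∧ p = outer n j ∧ q = inner n j := by
  obtain ⟨x, y⟩ := p
  obtain ⟨x', y'⟩ := q
  rw [latticeAdj_iff] at h
  unfold InGrid at hp hq
  simp only [Prod.mk.injEq] at h
  dsimp only at hp hq
  by_cases h1 : y = 0
  · refine ⟨x - 1, by omega, by omega, ?_⟩
    rw [(outer_inner_bottom (n := n) (j := x - 1) (by omega) (by omega)).1,
      (outer_inner_bottom (n := n) (j := x - 1) (by omega) (by omega)).2]
    simp only [Prod.mk.injEq]
    omega
  by_cases h2 : x = 0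
  · refine ⟨-y, by omega, by omega, ?_⟩
    rw [(outer_inner_left_neg (n := n) (j := -y) (by omega) (by omega)).1,
      (outer_inner_left_neg (n := n) (j := -y) (by omega) (by omega)).2]
    simp only [Prod.mk.injEq]
    omega
  by_cases h3 : x = n + 1
  · refine ⟨n + y - 1, by omega, by omega, ?_⟩
    rw [(outer_inner_right (n := n) (j := n + y - 1) (by omega) (by omega)).1,
      (outer_inner_right (n := n) (j := n + y - 1) (by omega) (by omega)).2]
    simp only [Prod.mk.injEq]
    omega
  · refine ⟨-n - x, by omega, by omega, ?_⟩
    rw [(outer_inner_top_neg (n := n) (j := -n - x) (by omega) (by omega)).1,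
      (outer_inner_top_neg (n := n) (j := -n - x) (by omega) (by omega)).2]
    simp only [Prod.mk.injEq]
    omega

end External

variable {a b c : ℕ} {k : ℤ}

/-- The graph of the fixed edges. -/
def fixedGraph (a b c : ℕ) (k : ℤ) : SimpleGraph (ℤ × ℤ) :=
  edgeGraph (a + b + c) (FixedRight a b c k) (FixedUp a b c k)

theorem edgeGraph_adj_right {n : ℕ} {R U : ℤ → ℤ → Prop} (x y : ℤ) :
    (edgeGraph n R U).Adj (x, y) (x + 1, y) ↔ (InGrid n (x, y) ∨ InGrid n (x + 1, y)) ∧ R x y := by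
  refine and_congr_right fun _ => ?_
  simp
  exact fun h => absurd h (by omega)

theorem edgeGraph_adj_up {n : ℕ} {R U : ℤ → ℤ → Prop} (x y : ℤ) :
    (edgeGraph n R U).Adj (x, y) (x, y + 1) ↔ (InGrid n (x, y) ∨ InGrid n (x, y + 1)) ∧ U x y := by
  refine and_congr_right fun _ => ?_
  simp
  exact fun h => absurd h (by omega)

theorem edgeGraph_latticeAdj {n : ℕ} {R U : ℤ → ℤ → Prop} {p q : ℤ × ℤ}
    (h : (edgeGraph n R U).Adj p q) : LatticeAdj p q := by
  rw [latticeAdj_iff]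
  rcases h.2 with h | h | h | h <;> simp [h.1]

/-- The fixed external edges are those that `C` being unoccupied forces to be occupied, so the
non-fixed edges of a configuration are all internal. -/
theorem fixedGraph_adj_outer (N : Normalized a b c k) (j : ℤ) :
    (fixedGraph a b c k).Adj (outer (a + b + c) j) (inner (a + b + c) j) ↔ Odd (j - k) := by
  have hn : 0 < a + b + c := by have := N.ha; omega
  obtain ⟨i, hi0, hi1, hi⟩ := exists_index hn (-2 * (a + b + c : ℕ)) j
  rw [← outer_congr hi, ← inner_congr hi]
  have hpar : (j - k) % 2 = (i - k) % 2 := by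
    obtain ⟨m, rfl⟩ := exists_add_period _ hi
    have : 4 * ((a + b + c : ℕ) : ℤ) * m = 2 * (2 * (a + b + c : ℕ) * m) := by ring
    omega
  rw [Int.odd_iff, hpar]
  have hg := (outer_inner_spec hn i).2.1
  obtain ⟨ha, hb, hc, h1, h2⟩ := N
  unfold fixedGraph
  rcases outer_inner_cases hi0 (by omega) with ⟨_, _, e1, e2⟩ | ⟨_, e1, e2⟩ | ⟨_, e1, e2⟩ |
    ⟨_, _, e1, e2⟩ <;> rw [e2] at hg <;> rw [e1, e2]
  · have e := edgeGraph_adj_up (n := a + b + c) (R := FixedRight a b c k) (U := FixedUp a b c k)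
      (i + 1) 0
    rw [zero_add] at e
    rw [e, and_iff_right (Or.inr hg)]
    unfold FixedUp
    omega
  · have e := edgeGraph_adj_right (n := a + b + c) (R := FixedRight a b c k)
      (U := FixedUp a b c k) (a + b + c : ℕ) (i - (a + b + c : ℕ) + 1)
    rw [SimpleGraph.adj_comm, e, and_iff_right (Or.inl hg)]
    unfold FixedRight
    omega
  · have e := edgeGraph_adj_up (n := a + b + c) (R := FixedRight a b c k) (U := FixedUp a b c k)
      (-(a + b + c : ℕ) - i) (a + b + c : ℕ)
    rw [SimpleGraph.adj_comm, e, and_iff_right (Or.inl hg)]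
    unfold FixedUp
    omega
  · have e := edgeGraph_adj_right (n := a + b + c) (R := FixedRight a b c k)
      (U := FixedUp a b c k) 0 (-i)
    rw [zero_add] at e
    rw [e, and_iff_right (Or.inr hg)]
    unfold FixedRight
    omega

/-- The number of fixed edges at a grid point. -/
theorem ncard_fixedGraph {x y : ℤ} (hg : InGrid (a + b + c) (x, y)) :
    (((fixedGraph a b c k).neighborSet (x, y)).ncard : ℤ) = fixedDegree a b c k x y := by
  have e := ncard_neighborSet (G := fixedGraph a b c k) (fun _ _ h => edgeGraph_latticeAdj h) x y
  rw [e]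
  have e1 := edgeGraph_adj_right (n := a + b + c) (R := FixedRight a b c k)
    (U := FixedUp a b c k) (x - 1) y
  have e2 := edgeGraph_adj_up (n := a + b + c) (R := FixedRight a b c k)
    (U := FixedUp a b c k) x (y - 1)
  rw [sub_add_cancel] at e1 e2
  unfold fixedGraph fixedDegree
  rw [edgeGraph_adj_right, edgeGraph_adj_up, e1, e2, and_iff_right (Or.inl hg),
    and_iff_right (Or.inr hg), and_iff_right (Or.inl hg), and_iff_right (Or.inr hg)]

theorem IsHexSite.inGrid (N : Normalized a b c k) {p : ℤ × ℤ} (h : IsHexSite a b c k p) :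
    InGrid (a + b + c) p := by
  obtain ⟨x, y⟩ := p
  have := ((isHexSite_iff N x y).1 h).1.1
  unfold InGrid
  push_cast
  exact this

theorem ncard_fixedGraph_of_isHexSite (N : Normalized a b c k) {p : ℤ × ℤ}
    (h : IsHexSite a b c k p) : ((fixedGraph a b c k).neighborSet p).ncard = 1 := by
  exact_mod_cast (ncard_fixedGraph (h.inGrid N)).trans (fixedDegree_of_isHexSite N h)

theorem ncard_fixedGraph_of_not_isHexSite (N : Normalized a b c k) {p : ℤ × ℤ}
    (hg : InGrid (a + b + c) p) (h : ¬ IsHexSite a b c k p) :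
    ((fixedGraph a b c k).neighborSet p).ncard = 2 := by
  exact_mod_cast (ncard_fixedGraph hg).trans (fixedDegree_of_not_isHexSite N hg h)

/-- Two sites which are neighbours in the grid are neighbours in the hexagon unless they are joined
by a fixed edge. -/
theorem hexNeighbours_iff_of_latticeAdj (N : Normalized a b c k) {p q : ℤ × ℤ}
    (hp : IsHexSite a b c k p) (hq : IsHexSite a b c k q) (h : LatticeAdj p q) :
    HexNeighbours (toHex a b c k p) (toHex a b c k q) ↔ ¬ (fixedGraph a b c k).Adj p q := by
  have right : ∀ x y : ℤ, IsHexSite a b c k (x, y) → IsHexSite a b c k (x + 1, y) →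
      (HexNeighbours (toHex a b c k (x, y)) (toHex a b c k (x + 1, y)) ↔
        ¬ (fixedGraph a b c k).Adj (x, y) (x + 1, y)) := fun x y hp hq => by
    unfold fixedGraph
    rw [hexNeighbours_right N hp hq, edgeGraph_adj_right, and_iff_right (Or.inl (hp.inGrid N))]
  have up : ∀ x y : ℤ, IsHexSite a b c k (x, y) → IsHexSite a b c k (x, y + 1) →
      (HexNeighbours (toHex a b c k (x, y)) (toHex a b c k (x, y + 1)) ↔
        ¬ (fixedGraph a b c k).Adj (x, y) (x, y + 1)) := fun x y hp hq => by
    unfold fixedGraph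
    rw [hexNeighbours_up N hp hq, edgeGraph_adj_up, and_iff_right (Or.inl (hp.inGrid N))]
  rw [latticeAdj_iff] at h
  rcases h with rfl | rfl | rfl | rfl
  · exact right _ _ hp hq
  · rw [SimpleGraph.adj_comm]
    exact (or_comm).trans (right _ _ hq hp)
  · exact up _ _ hp hq
  · rw [SimpleGraph.adj_comm]
    exact (or_comm).trans (up _ _ hq hp)

/-- Neighbours in the hexagon are consecutive on the border of a domino. -/
theorem HexNeighbours.latticeAdj (N : Normalized a b c k) {p q : ℤ × ℤ}
    (hp : IsHexSite a b c k p) (hq : IsHexSite a b c k q)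
    (h : HexNeighbours (toHex a b c k p) (toHex a b c k q)) : LatticeAdj p q := by
  have hd : ∀ (d : Domino) (i : Fin 6), LatticeAdj (d.vertex i) (d.vertex (i + 1)) := by
    rintro ⟨hor, x, y⟩ i
    rw [latticeAdj_iff]
    obtain rfl | rfl := Bool.eq_false_or_eq_true hor <;> fin_cases i <;>
      simp [Domino.vertex]
  obtain ⟨-, d, -, i, h | h⟩ := (pavingVertexEquiv_adj_iff N ⟨p, exists_pavingVertex N hp⟩
    ⟨q, exists_pavingVertex N hq⟩).1 h
  · obtain rfl : p = d.vertex i := h.1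
    obtain rfl : q = d.vertex (i + 1) := h.2
    exact hd d i
  · obtain rfl : q = d.vertex i := h.1
    obtain rfl : p = d.vertex (i + 1) := h.2
    exact (hd d i).symm

end FullyPackedLoops

namespace FullyPackedLoops
variable {a b c : ℕ} {k : ℤ}

/-! ### Configurations and matchings -/

/-- The edges of the grid which correspond to the edges of a matching. -/
def matchedGraph (k : ℤ) (M : (hexGraph a b c).Subgraph) : SimpleGraph (ℤ × ℤ) where
  Adj p q := IsHexSite a b c k p ∧ IsHexSite a b c k q ∧
    Matched M (toHex a b c k p) (toHex a b c k q)
  symm := ⟨fun _ _ ⟨hp, hq, h1, h2, h⟩ => ⟨hq, hp, h2, h1, h.symm⟩⟩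
  loopless := ⟨fun _ ⟨_, _, _, _, h⟩ => h.ne rfl⟩

/-- The configuration given by a matching. -/
def configOf (k : ℤ) (M : (hexGraph a b c).Subgraph) : SimpleGraph (ℤ × ℤ) :=
  fixedGraph a b c k ⊔ matchedGraph k M

/-- The edges of the hexagon which correspond to occupied edges of the grid. -/
def matchingOf (a b c : ℕ) (k : ℤ) (G : SimpleGraph (ℤ × ℤ)) : (hexGraph a b c).Subgraph where
  verts := Set.univ
  Adj u v := (hexGraph a b c).Adj u v ∧ G.Adj (ofHex a b c k u.1) (ofHex a b c k v.1)
  adj_sub h := h.1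
  edge_vert _ := Set.mem_univ _
  symm := ⟨fun _ _ h => ⟨h.1.symm, h.2.symm⟩⟩

theorem Matched.hexNeighbours {M : (hexGraph a b c).Subgraph} {u v : ℤ × ℤ × ℤ}
    (h : Matched M u v) : HexNeighbours u v := by
  obtain ⟨hu, hv, h⟩ := h
  exact M.adj_sub h

theorem matchedGraph_latticeAdj (N : Normalized a b c k) {M : (hexGraph a b c).Subgraph}
    {p q : ℤ × ℤ} (h : (matchedGraph k M).Adj p q) : LatticeAdj p q :=
  h.2.2.hexNeighbours.latticeAdj N h.1 h.2.1

theorem not_fixed_of_matched (N : Normalized a b c k) {M : (hexGraph a b c).Subgraph}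
    {p q : ℤ × ℤ} (h : (matchedGraph k M).Adj p q) : ¬ (fixedGraph a b c k).Adj p q :=
  (hexNeighbours_iff_of_latticeAdj N h.1 h.2.1 (matchedGraph_latticeAdj N h)).1
    h.2.2.hexNeighbours

theorem configOf_latticeAdj (N : Normalized a b c k) {M : (hexGraph a b c).Subgraph}
    {p q : ℤ × ℤ} (h : (configOf k M).Adj p q) : LatticeAdj p q :=
  h.elim (fun h => edgeGraph_latticeAdj h) (matchedGraph_latticeAdj N)

theorem matchedGraph_adj_ofHex (N : Normalized a b c k) {M : (hexGraph a b c).Subgraph}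
    (u v : HexVertex a b c) :
    (matchedGraph k M).Adj (ofHex a b c k u.1) (ofHex a b c k v.1) ↔ M.Adj u v := by
  obtain ⟨hu1, hu2⟩ := toHex_ofHex N u.2
  obtain ⟨hv1, hv2⟩ := toHex_ofHex N v.2
  change _ ∧ _ ∧ Matched M _ _ ↔ _
  rw [hu1, hv1]
  exact ⟨fun ⟨_, _, _, _, h⟩ => h, fun h => ⟨hu2, hv2, u.2, v.2, h⟩⟩

/-- No fixed edge corresponds to an edge of the hexagon, so adding the fixed edges to `M` is undone
by keeping the edges of the hexagon. -/
theorem matchingOf_configOf (N : Normalized a b c k) {M : (hexGraph a b c).Subgraph}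
    (hM : M.IsPerfectMatching) : matchingOf a b c k (configOf k M) = M := by
  refine SimpleGraph.Subgraph.ext (SimpleGraph.Subgraph.isSpanning_iff.1 hM.2).symm ?_
  funext u v
  refine propext ⟨fun ⟨h1, h2⟩ => ?_, fun h => ⟨M.adj_sub h, Or.inr
    ((matchedGraph_adj_ofHex N u v).2 h)⟩⟩
  rcases h2 with h2 | h2
  · obtain ⟨hu1, hu2⟩ := toHex_ofHex N u.2
    obtain ⟨hv1, hv2⟩ := toHex_ofHex N v.2
    refine absurd h2 ((hexNeighbours_iff_of_latticeAdj N hu2 hv2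
      (edgeGraph_latticeAdj h2)).1 ?_)
    rw [hu1, hv1]
    exact h1
  · exact (matchedGraph_adj_ofHex N u v).1 h2

theorem ncard_matchedGraph (N : Normalized a b c k) {M : (hexGraph a b c).Subgraph}
    (hM : M.IsPerfectMatching) {p : ℤ × ℤ} (hp : IsHexSite a b c k p) :
    ((matchedGraph k M).neighborSet p).ncard = 1 := by
  rw [Set.ncard_eq_one]
  obtain ⟨w, hw, huniq⟩ := hM.1 (hM.2 ⟨toHex a b c k p, hp.1⟩)
  obtain ⟨h1, h2⟩ := toHex_ofHex N w.2
  refine ⟨ofHex a b c k w.1, Set.eq_singleton_iff_unique_mem.2 ⟨?_, ?_⟩⟩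
  · refine ⟨hp, h2, ?_⟩
    rw [h1]
    exact ⟨hp.1, w.2, hw⟩
  · rintro q ⟨-, hq, _, _, h⟩
    have := huniq _ h
    rw [← ofHex_toHex N hq]
    exact congrArg (fun w => ofHex a b c k w.1) this

theorem finite_neighborSet {G : SimpleGraph (ℤ × ℤ)} (hG : ∀ p q, G.Adj p q → LatticeAdj p q)
    (p : ℤ × ℤ) : (G.neighborSet p).Finite := by
  refine (Set.toFinite {(p.1 + 1, p.2), (p.1 - 1, p.2), (p.1, p.2 + 1), (p.1, p.2 - 1)}).subset ?_
  rintro ⟨x, y⟩ h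
  have := (latticeAdj_iff _ _).1 (hG _ _ h)
  obtain ⟨x', y'⟩ := p
  simp only [Prod.mk.injEq, Set.mem_insert_iff, Set.mem_singleton_iff] at this ⊢
  omega

theorem neighborSet_configOf_of_not (M : (hexGraph a b c).Subgraph) {p : ℤ × ℤ}
    (hp : ¬ IsHexSite a b c k p) :
    (configOf k M).neighborSet p = (fixedGraph a b c k).neighborSet p := by
  ext q
  exact ⟨fun h => h.elim id fun h => absurd h.1 hp, Or.inl⟩

theorem configOf_adj_outer (N : Normalized a b c k) (M : (hexGraph a b c).Subgraph) (j : ℤ) :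
    (configOf k M).Adj (outer (a + b + c) j) (inner (a + b + c) j) ↔ Odd (j - k) := by
  have hn : 0 < a + b + c := by have := N.ha; omega
  rw [← fixedGraph_adj_outer N]
  exact ⟨fun h => h.elim id fun h => absurd (h.1.inGrid N) (outer_inner_spec hn j).1, Or.inl⟩

/-- A site has one fixed and one matched edge, every other grid point has two fixed edges, and the
external edges are the fixed ones. -/
theorem isFPL_configOf (N : Normalized a b c k) {M : (hexGraph a b c).Subgraph}
    (hM : M.IsPerfectMatching) : IsFPL (a + b + c) (configOf k M) := by
  refine ⟨fun p q h => ⟨configOf_latticeAdj N h, ?_⟩, fun p hp => ?_, ?_⟩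
  · exact h.elim (fun h => h.1) fun h => Or.inl (h.1.inGrid N)
  · by_cases hs : IsHexSite a b c k p
    · have h1 : (configOf k M).neighborSet p =
          (fixedGraph a b c k).neighborSet p ∪ (matchedGraph k M).neighborSet p := rfl
      have f1 : ((fixedGraph a b c k).neighborSet p).Finite :=
        finite_neighborSet (fun _ _ h => edgeGraph_latticeAdj h) p
      have f2 : ((matchedGraph k M).neighborSet p).Finite :=
        finite_neighborSet (fun _ _ h => matchedGraph_latticeAdj N h) p
      have hd : Disjoint ((fixedGraph a b c k).neighborSet p) ((matchedGraph k M).neighborSet p) :=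
        Set.disjoint_left.2 fun q h h' => not_fixed_of_matched N h' h
      rw [h1, Set.ncard_union_eq hd f1 f2, ncard_fixedGraph_of_isHexSite N hs,
        ncard_matchedGraph N hM hs]
    · rw [neighborSet_configOf_of_not M hs, ncard_fixedGraph_of_not_isHexSite N hp hs]
  · simp only [configOf_adj_outer N]
    rcases Int.even_or_odd k with hk | hk
    · exact Or.inr fun j => by rw [Int.odd_sub, iff_true_right hk]
    · exact Or.inl fun j => by
        rw [Int.odd_sub', iff_true_left hk]

/-- An FPL configuration which contains the fixed edges is given by a matching. -/
theorem IsFPL.eq_configOf (N : Normalized a b c k) {G : SimpleGraph (ℤ × ℤ)}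
    (hG : IsFPL (a + b + c) G) (hfix : fixedGraph a b c k ≤ G)
    (hout : ∀ j, G.Adj (outer (a + b + c) j) (inner (a + b + c) j) → Odd (j - k)) :
    (matchingOf a b c k G).IsPerfectMatching ∧ configOf k (matchingOf a b c k G) = G := by
  have hn : 0 < a + b + c := by have := N.ha; omega
  have hlat : ∀ p q, G.Adj p q → LatticeAdj p q := fun p q h => (hG.1 p q h).1
  have hsub : ∀ p, (fixedGraph a b c k).neighborSet p ⊆ G.neighborSet p := fun p q h => hfix h
  have hfinG := finite_neighborSet hlat
  -- By counting, the two fixed edges at a point that is not a site exhaust its edges.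
  have hns : ∀ p q, InGrid (a + b + c) p → ¬ IsHexSite a b c k p → G.Adj p q →
      (fixedGraph a b c k).Adj p q := by
    intro p q hp hs h
    have := Set.eq_of_subset_of_ncard_le (hsub p) (by
      rw [ncard_fixedGraph_of_not_isHexSite N hp hs, hG.2.1 p hp]) (hfinG p)
    change q ∈ (fixedGraph a b c k).neighborSet p
    rw [this]
    exact h
  -- Hence the non-fixed edge at a site leads to another site; it is not external, since the
  -- occupied external edges are fixed.
  have hq : ∀ p q, IsHexSite a b c k p → G.Adj p q → ¬ (fixedGraph a b c k).Adj p q →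
      IsHexSite a b c k q := by
    intro p q hp h hf
    by_cases hgq : InGrid (a + b + c) q
    · by_contra hs
      exact hf (hns q p hgq hs h.symm).symm
    · exfalso
      obtain ⟨j, -, -, rfl, rfl⟩ := exists_outer hgq (hp.inGrid N) (hlat _ _ h).symm
      exact hf ((fixedGraph_adj_outer N j).2 (hout j h.symm)).symm
  have hiff : ∀ p q, IsHexSite a b c k p → IsHexSite a b c k q →
      ((matchedGraph k (matchingOf a b c k G)).Adj p q ↔
        G.Adj p q ∧ ¬ (fixedGraph a b c k).Adj p q) := by
    intro p q hp hq
    constructor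
    · intro h
      refine ⟨?_, not_fixed_of_matched N h⟩
      obtain ⟨-, -, _, _, -, h⟩ := h
      dsimp only at h
      rwa [ofHex_toHex N hp, ofHex_toHex N hq] at h
    · rintro ⟨h1, h2⟩
      refine ⟨hp, hq, hp.1, hq.1, ?_, ?_⟩
      · exact (hexNeighbours_iff_of_latticeAdj N hp hq (hlat _ _ h1)).2 h2
      · dsimp only
        rwa [ofHex_toHex N hp, ofHex_toHex N hq]
  constructor
  · refine ⟨fun u _ => ?_, fun _ => Set.mem_univ _⟩
    obtain ⟨e1, hp⟩ := toHex_ofHex N u.2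
    obtain ⟨p, hp'⟩ : ∃ p, p = ofHex a b c k u.1 := ⟨_, rfl⟩
    rw [← hp'] at hp e1
    have h1 : (G.neighborSet p \ (fixedGraph a b c k).neighborSet p).ncard = 1 := by
      have := Set.ncard_sdiff_add_ncard_of_subset (hsub p) (hfinG p)
      rw [ncard_fixedGraph_of_isHexSite N hp, hG.2.1 p (hp.inGrid N)] at this
      omega
    obtain ⟨q, hq'⟩ := Set.ncard_eq_one.1 h1
    have hmem : ∀ r, G.Adj p r ∧ ¬ (fixedGraph a b c k).Adj p r ↔ r = q := fun r => by
      rw [← Set.mem_singleton_iff, ← hq']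
      rfl
    have hqs := hq p q hp ((hmem q).2 rfl).1 ((hmem q).2 rfl).2
    have hadj : ∀ w : HexVertex a b c, (matchingOf a b c k G).Adj u w ↔
        ofHex a b c k w.1 = q := fun w => by
      rw [← hmem, ← hiff p _ hp (toHex_ofHex N w.2).2, hp', matchedGraph_adj_ofHex N]
    refine ⟨⟨toHex a b c k q, hqs.1⟩, (hadj _).2 (ofHex_toHex N hqs), fun w hw => ?_⟩
    refine Subtype.ext ?_
    dsimp only
    rw [← (hadj w).1 hw, (toHex_ofHex N w.2).1]
  · ext p q
    constructor
    · rintro (h | h)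
      · exact hfix h
      · exact ((hiff p q h.1 h.2.1).1 h).1
    · intro h
      by_cases hf : (fixedGraph a b c k).Adj p q
      · exact Or.inl hf
      have hs : ∀ p q, G.Adj p q → InGrid (a + b + c) p → ¬ (fixedGraph a b c k).Adj p q →
          (matchedGraph k (matchingOf a b c k G)).Adj p q := by
        intro p q h hg hf
        have hp : IsHexSite a b c k p := by
          by_contra hs
          exact hf (hns p q hg hs h)
        exact (hiff p q hp (hq p q hp h hf)).2 ⟨h, hf⟩
      rcases (hG.1 p q h).2 with hg | hg
      · exact Or.inr (hs p q h hg hf)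
      · exact Or.inr (hs q p h.symm hg fun h => hf h.symm).symm

end FullyPackedLoops

namespace FullyPackedLoops

/-! ### The paths of a configuration -/

section Paths

variable {n : ℕ} {G : SimpleGraph (ℤ × ℤ)}

theorem IsFPL.latticeAdj (hG : IsFPL n G) {p q : ℤ × ℤ} (h : G.Adj p q) : LatticeAdj p q :=
  (hG.1 p q h).1

theorem IsFPL.isLeaf (hG : IsFPL n G) {p : ℤ × ℤ} (hp : ¬ InGrid n p) : IsLeaf G p := by
  intro x y hx hy
  have hxg : InGrid n x := ((hG.1 p x hx).2).resolve_left hp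
  have hyg : InGrid n y := ((hG.1 p y hy).2).resolve_left hp
  have hn : 0 < n := by
    unfold InGrid at hxg
    omega
  obtain ⟨j, -, -, rfl, rfl⟩ := exists_outer hp hxg (hG.latticeAdj hx)
  exact ((outer_inner_spec hn j).2.2.2 y hyg (hG.latticeAdj hy)).symm

theorem IsFPL.exists_two (hG : IsFPL n G) {p : ℤ × ℤ} (hp : InGrid n p) :
    ∃ x y, x ≠ y ∧ ∀ q, G.Adj p q ↔ q = x ∨ q = y := by
  obtain ⟨x, y, hxy, h⟩ := Set.ncard_eq_two.1 (hG.2.1 p hp)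
  refine ⟨x, y, hxy, fun q => ?_⟩
  change q ∈ G.neighborSet p ↔ _
  rw [h]
  simp

theorem IsFPL.maxDegreeTwo (hG : IsFPL n G) : MaxDegreeTwo G := by
  intro v x y z hx hy hz
  by_cases hv : InGrid n v
  · obtain ⟨p, q, -, h⟩ := hG.exists_two hv
    rw [h] at hx hy hz
    rcases hx with rfl | rfl <;> rcases hy with rfl | rfl <;> rcases hz with rfl | rfl <;> simp
  · exact Or.inl (hG.isLeaf hv x y hx hy)

theorem IsFPL.adj_outer_iff (hG : IsFPL n G) {k : ℤ} (hk : ¬ G.Adj (outer n k) (inner n k))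
    (j : ℤ) : G.Adj (outer n j) (inner n j) ↔ Odd (j - k) := by
  rcases hG.2.2 with h | h
  · rw [h] at hk ⊢
    rw [Int.odd_sub']
    simp [Int.not_even_iff_odd.1 hk]
  · rw [h] at hk ⊢
    rw [Int.odd_sub]
    simp [Int.not_odd_iff_even.1 hk]

theorem IsBundle.congr {X Y : ℤ} {m : ℕ} (h : IsBundle n G X m) (hXY : X ≡ Y [ZMOD 4 * n]) :
    IsBundle n G Y m := by
  refine ⟨by rw [← outer_congr hXY, ← inner_congr hXY]; exact h.1, fun i h1 h2 => ?_⟩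
  rw [← outer_congr (hXY.add_right _), ← outer_congr (hXY.sub_right _)]
  exact h.2 i h1 h2

/-- No two external edges between the centres of two consecutive bundles are connected. -/
theorem not_reachable_of_bundles (hG : IsFPL n G) {X Y : ℤ} {p q : ℕ} (hX : IsBundle n G X p)
    (hY : IsBundle n G Y q) (hXY : Y = X + 2 * (p + q)) (hpq : p + q ≤ n) {j j' : ℤ} (h1 : X < j)
    (h2 : j < Y) (h3 : Odd (j - X)) (h1' : X < j') (h2' : j' < Y)
    (h : G.Reachable (outer n j) (outer n j')) : j = j' := by
  by_contra hne
  have hn : 0 < n := by omega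
  obtain ⟨t, ht⟩ := h3
  have leaf : ∀ j, IsLeaf G (outer n j) := fun j => hG.isLeaf (outer_inner_spec hn j).1
  -- The arch from `j` leaves the interval: it goes around `X` if `j` is one of the `p` occupied
  -- edges nearest to `X`, and around `Y` otherwise. With `j'` its path would have three ends.
  obtain ⟨i, hi, hout⟩ : ∃ i, G.Reachable (outer n j) (outer n i) ∧
      ((i < X ∧ X - 2 * p < i) ∨ (Y < i ∧ i < Y + 2 * q)) := by
    by_cases hjp : t < p
    · refine ⟨X - (2 * ((t + 1).toNat : ℕ) - 1), ?_, by omega⟩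
      have := hX.2 (t + 1).toNat (by omega) (by omega)
      rwa [show X + (2 * ((t + 1).toNat : ℕ) - 1) = j by omega] at this
    · refine ⟨Y + (2 * ((p + q - t).toNat : ℕ) - 1), ?_, by omega⟩
      have := hY.2 (p + q - t).toNat (by omega) (by omega)
      rw [show Y - (2 * ((p + q - t).toNat : ℕ) - 1) = j by omega] at this
      exact this.symm
  have ne : ∀ i j : ℤ, i ≠ j → i < j + 4 * n → j < i + 4 * n → outer n i ≠ outer n j := by
    intro i j hij h1 h2
    rcases lt_or_gt_of_ne hij with h | h
    · exact outer_ne h h2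
    · exact (outer_ne h h1).symm
  exact hG.maxDegreeTwo.not_three_leaves (leaf j) (leaf j') (leaf i)
    (ne _ _ hne (by omega) (by omega)) (ne _ _ (by omega) (by omega) (by omega))
    (ne _ _ (by omega) (by omega) (by omega)) h hi

/-- De Gier's lemma: the vertices of a region `S` are joined to their neighbours in direction `d`.
The region is only accessible through the external edges between two consecutive centres. -/
theorem adj_of_region (hG : IsFPL n G) {X Y : ℤ} {p q : ℕ} (hX : IsBundle n G X p)
    (hY : IsBundle n G Y q) (hXY : Y = X + 2 * (p + q)) (hpq : p + q ≤ n)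
    (S : ℤ × ℤ → Prop) (d : ℤ × ℤ) (hd : ∀ v, LatticeAdj (v - d) v) (ρ : ℤ × ℤ → ℤ) (lo : ℤ)
    (hS : ∀ v, S v → InGrid n v ∧ lo ≤ ρ v)
    (hρ : ∀ v u, S v → LatticeAdj v u → u ≠ v + d → ρ u < ρ v ∧ ρ (u - d) < ρ u)
    (hin : ∀ v u, S v → LatticeAdj v u → u ≠ v + d → InGrid n u → InGrid n (u - d) → S (u - d))
    (hin' : ∀ (v u : ℤ × ℤ) (j : ℤ), S v → LatticeAdj v u → u ≠ v + d → InGrid n u → -2 * n ≤ j → j < 2 * n →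
      u - d = outer n j → u = inner n j → Odd (j - X) ∧
        ((X < j ∧ j < Y) ∨ (X < j + 4 * n ∧ j + 4 * n < Y)))
    (hout : ∀ (v u : ℤ × ℤ) (j : ℤ), S v → LatticeAdj v u → u ≠ v + d → -2 * n ≤ j → j < 2 * n →
      u = outer n j → v = inner n j → Odd (j - X) →
        ((X < j ∧ j < Y) ∨ (X < j + 4 * n ∧ j + 4 * n < Y))) :
    ∀ v, S v → G.Adj v (v + d) := by
  by_cases hn : n = 0
  · intro v hv
    have := (hS v hv).1
    unfold InGrid at this
    omega
  -- Positions are computed for indices in `[-2 n, 2 n)`, whereas the arc from `X` to `Y` may extend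
  -- beyond `2 n`.
  have arc : ∀ j : ℤ, Odd (j - X) → ((X < j ∧ j < Y) ∨ (X < j + 4 * n ∧ j + 4 * n < Y)) →
      ∃ i, X < i ∧ i < Y ∧ Odd (i - X) ∧ outer n j = outer n i := by
    rintro j hj (h | h)
    · exact ⟨j, h.1, h.2, hj, rfl⟩
    · refine ⟨j + 4 * n, h.1, h.2, ?_, ?_⟩
      · rw [Int.odd_iff] at hj ⊢
        omega
      · have := outer_add_period n j 1
        rw [mul_one] at this
        exact this.symm
  refine adj_partner hG.maxDegreeTwo
    (fun e => ∃ j, X < j ∧ j < Y ∧ Odd (j - X) ∧ e = outer n j) S (fun v => v + d) ρ lo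
    (fun v hv => (hS v hv).2) ?_ ?_ ?_ ?_
  · rintro e ⟨j, -, -, -, rfl⟩
    exact hG.isLeaf (outer_inner_spec (by omega) j).1
  · rintro e e' ⟨j, h1, h2, h3, rfl⟩ ⟨j', h1', h2', h3', rfl⟩ h
    rw [not_reachable_of_bundles hG hX hY hXY hpq h1 h2 h3 h1' h2' h]
  · intro v hv
    obtain ⟨x, y, hxy, h⟩ := hG.exists_two (hS v hv).1
    exact ⟨x, y, hxy, (h x).2 (Or.inl rfl), (h y).2 (Or.inr rfl)⟩
  · intro v hv u huv hu
    have hl := hG.latticeAdj huv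
    obtain ⟨h1, h2⟩ := hρ v u hv hl hu
    refine ⟨h1, ?_⟩
    by_cases hgu : InGrid n u
    · refine Or.inr ⟨u - d, h2, (sub_add_cancel u d).symm, ?_⟩
      by_cases hgd : InGrid n (u - d)
      · exact Or.inl (hin v u hv hl hu hgu hgd)
      · obtain ⟨j, hj0, hj1, h3, h4⟩ := exists_outer hgd hgu (hd u)
        obtain ⟨h5, h6⟩ := hin' v u j hv hl hu hgu hj0 hj1 h3 h4
        refine Or.inr ⟨?_, ?_⟩
        · obtain ⟨i, hi⟩ := arc j h5 h6
          exact ⟨i, hi.1, hi.2.1, hi.2.2.1, h3.trans hi.2.2.2⟩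
        · rw [h3, h4]
          exact (hG.adj_outer_iff hX.1 j).2 h5
    · obtain ⟨j, hj0, hj1, rfl, rfl⟩ := exists_outer hgu (hS v hv).1 hl.symm
      have hodd := (hG.adj_outer_iff hX.1 j).1 huv.symm
      exact Or.inl (arc j hodd (hout _ _ j hv hl hu hj0 hj1 rfl rfl hodd))

end Paths

end FullyPackedLoops

/-! ### Triangular corners -/

namespace FullyPackedLoops

/-- In a triangular corner of the grid, with an unoccupied external edge at its apex, the edges
parallel to the base determine the other ones. -/
theorem corner_vertical {h v : ℤ → ℤ → ℤ} (i₀ : ℤ)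
    (hh : ∀ i j, 0 ≤ h i j ∧ h i j ≤ 1) (hv : ∀ i j, 0 ≤ v i j ∧ v i j ≤ 1)
    (hdeg : ∀ i j, i₀ ≤ i → 0 ≤ j → i + j < 0 → h i j + h (i - 1) j + v i j + v i (j - 1) = 2)
    (hodd : ∀ i j, i₀ - 1 ≤ i → 0 ≤ j → i + j < 0 → (i + j) % 2 = 1 → h i j = 1)
    (hbase : ∀ i, i₀ ≤ i → i < 0 → v i (-1) = i % 2) :
    ∀ i j, i₀ ≤ i → 0 ≤ j → i + j < 0 → (i + j) % 2 = 0 → v i j = 1 := by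
  have key : ∀ j : ℕ, ∀ i : ℤ, i₀ ≤ i → i + j < 0 →
      v i ((j : ℤ) - 1) = (i + j) % 2 ∧ v i j = 1 - (i + j) % 2 := by
    have step : ∀ j : ℕ, (∀ i, i₀ ≤ i → i + j < 0 → v i ((j : ℤ) - 1) = (i + j) % 2) → ∀ i : ℤ, i₀ ≤ i →
        i + j < 0 → v i ((j : ℤ) - 1) = (i + j) % 2 ∧ v i j = 1 - (i + j) % 2 := by
      intro j hprev i hi hij
      refine ⟨hprev i hi hij, ?_⟩
      have h1 := hdeg i j hi (by omega) hij
      have h2 := hprev i hi hij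
      have h3 := hh (i - 1) j
      have h4 := hv i j
      -- If `i + j` is odd, the horizontal edge `h i j` and the edge from below already make degree
      -- two, so nothing goes up. If `i + j` is even, the right neighbour is saturated in this way,
      -- hence `h i j = 0`; as nothing comes from below either, the edge upwards is needed.
      rcases Int.emod_two_eq_zero_or_one (i + j) with hp | hp
      · have h5 := hodd (i - 1) j (by omega) (by omega) (by omega) (by omega)
        have h6 := hdeg (i + 1) j (by omega) (by omega) (by omega)
        have h7 := hodd (i + 1) j (by omega) (by omega) (by omega) (by omega)
        have h8 := hprev (i + 1) (by omega) (by omega)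
        have h9 := hh i j
        have h10 := hv (i + 1) j
        rw [add_sub_cancel_right] at h6
        omega
      · have h5 := hodd i j (by omega) (by omega) (by omega) hp
        omega
    intro j
    induction j with
    | zero =>
      refine step 0 fun i hi hij => ?_
      have := hbase i hi (by push_cast at hij; omega)
      simpa using this
    | succ j ih =>
      refine step (j + 1) fun i hi hij => ?_
      have := (ih i hi (by push_cast at hij; omega)).2
      push_cast at hij ⊢
      rw [add_sub_cancel_right]
      omega
  intro i j hi hj hij hp
  have := (key j.toNat i hi (by omega)).2
  rw [Int.toNat_of_nonneg hj] at this
  omega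

end FullyPackedLoops

/-! ### Forced edges in the three regions, by de Gier's lemma -/

namespace FullyPackedLoops
variable {a b c : ℕ} {k : ℤ} {G : SimpleGraph (ℤ × ℤ)}

/-- FPL configurations of the given type, in normalized position. -/
structure IsNormalFPL (a b c : ℕ) (k : ℤ) (G : SimpleGraph (ℤ × ℤ)) : Prop where
  isFPL : IsFPL (a + b + c) G
  bundleA : IsBundle (a + b + c) G (k - 2 * (c + a)) a
  bundleB : IsBundle (a + b + c) G (k + 2 * (b + c)) b
  bundleC : IsBundle (a + b + c) G k c

namespace IsNormalFPL

/-- The region is bounded by the diagonals `x + y - k - 2 = 2 * (c + a - k - 1)` and `x - y - k =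
0`, and is only entered from outside through the arc from `A` to `C`. Descending to the left stays
in it until that arc is reached. -/
theorem adj_left (H : IsNormalFPL a b c k G) (N : Normalized a b c k) {x y : ℤ}
    (hg : InGrid (a + b + c) (x, y)) (hodd : (x + y - k) % 2 = 1)
    (hs : x + y - k - 2 < 2 * (c + a - k - 1)) (ht : x - y - k < 0) :
    G.Adj (x, y) (x + 1, y) := by
  obtain ⟨ha, hb, hc, h1, h2⟩ := N
  have := adj_of_region H.isFPL H.bundleA H.bundleC (by ring) (by omega)
    (fun v => InGrid (a + b + c) v ∧ (v.1 + v.2 - k) % 2 = 1 ∧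
      v.1 + v.2 - k - 2 < 2 * (c + a - k - 1) ∧ v.1 - v.2 - k < 0) (1, 0)
    -- The rank is `2 x` on the parity class of the region and `2 x - 1` on the other one. It drops
    -- both when leaving a vertex other than by its partner edge and when passing backwards along a
    -- partner edge.
    (fun v => by rw [latticeAdj_iff]; simp [Prod.ext_iff]) (fun v => 2 * v.1 - (v.1 + v.2 - k + 1) % 2) 0
    ?_ ?_ ?_ ?_ ?_ (x, y) ⟨hg, hodd, hs, ht⟩
  · simpa using this
  · rintro ⟨x, y⟩ ⟨hg, h⟩
    refine ⟨hg, ?_⟩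
    unfold InGrid at hg
    dsimp only at *
    omega
  · rintro ⟨x, y⟩ ⟨x', y'⟩ ⟨-, h⟩ hl hu
    rw [latticeAdj_iff] at hl
    simp only [Prod.mk_add_mk, Prod.mk_sub_mk, Prod.mk.injEq, ne_eq] at *
    omega
  · rintro ⟨x, y⟩ ⟨x', y'⟩ ⟨-, h⟩ hl hu - hg
    refine ⟨hg, ?_⟩
    rw [latticeAdj_iff] at hl
    simp only [Prod.mk_add_mk, Prod.mk_sub_mk, Prod.mk.injEq, ne_eq] at *
    omega
  · rintro ⟨x, y⟩ ⟨x', y'⟩ j ⟨hg, h⟩ hl hu hg' hj0 hj1 e1 e2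
    rw [latticeAdj_iff] at hl
    unfold InGrid at hg hg'
    push_cast at hg hg' hj0 hj1
    rcases outer_inner_cases hj0 (by omega) with ⟨_, _, e3, e4⟩ | ⟨_, e3, e4⟩ | ⟨_, e3, e4⟩ |
      ⟨_, _, e3, e4⟩ <;> rw [e3] at e1 <;> rw [e4] at e2 <;>
    simp only [Prod.mk_add_mk, Prod.mk_sub_mk, Prod.mk.injEq, ne_eq] at * <;> rw [Int.odd_iff] <;>
    omega
  · rintro ⟨x, y⟩ ⟨x', y'⟩ j ⟨hg, h⟩ hl hu hj0 hj1 e1 e2 hj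
    rw [latticeAdj_iff] at hl
    unfold InGrid at hg
    rw [Int.odd_iff] at hj
    rcases outer_inner_cases hj0 hj1 with ⟨_, _, e3, e4⟩ | ⟨_, e3, e4⟩ | ⟨_, e3, e4⟩ |
      ⟨_, _, e3, e4⟩ <;> rw [e3] at e1 <;> rw [e4] at e2 <;>
    simp only [Prod.mk_add_mk, Prod.mk.injEq, ne_eq] at * <;> push_cast at * <;>
    omega

/-- The same argument for the arc from `B` to `A`, with the descent going upwards. -/
theorem adj_upper (H : IsNormalFPL a b c k G) (N : Normalized a b c k) {x y : ℤ}
    (hg : InGrid (a + b + c) (x, y)) (heven : (x + y - k) % 2 = 0)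
    (hs : 2 * (c + a - k - 1) < x + y - k - 3) (ht : x - y - k + 1 < 2 * (a - k)) :
    G.Adj (x, y) (x, y - 1) := by
  obtain ⟨ha, hb, hc, h1, h2⟩ := N
  -- The number of `A` is raised by the period `4 n`, so that it comes after the number of `B`.
  have hA : IsBundle (a + b + c) G (k + 2 * (b + c) + 2 * (b + a)) a := H.bundleA.congr
    (Int.modEq_iff_dvd.2 ⟨1, by push_cast; ring⟩)
  have := adj_of_region H.isFPL H.bundleB hA (by ring) (by omega)
    (fun v => InGrid (a + b + c) v ∧ (v.1 + v.2 - k) % 2 = 0 ∧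
      2 * (c + a - k - 1) < v.1 + v.2 - k - 3 ∧ v.1 - v.2 - k + 1 < 2 * (a - k)) (0, -1)
    (fun v => by rw [latticeAdj_iff]; simp [Prod.ext_iff]) (fun v => -2 * v.2 - (v.1 + v.2 - k) % 2)
    (-2 * (a + b + c))
    ?_ ?_ ?_ ?_ ?_ (x, y) ⟨hg, heven, hs, ht⟩
  · simpa [sub_eq_add_neg] using this
  · rintro ⟨x, y⟩ ⟨hg, h⟩
    refine ⟨hg, ?_⟩
    unfold InGrid at hg
    push_cast at hg
    dsimp only at *
    omega
  · rintro ⟨x, y⟩ ⟨x', y'⟩ ⟨-, h⟩ hl hu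
    rw [latticeAdj_iff] at hl
    simp only [Prod.mk_add_mk, Prod.mk_sub_mk, Prod.mk.injEq, ne_eq] at *
    omega
  · rintro ⟨x, y⟩ ⟨x', y'⟩ ⟨-, h⟩ hl hu - hg
    refine ⟨hg, ?_⟩
    rw [latticeAdj_iff] at hl
    simp only [Prod.mk_add_mk, Prod.mk_sub_mk, Prod.mk.injEq, ne_eq] at *
    omega
  · rintro ⟨x, y⟩ ⟨x', y'⟩ j ⟨hg, h⟩ hl hu hg' hj0 hj1 e1 e2
    rw [latticeAdj_iff] at hl
    unfold InGrid at hg hg'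
    push_cast at hg hg' hj0 hj1
    rcases outer_inner_cases hj0 (by omega) with ⟨_, _, e3, e4⟩ | ⟨_, e3, e4⟩ | ⟨_, e3, e4⟩ |
      ⟨_, _, e3, e4⟩ <;> rw [e3] at e1 <;> rw [e4] at e2 <;>
    simp only [Prod.mk_add_mk, Prod.mk_sub_mk, Prod.mk.injEq, ne_eq] at * <;> rw [Int.odd_iff] <;>
    omega
  · rintro ⟨x, y⟩ ⟨x', y'⟩ j ⟨hg, h⟩ hl hu hj0 hj1 e1 e2 hj
    rw [latticeAdj_iff] at hl
    unfold InGrid at hg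
    rw [Int.odd_iff] at hj
    rcases outer_inner_cases hj0 hj1 with ⟨_, _, e3, e4⟩ | ⟨_, e3, e4⟩ | ⟨_, e3, e4⟩ |
      ⟨_, _, e3, e4⟩ <;> rw [e3] at e1 <;> rw [e4] at e2 <;>
    simp only [Prod.mk_add_mk, Prod.mk.injEq, ne_eq] at * <;> push_cast at * <;>
    omega

/-- The same argument for the arc from `C` to `B`, with the descent going to the right. -/
theorem adj_right (H : IsNormalFPL a b c k G) (N : Normalized a b c k) {x y : ℤ}
    (hg : InGrid (a + b + c) (x, y)) (hodd : (x + y - k) % 2 = 1)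
    (hs : 0 ≤ x + y - k - 3) (ht : 2 * (a - k) ≤ x - y - k - 1) :
    G.Adj (x, y) (x - 1, y) := by
  obtain ⟨ha, hb, hc, h1, h2⟩ := N
  have := adj_of_region H.isFPL H.bundleC H.bundleB (by ring) (by omega)
    (fun v => InGrid (a + b + c) v ∧ (v.1 + v.2 - k) % 2 = 1 ∧
      0 ≤ v.1 + v.2 - k - 3 ∧ 2 * (a - k) ≤ v.1 - v.2 - k - 1) (-1, 0)
    (fun v => by rw [latticeAdj_iff]; simp [Prod.ext_iff]) (fun v => -2 * v.1 - (v.1 + v.2 - k + 1) % 2)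
    (-2 * (a + b + c))
    ?_ ?_ ?_ ?_ ?_ (x, y) ⟨hg, hodd, hs, ht⟩
  · simpa [sub_eq_add_neg] using this
  · rintro ⟨x, y⟩ ⟨hg, h⟩
    refine ⟨hg, ?_⟩
    unfold InGrid at hg
    push_cast at hg
    dsimp only at *
    omega
  · rintro ⟨x, y⟩ ⟨x', y'⟩ ⟨-, h⟩ hl hu
    rw [latticeAdj_iff] at hl
    simp only [Prod.mk_add_mk, Prod.mk_sub_mk, Prod.mk.injEq, ne_eq] at *
    omega
  · rintro ⟨x, y⟩ ⟨x', y'⟩ ⟨-, h⟩ hl hu - hg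
    refine ⟨hg, ?_⟩
    rw [latticeAdj_iff] at hl
    simp only [Prod.mk_add_mk, Prod.mk_sub_mk, Prod.mk.injEq, ne_eq] at *
    omega
  · rintro ⟨x, y⟩ ⟨x', y'⟩ j ⟨hg, h⟩ hl hu hg' hj0 hj1 e1 e2
    rw [latticeAdj_iff] at hl
    unfold InGrid at hg hg'
    push_cast at hg hg' hj0 hj1
    rcases outer_inner_cases hj0 (by omega) with ⟨_, _, e3, e4⟩ | ⟨_, e3, e4⟩ | ⟨_, e3, e4⟩ |
      ⟨_, _, e3, e4⟩ <;> rw [e3] at e1 <;> rw [e4] at e2 <;>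
    simp only [Prod.mk_add_mk, Prod.mk_sub_mk, Prod.mk.injEq, ne_eq] at * <;> rw [Int.odd_iff] <;>
    omega
  · rintro ⟨x, y⟩ ⟨x', y'⟩ j ⟨hg, h⟩ hl hu hj0 hj1 e1 e2 hj
    rw [latticeAdj_iff] at hl
    unfold InGrid at hg
    rw [Int.odd_iff] at hj
    rcases outer_inner_cases hj0 hj1 with ⟨_, _, e3, e4⟩ | ⟨_, e3, e4⟩ | ⟨_, e3, e4⟩ |
      ⟨_, _, e3, e4⟩ <;> rw [e3] at e1 <;> rw [e4] at e2 <;>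
    simp only [Prod.mk_add_mk, Prod.mk.injEq, ne_eq] at * <;> push_cast at * <;>
    omega

end IsNormalFPL

end FullyPackedLoops

/-! ### Forced edges in the corners next to the centres -/

namespace FullyPackedLoops
variable {a b c : ℕ} {k : ℤ} {G : SimpleGraph (ℤ × ℤ)}

/-- The indicator of the edge from `(x, y)` to `(x + 1, y)`. -/
noncomputable def edgeR (G : SimpleGraph (ℤ × ℤ)) (x y : ℤ) : ℤ := ind (G.Adj (x, y) (x + 1, y))

/-- The indicator of the edge from `(x, y)` to `(x, y + 1)`. -/
noncomputable def edgeU (G : SimpleGraph (ℤ × ℤ)) (x y : ℤ) : ℤ := ind (G.Adj (x, y) (x, y + 1))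

theorem ind_mem (P : Prop) : 0 ≤ ind P ∧ ind P ≤ 1 := by
  unfold ind; split_ifs <;> simp

theorem IsFPL.edge_sum {n : ℕ} (hG : IsFPL n G) {x y : ℤ} (hg : InGrid n (x, y)) :
    edgeR G x y + edgeR G (x - 1) y + edgeU G x y + edgeU G x (y - 1) = 2 := by
  have h := ncard_neighborSet (fun _ _ h => hG.latticeAdj h) x y
  rw [hG.2.1 _ hg] at h
  unfold edgeR edgeU
  rw [sub_add_cancel, sub_add_cancel, ← h]
  rfl

namespace IsNormalFPL

theorem ind_outer (H : IsNormalFPL a b c k G) (j : ℤ) :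
    ind (G.Adj (outer (a + b + c) j) (inner (a + b + c) j)) = (j - k) % 2 := by
  have h := H.isFPL.adj_outer_iff H.bundleC.1 j
  rw [Int.odd_iff] at h
  rcases ind_cases (G.Adj (outer (a + b + c) j) (inner (a + b + c) j)) with ⟨h1, h2⟩ | ⟨h1, h2⟩
  · rw [h2, h.1 h1]
  · rw [h] at h1
    omega

theorem edgeU_bottom (H : IsNormalFPL a b c k G) {x : ℤ} (h1 : 1 ≤ x) (h2 : x ≤ a + b + c) :
    edgeU G x 0 = (x - 1 - k) % 2 := by
  obtain ⟨e1, e2⟩ := outer_inner_bottom (n := a + b + c) (j := x - 1) (by omega)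
    (by push_cast; omega)
  rw [← H.ind_outer, e1, e2, sub_add_cancel]
  rfl

theorem edgeU_top (H : IsNormalFPL a b c k G) {x : ℤ} (h1 : 1 ≤ x) (h2 : x ≤ a + b + c) :
    edgeU G x (a + b + c) = (a + b + c + x - k) % 2 := by
  obtain ⟨e1, e2⟩ := outer_inner_top_neg (n := a + b + c) (j := -(a + b + c) - x)
    (by push_cast; omega) (by push_cast; omega)
  have := H.ind_outer (-(a + b + c) - x)
  rw [e1, e2, SimpleGraph.adj_comm] at this
  push_cast at this
  rw [sub_sub_cancel] at this
  unfold edgeU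
  rw [this]
  omega

theorem edgeR_left (H : IsNormalFPL a b c k G) {y : ℤ} (h1 : 1 ≤ y) (h2 : y ≤ a + b + c) :
    edgeR G 0 y = (y - k) % 2 := by
  obtain ⟨e1, e2⟩ := outer_inner_left_neg (n := a + b + c) (j := -y)
    (by push_cast; omega) (by omega)
  have := H.ind_outer (-y)
  rw [e1, e2, neg_neg] at this
  unfold edgeR
  rw [zero_add, this]
  omega

theorem edgeR_right (H : IsNormalFPL a b c k G) {y : ℤ} (h1 : 1 ≤ y) (h2 : y ≤ a + b + c) :
    edgeR G (a + b + c) y = (a + b + c + y - 1 - k) % 2 := by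
  obtain ⟨e1, e2⟩ := outer_inner_right (n := a + b + c) (j := a + b + c + y - 1)
    (by push_cast; omega) (by push_cast; omega)
  have := H.ind_outer (a + b + c + y - 1)
  rw [e1, e2, SimpleGraph.adj_comm] at this
  push_cast at this
  rw [show (a : ℤ) + b + c + y - 1 - (a + b + c) + 1 = y by ring] at this
  exact this

/-- The triangle to the left of `C`, below the diagonal through `C`, with its base on the bottom
side. The coordinates of `corner_vertical` start at `C`, and the edges parallel to the base come
from `adj_left`. -/
theorem corner_bottom_left (H : IsNormalFPL a b c k G) (N : Normalized a b c k) {x y : ℤ}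
    (hg : InGrid (a + b + c) (x, y)) (heven : (x + y - k) % 2 = 0) (hs : x + y - k - 2 < 0) :
    edgeU G x y = 1 := by
  obtain ⟨ha, hb, hc, h1, h2⟩ := id N
  unfold InGrid at hg
  push_cast at hg
  have := corner_vertical (h := fun i j => edgeR G (i + k + 1) (j + 1))
    (v := fun i j => edgeU G (i + k + 1) (j + 1)) (-k) (fun i j => ind_mem _) (fun i j => ind_mem _)
    ?_ ?_ ?_ (x - k - 1) (y - 1) (by omega) (by omega) (by omega) (by omega)
  · convert this using 2 <;> ring
  · intro i j hi hj hij
    refine Eq.trans ?_ (H.isFPL.edge_sum (x := i + k + 1) (y := j + 1)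
      (by unfold InGrid; push_cast; omega))
    ring_nf
  · intro i j hi hj hij hp
    -- The leftmost edge of a row is external, so its occupation is known from its number; the
    -- others are covered by the region lemma.
    by_cases hi' : i = -k - 1
    · subst hi'
      rw [show -k - 1 + k + 1 = 0 by ring, H.edgeR_left (by omega) (by omega)]
      omega
    · have := H.adj_left N (x := i + k + 1) (y := j + 1) (by unfold InGrid; push_cast; omega)
        (by omega) (by omega) (by omega)
      refine ind_eq_one.2 ?_
      exact this
  · intro i hi hi'
    rw [show (-1 : ℤ) + 1 = 0 by ring, H.edgeU_bottom (by omega) (by omega)]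
    omega

/-- The mirror image on the other side of `C`, with `adj_right`. -/
theorem corner_bottom_right (H : IsNormalFPL a b c k G) (N : Normalized a b c k) {x y : ℤ}
    (hg : InGrid (a + b + c) (x, y)) (heven : (x + y - k) % 2 = 0) (ht : 0 < x - y - k) :
    edgeU G x y = 1 := by
  obtain ⟨ha, hb, hc, h1, h2⟩ := id N
  unfold InGrid at hg
  push_cast at hg
  have := corner_vertical (h := fun i j => edgeR G (k - i) (j + 1))
    (v := fun i j => edgeU G (k + 1 - i) (j + 1)) (k + 1 - (a + b + c)) (fun i j => ind_mem _) (fun i j => ind_mem _)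
    ?_ ?_ ?_ (k + 1 - x) (y - 1) (by omega) (by omega) (by omega) (by omega)
  · convert this using 2 <;> ring
  · intro i j hi hj hij
    refine Eq.trans ?_ (H.isFPL.edge_sum (x := k + 1 - i) (y := j + 1)
      (by unfold InGrid; push_cast; omega))
    ring_nf
  · intro i j hi hj hij hp
    by_cases hi' : i = k + 1 - (a + b + c) - 1
    · subst hi'
      rw [show k - (k + 1 - (a + b + c) - 1) = (a : ℤ) + b + c by ring,
        H.edgeR_right (by omega) (by omega)]
      omega
    · have := H.adj_right N (x := k + 1 - i) (y := j + 1) (by unfold InGrid; push_cast; omega)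
        (by omega) (by omega) (by omega)
      refine ind_eq_one.2 ?_
      rw [SimpleGraph.adj_comm]
      convert this using 2 <;> ring
  · intro i hi hi'
    rw [show (-1 : ℤ) + 1 = 0 by ring, H.edgeU_bottom (by omega) (by omega)]
    omega

/-- The triangle to the left of `A` when `A` is on the top side, hanging from that side; there is no
such point when `A` is on the left side. -/
theorem corner_left_of_top (H : IsNormalFPL a b c k G) (N : Normalized a b c k) {x y : ℤ}
    (hg : InGrid (a + b + c) (x, y)) (heven : (x + y - k) % 2 = 0)
    (ht : x - y - k < -2 * (b + k)) :
    edgeU G x (y - 1) = 1 := by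
  obtain ⟨ha, hb, hc, h1, h2⟩ := id N
  unfold InGrid at hg
  push_cast at hg
  have := corner_vertical (h := fun i j => edgeR G (i + (c + a - b - k)) (a + b + c - j))
    (v := fun i j => edgeU G (i + (c + a - b - k)) (a + b + c - j - 1)) (1 - (c + a - b - k)) (fun i j => ind_mem _) (fun i j => ind_mem _)
    ?_ ?_ ?_ (x - (c + a - b - k)) (a + b + c - y) (by omega) (by omega) (by omega) (by omega)
  · convert this using 2 <;> ring
  · intro i j hi hj hij
    refine Eq.trans ?_ (H.isFPL.edge_sum (x := i + (c + a - b - k)) (y := a + b + c - j)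
      (by unfold InGrid; push_cast; omega))
    ring_nf
  · intro i j hi hj hij hp
    by_cases hi' : i = 1 - (c + a - b - k) - 1
    · subst hi'
      rw [show 1 - (c + a - b - k) - 1 + (c + a - b - k) = 0 by ring,
        H.edgeR_left (by omega) (by omega)]
      omega
    · have := H.adj_left N (x := i + (c + a - b - k)) (y := a + b + c - j) (by unfold InGrid; push_cast; omega)
        (by omega) (by omega) (by omega)
      refine ind_eq_one.2 ?_
      exact this
  · intro i hi hi'
    rw [show (a : ℤ) + b + c - -1 - 1 = a + b + c by ring, H.edgeU_top (by omega) (by omega)]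
    omega

/-- The triangle above `A` when `A` is on the left side, with its base on that side. The roles of
rows and columns are exchanged, and the edges parallel to the base come from `adj_upper`. -/
theorem corner_above_left (H : IsNormalFPL a b c k G) (N : Normalized a b c k) {x y : ℤ}
    (hg : InGrid (a + b + c) (x, y)) (hodd : (x + y - k) % 2 = 1)
    (ht : x - y - k < 1 - 2 * (c + a)) :
    edgeR G x y = 1 := by
  obtain ⟨ha, hb, hc, h1, h2⟩ := id N
  unfold InGrid at hg
  push_cast at hg
  have := corner_vertical (h := fun i j => edgeU G (j + 1) (2 * (c + a) - k - i - 1))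
    (v := fun i j => edgeR G (j + 1) (2 * (c + a) - k - i)) (2 * (c + a) - k - (a + b + c)) (fun i j => ind_mem _) (fun i j => ind_mem _)
    ?_ ?_ ?_ (2 * (c + a) - k - y) (x - 1) (by omega) (by omega) (by omega) (by omega)
  · convert this using 2 <;> ring
  · intro i j hi hj hij
    refine Eq.trans ?_ (H.isFPL.edge_sum (x := j + 1) (y := 2 * (c + a) - k - i)
      (by unfold InGrid; push_cast; omega))
    ring_nf
  · intro i j hi hj hij hp
    by_cases hi' : i = 2 * (c + a) - k - (a + b + c) - 1
    · subst hi'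
      rw [show 2 * (c + a) - k - (2 * (c + a) - k - (a + b + c) - 1) - 1 = (a : ℤ) + b + c by ring,
        H.edgeU_top (by omega) (by omega)]
      omega
    · have := H.adj_upper N (x := j + 1) (y := 2 * (c + a) - k - i) (by unfold InGrid; push_cast; omega)
        (by omega) (by omega) (by omega)
      refine ind_eq_one.2 ?_
      rw [SimpleGraph.adj_comm]
      convert this using 2
      ring
  · intro i hi hi'
    rw [show (-1 : ℤ) + 1 = 0 by ring, H.edgeR_left (by omega) (by omega)]
    omega

/-- The triangle above `B` when `B` is on the right side. -/
theorem corner_above_right (H : IsNormalFPL a b c k G) (N : Normalized a b c k) {x y : ℤ}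
    (hg : InGrid (a + b + c) (x, y)) (hodd : (x + y - k) % 2 = 1)
    (hs : 2 * (b + c) - 1 < x + y - k - 2) :
    edgeR G (x - 1) y = 1 := by
  obtain ⟨ha, hb, hc, h1, h2⟩ := id N
  unfold InGrid at hg
  push_cast at hg
  have := corner_vertical (h := fun i j => edgeU G (a + b + c - j) (k + 1 + b + c - a - i - 1))
    (v := fun i j => edgeR G (a + b + c - j - 1) (k + 1 + b + c - a - i)) (k + 1 + b + c - a - (a + b + c)) (fun i j => ind_mem _) (fun i j => ind_mem _)
    ?_ ?_ ?_ (k + 1 + b + c - a - y) (a + b + c - x) (by omega) (by omega) (by omega) (by omega)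
  · convert this using 2 <;> ring
  · intro i j hi hj hij
    refine Eq.trans ?_ (H.isFPL.edge_sum (x := a + b + c - j) (y := k + 1 + b + c - a - i)
      (by unfold InGrid; push_cast; omega))
    ring_nf
  · intro i j hi hj hij hp
    by_cases hi' : i = k + 1 + b + c - a - (a + b + c) - 1
    · subst hi'
      rw [show k + 1 + b + c - a - (k + 1 + b + c - a - (a + b + c) - 1) - 1 = (a : ℤ) + b + c by ring,
        H.edgeU_top (by omega) (by omega)]
      omega
    · have := H.adj_upper N (x := a + b + c - j) (y := k + 1 + b + c - a - i) (by unfold InGrid; push_cast; omega)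
        (by omega) (by omega) (by omega)
      refine ind_eq_one.2 ?_
      rw [SimpleGraph.adj_comm]
      convert this using 2
      ring
  · intro i hi hi'
    rw [show (a : ℤ) + b + c - -1 - 1 = a + b + c by ring, H.edgeR_right (by omega) (by omega)]
    omega

/-- The triangle to the right of `B` when `B` is on the top side. -/
theorem corner_right_of_top (H : IsNormalFPL a b c k G) (N : Normalized a b c k) {x y : ℤ}
    (hg : InGrid (a + b + c) (x, y)) (heven : (x + y - k) % 2 = 0)
    (hs : 2 * (2 * a + b + c - 1 - k) < x + y - k - 2) :
    edgeU G x (y - 1) = 1 := by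
  obtain ⟨ha, hb, hc, h1, h2⟩ := id N
  unfold InGrid at hg
  push_cast at hg
  have := corner_vertical (h := fun i j => edgeR G (3 * a + b + c - k - i - 1) (a + b + c - j))
    (v := fun i j => edgeU G (3 * a + b + c - k - i) (a + b + c - j - 1)) (3 * a + b + c - k - (a + b + c)) (fun i j => ind_mem _) (fun i j => ind_mem _)
    ?_ ?_ ?_ (3 * a + b + c - k - x) (a + b + c - y) (by omega) (by omega) (by omega) (by omega)
  · convert this using 2 <;> ring
  · intro i j hi hj hij
    refine Eq.trans ?_ (H.isFPL.edge_sum (x := 3 * a + b + c - k - i) (y := a + b + c - j)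
      (by unfold InGrid; push_cast; omega))
    ring_nf
  · intro i j hi hj hij hp
    by_cases hi' : i = 3 * a + b + c - k - (a + b + c) - 1
    · subst hi'
      rw [show 3 * a + b + c - k - (3 * a + b + c - k - (a + b + c) - 1) - 1 = (a : ℤ) + b + c by ring,
        H.edgeR_right (by omega) (by omega)]
      omega
    · have := H.adj_right N (x := 3 * a + b + c - k - i) (y := a + b + c - j) (by unfold InGrid; push_cast; omega)
        (by omega) (by omega) (by omega)
      refine ind_eq_one.2 ?_
      rw [SimpleGraph.adj_comm]
      convert this using 2
      ring
  · intro i hi hi'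
    rw [show (a : ℤ) + b + c - -1 - 1 = a + b + c by ring, H.edgeU_top (by omega) (by omega)]
    omega

end IsNormalFPL

end FullyPackedLoops

/-! ### All fixed edges are occupied -/

namespace FullyPackedLoops
variable {a b c : ℕ} {k : ℤ} {G : SimpleGraph (ℤ × ℤ)}

namespace IsNormalFPL

theorem adj_of_fixedRight (H : IsNormalFPL a b c k G) (N : Normalized a b c k) {x y : ℤ}
    (hg : InGrid (a + b + c) (x, y)) (hg' : InGrid (a + b + c) (x + 1, y))
    (h : FixedRight a b c k x y) : G.Adj (x, y) (x + 1, y) := by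
  obtain ⟨ha, hb, hc, h1, h2⟩ := id N
  have hc1 := hg
  have hc2 := hg'
  unfold InGrid at hc1 hc2
  push_cast at hc1 hc2
  rcases Int.emod_two_eq_zero_or_one (x + y - k) with hp | hp
  · rw [fixedRight_even hp] at h
    by_cases hR : 2 * (a - k) ≤ x - y - k ∧ 0 ≤ x + y - k - 2
    · have := H.adj_right N hg' (by omega) (by omega) (by omega)
      rw [add_sub_cancel_right] at this
      exact this.symm
    · have := H.corner_above_right N hg' (by omega) (by omega)
      rw [add_sub_cancel_right] at this
      exact ind_eq_one.1 this
  · rw [fixedRight_odd hp] at h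
    by_cases hL : x + y - k - 2 < 2 * (c + a - k - 1) ∧ x - y - k < 0
    · exact H.adj_left N hg hp hL.1 hL.2
    · exact ind_eq_one.1 (H.corner_above_left N hg hp (by omega))

theorem adj_of_fixedUp (H : IsNormalFPL a b c k G) (N : Normalized a b c k) {x y : ℤ}
    (hg : InGrid (a + b + c) (x, y)) (hg' : InGrid (a + b + c) (x, y + 1))
    (h : FixedUp a b c k x y) : G.Adj (x, y) (x, y + 1) := by
  obtain ⟨ha, hb, hc, h1, h2⟩ := id N
  have hc1 := hg
  have hc2 := hg'
  unfold InGrid at hc1 hc2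
  push_cast at hc1 hc2
  rcases Int.emod_two_eq_zero_or_one (x + y - k) with hp | hp
  · rw [fixedUp_even hp] at h
    rcases h with h | h
    · exact ind_eq_one.1 (H.corner_bottom_left N hg hp h)
    · exact ind_eq_one.1 (H.corner_bottom_right N hg hp h)
  · rw [fixedUp_odd hp] at h
    by_cases hU : 2 * (c + a - k - 1) < x + y - k - 2 ∧ x - y - k < 2 * (a - k)
    · have := H.adj_upper N hg' (by omega) (by omega) (by omega)
      rw [add_sub_cancel_right] at this
      exact this.symm
    · by_cases ht : x - y - k < -2 * (b + k)
      · have := H.corner_left_of_top N hg' (by omega) (by omega)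
        rw [add_sub_cancel_right] at this
        exact ind_eq_one.1 this
      · have := H.corner_right_of_top N hg' (by omega) (by omega)
        rw [add_sub_cancel_right] at this
        exact ind_eq_one.1 this

/-- The internal fixed edges are those of the three regions and of the corners; the external ones
are occupied by parity. -/
theorem fixedGraph_le (H : IsNormalFPL a b c k G) (N : Normalized a b c k) :
    fixedGraph a b c k ≤ G := by
  have hn : 0 < a + b + c := by have := N.ha; omega
  have hout : ∀ p q, ¬ InGrid (a + b + c) p → (fixedGraph a b c k).Adj p q → G.Adj p q := by
    intro p q hp h
    obtain ⟨j, -, -, rfl, rfl⟩ := exists_outer hp (h.1.resolve_left hp) (edgeGraph_latticeAdj h)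
    rw [H.isFPL.adj_outer_iff H.bundleC.1, ← fixedGraph_adj_outer N]
    exact h
  intro p q h
  by_cases hp : InGrid (a + b + c) p
  · by_cases hq : InGrid (a + b + c) q
    · rcases h.2 with ⟨rfl, hf⟩ | ⟨rfl, hf⟩ | ⟨rfl, hf⟩ | ⟨rfl, hf⟩
      · exact H.adj_of_fixedRight N hp hq hf
      · exact (H.adj_of_fixedRight N hq hp hf).symm
      · exact H.adj_of_fixedUp N hp hq hf
      · exact (H.adj_of_fixedUp N hq hp hf).symm
    · exact (hout q p hq h.symm).symm
  · exact hout p q hp h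

theorem eq_configOf (H : IsNormalFPL a b c k G) (N : Normalized a b c k) :
    (matchingOf a b c k G).IsPerfectMatching ∧ configOf k (matchingOf a b c k G) = G :=
  H.isFPL.eq_configOf N (H.fixedGraph_le N) fun j => (H.isFPL.adj_outer_iff H.bundleC.1 j).1

end IsNormalFPL

end FullyPackedLoops

/-! ### Labels of the paths -/

namespace FullyPackedLoops
variable {a b c : ℕ} {k : ℤ}

/-- The label of the `i`-th path met on the way from `B` to `A`, counted from `A`. -/
def labelBA (a b : ℕ) (i : ℤ) : ℤ := if i ≤ a then i else i - (a + b + 1)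

/-- The label of the `i`-th path met on the way from `C` to `B`. -/
def labelCB (a b c : ℕ) (i : ℤ) : ℤ := if i ≤ c then a + c + 1 - i else i - (b + c + 1)

/-- The label of the path through the point with `x + y = k + 2 + 2 u`, `x - y = k + 2 w`, in the
configuration with height function `h`. -/
def labelEven (a b c : ℕ) (k : ℤ) (h : ℤ → ℤ → ℤ) (u w : ℤ) : ℤ :=
  if u < 0 then w + a + c
  else if 0 < w then labelCB a b c (u + 1)
  else if w < -(b + k) ∨ w ≤ -(c + a) then
    if c + a - k - 1 < u then labelBA a b (u - (c + a - k - 1)) else 1 - (u - (c + a - k - 1))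
  else if b + c ≤ u ∨ 2 * a + b + c - 1 - k < u then
    if w < a - k then labelBA a b (a + b + 1 - (a - k - w)) else labelCB a b c (b + c + a - k - w)
  else if a - k ≤ w then
    if u ≤ c + a - k - 1 then a + c - (u - w)
    else labelCB a b c (u + 1 + h (w + a) (w + u + k - a - c + 1))
  else if u ≤ c + a - k - 1 then w + a + h (u + w + k - c) (u - c)
  else labelBA a b (w + u + 1 + k - c + h (w + a) (u - c))

/-- The label of the path through the point with `x + y = k + 3 + 2 u`, `x - y = k + 1 + 2 w`, in
the configuration with height function `h`. -/
def labelOdd (a b c : ℕ) (k : ℤ) (h : ℤ → ℤ → ℤ) (u w : ℤ) : ℤ :=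
  if u < 0 then w + 1 + a + c
  else if 0 ≤ w then labelCB a b c (u + 1)
  else if w < -(b + k) ∨ w < -(c + a) then
    if c + a - k - 1 ≤ u then labelBA a b (u + 1 - (c + a - k - 1))
    else 1 - (u + 1 - (c + a - k - 1))
  else if b + c ≤ u ∨ 2 * a + b + c - 1 - k ≤ u then
    if w < a - k then labelBA a b (a + b + 1 - (a - k - w)) else labelCB a b c (b + c + a - k - w)
  else if a - k ≤ w then
    if u < c + a - k - 1 then a + c - (u - w)
    else labelCB a b c (u + 1 + h (w + a) (w + u + k - a - c + 1))
  else if u < c + a - k - 1 then w + 1 + a + h (u + w + k - c + 1 + 1) (u - c + 1)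
  else labelBA a b (w + u + 2 + k - c + h (w + a) (u - c + 1))

variable {h : ℤ → ℤ → ℤ}

/-- The values of `labelEven` in the different parts of the grid. -/
theorem labelEven_cases (a b c : ℕ) (k : ℤ) (h : ℤ → ℤ → ℤ) (u w : ℤ) :
    (u < 0 ∧ labelEven a b c k h u w = w + a + c) ∨
    (0 ≤ u ∧ 0 < w ∧ labelEven a b c k h u w = labelCB a b c (u + 1)) ∨
    (0 ≤ u ∧ w ≤ 0 ∧ (w < -(b + k) ∨ w ≤ -(c + a)) ∧ labelEven a b c k h u w =
      if c + a - k - 1 < u then labelBA a b (u - (c + a - k - 1)) else 1 - (u - (c + a - k - 1))) ∨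
    (0 ≤ u ∧ w ≤ 0 ∧ ¬ (w < -(b + k) ∨ w ≤ -(c + a)) ∧ (b + c ≤ u ∨ 2 * a + b + c - 1 - k < u) ∧ labelEven a b c k h u w =
      if w < a - k then labelBA a b (a + b + 1 - (a - k - w))
      else labelCB a b c (b + c + a - k - w)) ∨
    (0 ≤ u ∧ w ≤ 0 ∧ ¬ (w < -(b + k) ∨ w ≤ -(c + a)) ∧ ¬ (b + c ≤ u ∨ 2 * a + b + c - 1 - k < u) ∧ a - k ≤ w ∧ u ≤ c + a - k - 1 ∧
      labelEven a b c k h u w = a + c - (u - w)) ∨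
    (0 ≤ u ∧ w ≤ 0 ∧ ¬ (w < -(b + k) ∨ w ≤ -(c + a)) ∧ ¬ (b + c ≤ u ∨ 2 * a + b + c - 1 - k < u) ∧ a - k ≤ w ∧ c + a - k - 1 < u ∧
      labelEven a b c k h u w =
        labelCB a b c (u + 1 + h (w + a) (w + u + k - a - c + 1))) ∨
    (0 ≤ u ∧ w ≤ 0 ∧ ¬ (w < -(b + k) ∨ w ≤ -(c + a)) ∧ ¬ (b + c ≤ u ∨ 2 * a + b + c - 1 - k < u) ∧ w < a - k ∧ u ≤ c + a - k - 1 ∧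
      labelEven a b c k h u w = w + a + h (u + w + k - c) (u - c)) ∨
    (0 ≤ u ∧ w ≤ 0 ∧ ¬ (w < -(b + k) ∨ w ≤ -(c + a)) ∧ ¬ (b + c ≤ u ∨ 2 * a + b + c - 1 - k < u) ∧ w < a - k ∧ c + a - k - 1 < u ∧
      labelEven a b c k h u w = labelBA a b (w + u + 1 + k - c + h (w + a) (u - c))) := by
  unfold labelEven
  by_cases h1 : u < 0
  · exact Or.inl ⟨h1, if_pos h1⟩
  rw [if_neg h1]
  refine Or.inr ?_
  rw [not_lt] at h1
  by_cases h2 : 0 < w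
  · exact Or.inl ⟨h1, h2, if_pos h2⟩
  rw [if_neg h2]
  refine Or.inr ?_
  rw [not_lt] at h2
  by_cases h3 : w < -(b + k) ∨ w ≤ -(c + a)
  · exact Or.inl ⟨h1, h2, h3, if_pos h3⟩
  rw [if_neg h3]
  refine Or.inr ?_
  by_cases h4 : b + c ≤ u ∨ 2 * a + b + c - 1 - k < u
  · exact Or.inl ⟨h1, h2, h3, h4, if_pos h4⟩
  rw [if_neg h4]
  refine Or.inr ?_
  by_cases h5 : a - k ≤ w
  · rw [if_pos h5]
    by_cases h6 : u ≤ c + a - k - 1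
    · exact Or.inl ⟨h1, h2, h3, h4, h5, h6, if_pos h6⟩
    · exact Or.inr (Or.inl ⟨h1, h2, h3, h4, h5, by omega, if_neg h6⟩)
  · rw [if_neg h5]
    refine Or.inr (Or.inr ?_)
    by_cases h6 : u ≤ c + a - k - 1
    · exact Or.inl ⟨h1, h2, h3, h4, by omega, h6, if_pos h6⟩
    · exact Or.inr ⟨h1, h2, h3, h4, by omega, by omega, if_neg h6⟩

/-- The values of `labelOdd` in the different parts of the grid. -/
theorem labelOdd_cases (a b c : ℕ) (k : ℤ) (h : ℤ → ℤ → ℤ) (u w : ℤ) :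
    (u < 0 ∧ labelOdd a b c k h u w = w + 1 + a + c) ∨
    (0 ≤ u ∧ 0 ≤ w ∧ labelOdd a b c k h u w = labelCB a b c (u + 1)) ∨
    (0 ≤ u ∧ w < 0 ∧ (w < -(b + k) ∨ w < -(c + a)) ∧ labelOdd a b c k h u w =
      if c + a - k - 1 ≤ u then labelBA a b (u + 1 - (c + a - k - 1)) else 1 - (u + 1 - (c + a - k - 1))) ∨
    (0 ≤ u ∧ w < 0 ∧ ¬ (w < -(b + k) ∨ w < -(c + a)) ∧ (b + c ≤ u ∨ 2 * a + b + c - 1 - k ≤ u) ∧ labelOdd a b c k h u w =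
      if w < a - k then labelBA a b (a + b + 1 - (a - k - w))
      else labelCB a b c (b + c + a - k - w)) ∨
    (0 ≤ u ∧ w < 0 ∧ ¬ (w < -(b + k) ∨ w < -(c + a)) ∧ ¬ (b + c ≤ u ∨ 2 * a + b + c - 1 - k ≤ u) ∧ a - k ≤ w ∧ u < c + a - k - 1 ∧
      labelOdd a b c k h u w = a + c - (u - w)) ∨
    (0 ≤ u ∧ w < 0 ∧ ¬ (w < -(b + k) ∨ w < -(c + a)) ∧ ¬ (b + c ≤ u ∨ 2 * a + b + c - 1 - k ≤ u) ∧ a - k ≤ w ∧ c + a - k - 1 ≤ u ∧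
      labelOdd a b c k h u w =
        labelCB a b c (u + 1 + h (w + a) (w + u + k - a - c + 1))) ∨
    (0 ≤ u ∧ w < 0 ∧ ¬ (w < -(b + k) ∨ w < -(c + a)) ∧ ¬ (b + c ≤ u ∨ 2 * a + b + c - 1 - k ≤ u) ∧ w < a - k ∧ u < c + a - k - 1 ∧
      labelOdd a b c k h u w = w + 1 + a + h (u + w + k - c + 1 + 1) (u - c + 1)) ∨
    (0 ≤ u ∧ w < 0 ∧ ¬ (w < -(b + k) ∨ w < -(c + a)) ∧ ¬ (b + c ≤ u ∨ 2 * a + b + c - 1 - k ≤ u) ∧ w < a - k ∧ c + a - k - 1 ≤ u ∧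
      labelOdd a b c k h u w = labelBA a b (w + u + 2 + k - c + h (w + a) (u - c + 1))) := by
  unfold labelOdd
  by_cases h1 : u < 0
  · exact Or.inl ⟨h1, if_pos h1⟩
  rw [if_neg h1]
  refine Or.inr ?_
  rw [not_lt] at h1
  by_cases h2 : 0 ≤ w
  · exact Or.inl ⟨h1, h2, if_pos h2⟩
  rw [if_neg h2]
  refine Or.inr ?_
  rw [not_le] at h2
  by_cases h3 : w < -(b + k) ∨ w < -(c + a)
  · exact Or.inl ⟨h1, h2, h3, if_pos h3⟩
  rw [if_neg h3]
  refine Or.inr ?_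
  by_cases h4 : b + c ≤ u ∨ 2 * a + b + c - 1 - k ≤ u
  · exact Or.inl ⟨h1, h2, h3, h4, if_pos h4⟩
  rw [if_neg h4]
  refine Or.inr ?_
  by_cases h5 : a - k ≤ w
  · rw [if_pos h5]
    by_cases h6 : u < c + a - k - 1
    · exact Or.inl ⟨h1, h2, h3, h4, h5, h6, if_pos h6⟩
    · exact Or.inr (Or.inl ⟨h1, h2, h3, h4, h5, by omega, if_neg h6⟩)
  · rw [if_neg h5]
    refine Or.inr (Or.inr ?_)
    by_cases h6 : u < c + a - k - 1
    · exact Or.inl ⟨h1, h2, h3, h4, by omega, h6, if_pos h6⟩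
    · exact Or.inr ⟨h1, h2, h3, h4, by omega, by omega, if_neg h6⟩

end FullyPackedLoops

/-! ### Labels along fixed edges -/

namespace FullyPackedLoops
variable {a b c : ℕ} {k : ℤ} {h : ℤ → ℤ → ℤ}

/-- In this and the three following lemmas, all pairs of parts in which the two endpoints may lie
are examined. Inside a part the two formulas coincide; at the border between a part with heights and
one without, the bounds of `IsHeight` leave only a wall height. -/
theorem labelEven_eq_right (N : Normalized a b c k) (H : IsHeight a b c h) {u w : ℤ}
    (hX1 : u + w + k + 1 ≤ a + b + c)
    (hY1 : u - w + 1 ≤ a + b + c)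
    (hf : a - k ≤ w ∧ 0 ≤ u ∨ b + c ≤ u ∨ 2 * a + b + c - 1 - k < u) :
    labelEven a b c k h u w = labelOdd a b c k h u w := by
  obtain ⟨ha, hb, hc, h1, h2⟩ := N
  rcases labelEven_cases a b c k h u w with ⟨p1, e⟩ |
    ⟨p1, p2, e⟩ |
    ⟨p1, p2, p3, e⟩ |
    ⟨p1, p2, p3, p4, e⟩ |
    ⟨p1, p2, p3, p4, p5, p6, e⟩ |
    ⟨p1, p2, p3, p4, p5, p6, e⟩ |
    ⟨p1, p2, p3, p4, p5, p6, e⟩ |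
    ⟨p1, p2, p3, p4, p5, p6, e⟩ <;>
  first
  | (exfalso; omega)
  | rcases labelOdd_cases a b c k h u w with ⟨q1, f⟩ |
    ⟨q1, q2, f⟩ |
    ⟨q1, q2, q3, f⟩ |
    ⟨q1, q2, q3, q4, f⟩ |
    ⟨q1, q2, q3, q4, q5, q6, f⟩ |
    ⟨q1, q2, q3, q4, q5, q6, f⟩ |
    ⟨q1, q2, q3, q4, q5, q6, f⟩ |
    ⟨q1, q2, q3, q4, q5, q6, f⟩ <;>
    first
    | (exfalso; omega)
    | (have l1 := H.lower (w + a) (w + u + k - a - c + 1)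
       have u1 := H.upper (w + a) (w + u + k - a - c + 1)
       simp only [e, f, labelCB, labelBA]
       all_goals omega)

theorem labelOdd_eq_right (N : Normalized a b c k) (H : IsHeight a b c h) {u w : ℤ}
    (hX0 : 0 ≤ u + w + k + 2) (hX1 : u + w + k + 2 ≤ a + b + c)
    (hY1 : u - w + 1 ≤ a + b + c)
    (hf : u < c + a - k - 1 ∧ w < 0 ∨ w < -(b + k) ∨ w < -(c + a)) :
    labelOdd a b c k h u w = labelEven a b c k h (u + 1) (w + 1) := by
  obtain ⟨ha, hb, hc, h1, h2⟩ := N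
  rcases labelEven_cases a b c k h (u + 1) (w + 1) with ⟨p1, e⟩ |
    ⟨p1, p2, e⟩ |
    ⟨p1, p2, p3, e⟩ |
    ⟨p1, p2, p3, p4, e⟩ |
    ⟨p1, p2, p3, p4, p5, p6, e⟩ |
    ⟨p1, p2, p3, p4, p5, p6, e⟩ |
    ⟨p1, p2, p3, p4, p5, p6, e⟩ |
    ⟨p1, p2, p3, p4, p5, p6, e⟩ <;>
  first
  | (exfalso; omega)
  | rcases labelOdd_cases a b c k h u w with ⟨q1, f⟩ |
    ⟨q1, q2, f⟩ |
    ⟨q1, q2, q3, f⟩ |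
    ⟨q1, q2, q3, q4, f⟩ |
    ⟨q1, q2, q3, q4, q5, q6, f⟩ |
    ⟨q1, q2, q3, q4, q5, q6, f⟩ |
    ⟨q1, q2, q3, q4, q5, q6, f⟩ |
    ⟨q1, q2, q3, q4, q5, q6, f⟩ <;>
    first
    | (exfalso; omega)
    | (have e1 : h (u + 1 + (w + 1) + k - c) (u + 1 - c) = h (u + w + k - c + 1 + 1) (u - c + 1) := by
         ring_nf
       have l1 := H.lower (u + w + k - c + 1 + 1) (u - c + 1)
       have u1 := H.upper (u + w + k - c + 1 + 1) (u - c + 1)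
       simp only [e, f, labelBA]
       all_goals omega)

theorem labelOdd_eq_up (N : Normalized a b c k) (H : IsHeight a b c h) {u w : ℤ}
    (hX0 : 1 ≤ u + w + k + 2) (hX1 : u + w + k + 2 ≤ a + b + c)
    (hY1 : u - w + 1 ≤ a + b + c)
    (hf : c + a - k - 1 ≤ u ∧ w < a - k ∨ w < -(b + k) ∨ w < -(c + a) ∨ b + c ≤ u ∨
      2 * a + b + c - 1 - k ≤ u) :
    labelOdd a b c k h u w = labelEven a b c k h (u + 1) w := by
  obtain ⟨ha, hb, hc, h1, h2⟩ := N
  rcases labelEven_cases a b c k h (u + 1) w with ⟨p1, e⟩ |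
    ⟨p1, p2, e⟩ |
    ⟨p1, p2, p3, e⟩ |
    ⟨p1, p2, p3, p4, e⟩ |
    ⟨p1, p2, p3, p4, p5, p6, e⟩ |
    ⟨p1, p2, p3, p4, p5, p6, e⟩ |
    ⟨p1, p2, p3, p4, p5, p6, e⟩ |
    ⟨p1, p2, p3, p4, p5, p6, e⟩ <;>
  first
  | (exfalso; omega)
  | rcases labelOdd_cases a b c k h u w with ⟨q1, f⟩ |
    ⟨q1, q2, f⟩ |
    ⟨q1, q2, q3, f⟩ |
    ⟨q1, q2, q3, q4, f⟩ |
    ⟨q1, q2, q3, q4, q5, q6, f⟩ |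
    ⟨q1, q2, q3, q4, q5, q6, f⟩ |
    ⟨q1, q2, q3, q4, q5, q6, f⟩ |
    ⟨q1, q2, q3, q4, q5, q6, f⟩ <;>
    first
    | (exfalso; omega)
    | (have e1 : h (w + a) (u + 1 - c) = h (w + a) (u - c + 1) := by ring_nf
       have l1 := H.lower (w + a) (u - c + 1)
       have u1 := H.upper (w + a) (u - c + 1)
       simp only [e, f, labelCB, labelBA]
       all_goals omega)

theorem labelEven_eq_up (N : Normalized a b c k) {u w : ℤ}
    (hX0 : 1 ≤ u + w + k + 1) (hX1 : u + w + k + 1 ≤ a + b + c)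
    (hY1 : u - w + 1 ≤ a + b + c)
    (hf : u < 0 ∨ 0 < w) :
    labelEven a b c k h u w = labelOdd a b c k h u (w - 1) := by
  obtain ⟨ha, hb, hc, h1, h2⟩ := N
  rcases labelEven_cases a b c k h u w with ⟨p1, e⟩ |
    ⟨p1, p2, e⟩ |
    ⟨p1, p2, p3, e⟩ |
    ⟨p1, p2, p3, p4, e⟩ |
    ⟨p1, p2, p3, p4, p5, p6, e⟩ |
    ⟨p1, p2, p3, p4, p5, p6, e⟩ |
    ⟨p1, p2, p3, p4, p5, p6, e⟩ |
    ⟨p1, p2, p3, p4, p5, p6, e⟩ <;>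
  first
  | (exfalso; omega)
  | rcases labelOdd_cases a b c k h u (w - 1) with ⟨q1, f⟩ |
    ⟨q1, q2, f⟩ |
    ⟨q1, q2, q3, f⟩ |
    ⟨q1, q2, q3, q4, f⟩ |
    ⟨q1, q2, q3, q4, q5, q6, f⟩ |
    ⟨q1, q2, q3, q4, q5, q6, f⟩ |
    ⟨q1, q2, q3, q4, q5, q6, f⟩ |
    ⟨q1, q2, q3, q4, q5, q6, f⟩ <;>
    first
    | (exfalso; omega)
    | (simp only [e, f, labelCB]
       all_goals omega)

end FullyPackedLoops

/-! ### Labels along matched edges -/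

namespace FullyPackedLoops
variable {a b c : ℕ} {k : ℤ} {h : ℤ → ℤ → ℤ}

/-- The conditions for the point with `x + y = k + 2 + 2 u`, `x - y = k + 2 w` to be a site. -/
def IsEvenSite (a b c : ℕ) (k u w : ℤ) : Prop :=
  0 ≤ u ∧ w ≤ 0 ∧ -(b + k) ≤ w ∧ -(c + a) < w ∧ u < b + c ∧ u ≤ 2 * a + b + c - 1 - k ∧
    (w < a - k ∨ c + a - k - 1 < u)

/-- The conditions for the point with `x + y = k + 3 + 2 u`, `x - y = k + 1 + 2 w` to be a site. -/
def IsOddSite (a b c : ℕ) (k u w : ℤ) : Prop :=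
  0 ≤ u ∧ w < 0 ∧ -(b + k) ≤ w ∧ -(c + a) ≤ w ∧ u < b + c ∧ u < 2 * a + b + c - 1 - k ∧
    (w < a - k ∨ c + a - k - 1 ≤ u)

theorem labelEven_left {u w α β : ℤ} (hs : IsEvenSite a b c k u w) (h1 : w < a - k)
    (h2 : u ≤ c + a - k - 1) (hα : u + w + k - c = α) (hβ : u - c = β) :
    labelEven a b c k h u w = w + a + h α β := by
  unfold IsEvenSite at hs
  rw [labelEven, if_neg (by omega), if_neg (by omega), if_neg (by omega), if_neg (by omega),
    if_neg (by omega), if_pos h2, hα, hβ]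

theorem labelEven_upper {u w α β : ℤ} (hs : IsEvenSite a b c k u w) (h1 : w < a - k)
    (h2 : c + a - k - 1 < u) (hα : w + a = α) (hβ : u - c = β) :
    labelEven a b c k h u w = labelBA a b (w + u + 1 + k - c + h α β) := by
  unfold IsEvenSite at hs
  rw [labelEven, if_neg (by omega), if_neg (by omega), if_neg (by omega), if_neg (by omega),
    if_neg (by omega), if_neg (by omega), hα, hβ]

theorem labelEven_right {u w α β : ℤ} (hs : IsEvenSite a b c k u w) (h1 : a - k ≤ w)
    (hα : w + a = α) (hβ : w + u + k - a - c + 1 = β) :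
    labelEven a b c k h u w = labelCB a b c (u + 1 + h α β) := by
  unfold IsEvenSite at hs
  rw [labelEven, if_neg (by omega), if_neg (by omega), if_neg (by omega), if_neg (by omega),
    if_pos h1, if_neg (by omega), hα, hβ]

theorem labelOdd_left {u w α β : ℤ} (hs : IsOddSite a b c k u w) (h1 : w < a - k)
    (h2 : u < c + a - k - 1) (hα : u + w + k - c + 1 + 1 = α) (hβ : u - c + 1 = β) :
    labelOdd a b c k h u w = w + 1 + a + h α β := by
  unfold IsOddSite at hs
  rw [labelOdd, if_neg (by omega), if_neg (by omega), if_neg (by omega), if_neg (by omega),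
    if_neg (by omega), if_pos h2, hα, hβ]

theorem labelOdd_upper {u w α β : ℤ} (hs : IsOddSite a b c k u w) (h1 : w < a - k)
    (h2 : c + a - k - 1 ≤ u) (hα : w + a = α) (hβ : u - c + 1 = β) :
    labelOdd a b c k h u w = labelBA a b (w + u + 2 + k - c + h α β) := by
  unfold IsOddSite at hs
  rw [labelOdd, if_neg (by omega), if_neg (by omega), if_neg (by omega), if_neg (by omega),
    if_neg (by omega), if_neg (by omega), hα, hβ]

theorem labelOdd_right {u w α β : ℤ} (hs : IsOddSite a b c k u w) (h1 : a - k ≤ w)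
    (hα : w + a = α) (hβ : w + u + k - a - c + 1 = β) :
    labelOdd a b c k h u w = labelCB a b c (u + 1 + h α β) := by
  unfold IsOddSite at hs
  rw [labelOdd, if_neg (by omega), if_neg (by omega), if_neg (by omega), if_neg (by omega),
    if_pos h1, if_neg (by omega), hα, hβ]

/-- On the paths around `B` both numberings count from `B`, with a minus sign; this makes the labels
agree across the cut between the upper and the right part. -/
theorem labelBA_eq_labelCB {i j : ℤ} (h : i - a = j - c) (hi : (a : ℤ) < i) :
    labelBA a b i = labelCB a b c j := by
  unfold labelBA labelCB
  rw [if_neg (by omega), if_neg (by omega)]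
  omega

/-- A lozenge is a unit drop of the height across one side. Since the drop along a diagonal is at
most one, it fixes the heights at the neighbouring points, which are the ones that enter the labels.
On the cut `u = c + a - k - 1` one also needs that the label is at most `a`, so that `labelBA` is
the identity there. -/
theorem labelOdd_eq_of_two (H : IsHeight a b c h) {u w : ℤ} (ho : IsOddSite a b c k u w)
    (he : IsEvenSite a b c k u w) {A B A' : ℤ} (hA : A = u + w + k + 1 - c) (hB : B = u - c)
    (hA' : A' = a + w) (h1 : w < a - k) (hL : u ≤ c + a - k - 1 → h A B = h A (B + 1) + 1)
    (hU : c + a - k - 1 ≤ u → h A' B = h A' (B + 1) + 1) :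
    labelOdd a b c k h u w = labelEven a b c k h u w := by
  rcases lt_trichotomy u (c + a - k - 1) with h2 | h2 | h2
  · rw [labelOdd_left ho h1 h2 (α := A + 1) (β := B + 1) (by omega) (by omega),
      labelEven_left he h1 h2.le (α := A - 1) (β := B) (by omega) (by omega)]
    have f1 := H.anti_left (A - 1) B
    have f2 := H.diag (A - 1) B
    have f3 := H.anti_left A (B + 1)
    have f4 := H.diag A B
    rw [sub_add_cancel] at f1 f2
    have := hL h2.le
    omega
  · obtain rfl : A = A' := by omega
    rw [labelOdd_upper ho h1 h2.ge (α := A) (β := B + 1) (by omega) (by omega),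
      labelEven_left he h1 h2.le (α := A - 1) (β := B) (by omega) (by omega)]
    have f1 := H.anti_left (A - 1) B
    have f2 := H.diag (A - 1) B
    have f3 := H.upper A B
    have f4 := H.lower A (B + 1)
    rw [sub_add_cancel] at f1 f2
    have := hL h2.le
    have hle : w + u + 2 + k - c + h A (B + 1) ≤ a := by omega
    rw [labelBA, if_pos hle]
    omega
  · rw [labelOdd_upper ho h1 h2.le (α := A') (β := B + 1) (by omega) (by omega),
      labelEven_upper he h1 h2 (α := A') (β := B) (by omega) (by omega)]
    have := hU h2.le
    congr 1
    omega

/-- Equal heights at the ends of a diagonal force equality at the two intermediate corners as well.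
The relations overlap on the cuts, where the two labels are given by different formulas. -/
theorem labelOdd_eq_of_three (H : IsHeight a b c h) {u w : ℤ} (ho : IsOddSite a b c k u w)
    (he : IsEvenSite a b c k u (w + 1)) {A B A' B' : ℤ} (hA : A = u + w + k + 1 - c)
    (hB : B = u - c) (hA' : A' = a + w) (hB' : B' = u + w + k + 1 - a - c)
    (hL : w + 1 < a - k → u ≤ c + a - k - 1 → h A B = h (A + 1) (B + 1))
    (hU : w + 1 ≤ a - k → c + a - k - 1 ≤ u → h A' B = h (A' + 1) (B + 1))
    (hR : a - k - 1 ≤ w → c + a - k - 1 ≤ u → h A' B' = h (A' + 1) (B' + 1)) :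
    labelOdd a b c k h u w = labelEven a b c k h u (w + 1) := by
  have he' := he
  have ho' := ho
  unfold IsEvenSite at he'
  unfold IsOddSite at ho'
  rcases lt_trichotomy (w + 1) (a - k) with h1 | h1 | h1
  · rcases lt_trichotomy u (c + a - k - 1) with h2 | h2 | h2
    · rw [labelOdd_left ho (by omega) h2 (α := A + 1) (β := B + 1) (by omega) (by omega),
        labelEven_left he h1 h2.le (α := A) (β := B) (by omega) (by omega), hL h1 h2.le]
    · obtain rfl : A = A' := by omega
      rw [labelOdd_upper ho (by omega) h2.ge (α := A) (β := B + 1) (by omega) (by omega),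
        labelEven_left he h1 h2.le (α := A) (β := B) (by omega) (by omega)]
      have := hL h1 h2.le
      have f1 := H.anti_right A B
      have f2 := H.anti_left A (B + 1)
      have f3 := H.upper (A + 1) (B + 1)
      have f4 := H.lower A B
      have hle : w + u + 2 + k - c + h A (B + 1) ≤ a := by omega
      rw [labelBA, if_pos hle]
      omega
    · rw [labelOdd_upper ho (by omega) h2.le (α := A') (β := B + 1) (by omega) (by omega),
        labelEven_upper he h1 h2 (α := A' + 1) (β := B) (by omega) (by omega)]
      have := hU h1.le h2.le
      have f1 := H.anti_right A' B
      have f2 := H.anti_left A' (B + 1)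
      have f3 := H.anti_left A' B
      have f4 := H.anti_right (A' + 1) B
      congr 1
      omega
  · obtain rfl : B = B' := by omega
    rw [labelOdd_upper ho (by omega) (by omega) (α := A') (β := B + 1) (by omega) (by omega),
      labelEven_right he h1.ge (α := A' + 1) (β := B + 1) (by omega) (by omega)]
    have := hU h1.le (by omega)
    have f1 := H.anti_right A' B
    have f2 := H.anti_left A' (B + 1)
    have f4 := H.lower A' B
    exact labelBA_eq_labelCB (by omega) (by omega)
  · rw [labelOdd_right ho (by omega) (α := A') (β := B') (by omega) (by omega),
      labelEven_right he h1.le (α := A' + 1) (β := B' + 1) (by omega) (by omega),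
      hR (by omega) (by omega)]

/-- In the upper and right parts the unit drop of the height compensates the change of the explicit
term. -/
theorem labelOdd_eq_of_one (H : IsHeight a b c h) {u w : ℤ} (ho : IsOddSite a b c k u w)
    (he : IsEvenSite a b c k (u + 1) (w + 1)) {B A' B' : ℤ}
    (hB : B = u - c) (hA' : A' = a + w) (hB' : B' = u + w + k + 1 - a - c)
    (h2 : c + a - k - 1 ≤ u)
    (hU : w + 1 ≤ a - k → h A' (B + 1) = h (A' + 1) (B + 1) + 1)
    (hR : a - k - 1 ≤ w → h A' (B' + 1) = h (A' + 1) (B' + 1) + 1) :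
    labelOdd a b c k h u w = labelEven a b c k h (u + 1) (w + 1) := by
  have f1 := H.diag A' (B' + 1)
  have f2 := H.anti_right (A' + 1) (B' + 1)
  have f3 := H.diag A' B'
  have f4 := H.anti_right A' B'
  have f5 := H.lower (A' + 1) (B' + 1)
  rcases lt_trichotomy (w + 1) (a - k) with h1 | h1 | h1
  · rw [labelOdd_upper ho (by omega) h2 (α := A') (β := B + 1) (by omega) (by omega),
      labelEven_upper he h1 (by omega) (α := A' + 1) (β := B + 1) (by omega) (by omega)]
    have := hU h1.le
    congr 1
    omega
  · obtain rfl : B = B' := by omega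
    rw [labelOdd_upper ho (by omega) h2 (α := A') (β := B + 1) (by omega) (by omega),
      labelEven_right he h1.ge (α := A' + 1) (β := B + 1 + 1) (by omega) (by omega)]
    have := hU h1.le
    exact labelBA_eq_labelCB (by omega) (by omega)
  · rw [labelOdd_right ho (by omega) (α := A') (β := B') (by omega) (by omega),
      labelEven_right he h1.le (α := A' + 1) (β := B' + 1 + 1) (by omega) (by omega)]
    have := hR (by omega)
    congr 1
    omega

/-- Vertical edges from an odd to an even point occur only in the left and right parts, since in the
upper part they are fixed. -/
theorem labelOdd_eq_of_down {u w : ℤ} (ho : IsOddSite a b c k u w)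
    (he : IsEvenSite a b c k (u + 1) w) {A B A' B' : ℤ} (hA : A = u + w + k + 1 - c)
    (hB : B = u - c) (hA' : A' = a + w) (hB' : B' = u + w + k + 1 - a - c)
    (h1 : u < c + a - k - 1 ∨ a - k ≤ w)
    (hL : w < a - k → u < c + a - k - 1 → h A (B + 1) = h (A + 1) (B + 1) + 1)
    (hR : a - k ≤ w → h A' B' = h A' (B' + 1) + 1) :
    labelOdd a b c k h u w = labelEven a b c k h (u + 1) w := by
  have ho' := ho
  unfold IsOddSite at ho'
  by_cases h2 : w < a - k
  · rw [labelOdd_left ho h2 (by omega) (α := A + 1) (β := B + 1) (by omega) (by omega),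
      labelEven_left he h2 (by omega) (α := A) (β := B + 1) (by omega) (by omega)]
    have := hL h2 (by omega)
    omega
  · rw [labelOdd_right ho (by omega) (α := A') (β := B') (by omega) (by omega),
      labelEven_right he (by omega) (α := A') (β := B' + 1) (by omega) (by omega)]
    have := hR (by omega)
    congr 1
    omega

end FullyPackedLoops

/-! ### From matched pairs to relations between heights -/

namespace FullyPackedLoops
variable {a b c : ℕ} {k : ℤ} {h : ℤ → ℤ → ℤ}

theorem lozengeRel_or_one {p q r α β : ℤ} (hα : α = a - 1 - q) (hβ : β = p - c)
    {P Q : ℤ × ℤ × ℤ} (hP : P = (p, q, r)) (hQ : Q = (p + 1, q, r))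
    (H : LozengeRel a c h P Q ∨ LozengeRel a c h Q P) :
    h α (β + 1) = h (α + 1) (β + 1) + 1 := by
  subst hP hQ
  rcases H with H | H
  · rw [lozengeRel_lower_iff hα hβ] at H
    simpa using H
  · have := H.sum
    dsimp only at this
    omega

theorem lozengeRel_or_two {p q r α β : ℤ} (hα : α = a - 1 - q) (hβ : β = p - c)
    {P Q : ℤ × ℤ × ℤ} (hP : P = (p, q, r)) (hQ : Q = (p, q + 1, r))
    (H : LozengeRel a c h P Q ∨ LozengeRel a c h Q P) : h α β = h α (β + 1) + 1 := by
  subst hP hQ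
  rcases H with H | H
  · rw [lozengeRel_lower_iff hα hβ] at H
    simpa using H
  · have := H.sum
    dsimp only at this
    omega

theorem lozengeRel_or_three {p q r α β : ℤ} (hα : α = a - 1 - q) (hβ : β = p - c)
    {P Q : ℤ × ℤ × ℤ} (hP : P = (p, q, r)) (hQ : Q = (p, q, r + 1))
    (H : LozengeRel a c h P Q ∨ LozengeRel a c h Q P) : h α β = h (α + 1) (β + 1) := by
  subst hP hQ
  rcases H with H | H
  · rw [lozengeRel_lower_iff hα hβ] at H
    simpa using H
  · have := H.sum
    dsimp only at this
    omega

/-- The point with `x + y = k + 2 + 2 u`, `x - y = k + 2 w`. -/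
def evenPoint (k u w : ℤ) : ℤ × ℤ := (u + w + k + 1, u - w + 1)

/-- The point with `x + y = k + 3 + 2 u`, `x - y = k + 1 + 2 w`. -/
def oddPoint (k u w : ℤ) : ℤ × ℤ := (u + w + k + 2, u - w + 1)

theorem isHexSite_evenPoint (N : Normalized a b c k) {u w : ℤ}
    (hs : IsHexSite a b c k (evenPoint k u w)) : IsEvenSite a b c k u w := by
  unfold evenPoint at hs
  rw [isHexSite_iff N] at hs
  unfold InStrip at hs
  unfold IsEvenSite
  refine ⟨?_, ?_, ?_, ?_, ?_, ?_, ?_⟩ <;> omega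

theorem isHexSite_oddPoint (N : Normalized a b c k) {u w : ℤ}
    (hs : IsHexSite a b c k (oddPoint k u w)) : IsOddSite a b c k u w := by
  unfold oddPoint at hs
  rw [isHexSite_iff N] at hs
  unfold InStrip at hs
  unfold IsOddSite
  refine ⟨?_, ?_, ?_, ?_, ?_, ?_, ?_⟩ <;> omega

theorem toHex_evenPoint_left {u w : ℤ} (h1 : w < a - k) (h2 : u ≤ c + a - k - 1) :
    toHex a b c k (evenPoint k u w) = (u, a + c - (u + w + k + 1), w + b + k) := by
  unfold evenPoint
  rw [toHex_left (by omega) (by omega)]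
  refine Prod.ext ?_ (Prod.ext ?_ ?_) <;> dsimp only <;> omega

theorem toHex_evenPoint_upper {u w : ℤ} (h1 : w ≤ a - k) (h2 : c + a - k - 1 ≤ u)
    (h3 : w < a - k ∨ c + a - k - 1 < u) :
    toHex a b c k (evenPoint k u w) = (u, -w, a + b + c - (u - w + 1)) := by
  unfold evenPoint
  rw [toHex_upper (by omega) (by omega) (by omega)]
  refine Prod.ext ?_ (Prod.ext ?_ ?_) <;> dsimp only <;> omega

theorem toHex_evenPoint_right {u w : ℤ} (h1 : a - k ≤ w) (h2 : c + a - k - 1 < u) :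
    toHex a b c k (evenPoint k u w) = (u + w + k - a, -w, 2 * a + b + c - 1 - k - u) := by
  unfold evenPoint
  rw [toHex_right (by omega) (by omega)]
  refine Prod.ext ?_ (Prod.ext ?_ ?_) <;> dsimp only <;> omega

theorem toHex_oddPoint_left {u w : ℤ} (h1 : w < a - k) (h2 : u ≤ c + a - k - 1) :
    toHex a b c k (oddPoint k u w) = (u, a + c - (u + w + k + 2), w + b + k) := by
  unfold oddPoint
  rw [toHex_left (by omega) (by omega)]
  refine Prod.ext ?_ (Prod.ext ?_ ?_) <;> dsimp only <;> omega

theorem toHex_oddPoint_upper {u w : ℤ} (h1 : w < a - k) (h2 : c + a - k - 1 ≤ u) :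
    toHex a b c k (oddPoint k u w) = (u, -(w + 1), a + b + c - (u - w + 1)) := by
  unfold oddPoint
  rw [toHex_upper (by omega) (by omega) (by omega)]
  refine Prod.ext ?_ (Prod.ext ?_ ?_) <;> dsimp only <;> omega

theorem toHex_oddPoint_right {u w : ℤ} (h1 : a - k - 1 ≤ w) (h2 : c + a - k - 1 ≤ u) :
    toHex a b c k (oddPoint k u w) =
      (u + w + k + 1 - a, -(w + 1), 2 * a + b + c - 1 - k - (u + 1)) := by
  unfold oddPoint
  rw [toHex_right (by omega) (by omega)]
  refine Prod.ext ?_ (Prod.ext ?_ ?_) <;> dsimp only <;> omega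

/-- Equality of triples, from equalities of coordinates. -/
theorem triple_ext {p q r p' q' r' : ℤ} (h1 : p = p') (h2 : q = q') (h3 : r = r') :
    (p, q, r) = (p', q', r') := by rw [h1, h2, h3]

/-- The two points are matched in the tiling with height function `h`. -/
def HexMatched (a b c : ℕ) (k : ℤ) (h : ℤ → ℤ → ℤ) (p q : ℤ × ℤ) : Prop :=
  IsHexSite a b c k p ∧ IsHexSite a b c k q ∧
    (LozengeRel a c h (toHex a b c k p) (toHex a b c k q) ∨
      LozengeRel a c h (toHex a b c k q) (toHex a b c k p))

/-- On the cut both formulas for `toHex` apply, so both relations required by `labelOdd_eq_of_two`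
are available; the same happens in the next lemmas. -/
theorem labelOdd_eq_of_matched_left (N : Normalized a b c k) (H : IsHeight a b c h) {u w : ℤ}
    (hm : HexMatched a b c k h (oddPoint k u w) (evenPoint k u w)) (h1 : w < a - k) :
    labelOdd a b c k h u w = labelEven a b c k h u w := by
  obtain ⟨ho, he, hm⟩ := hm
  refine labelOdd_eq_of_two H (isHexSite_oddPoint N ho) (isHexSite_evenPoint N he) rfl rfl rfl h1
    (fun h2 => ?_) (fun h2 => ?_)
  · refine lozengeRel_or_two (a := a) (c := c) ?_ ?_ (toHex_oddPoint_left h1 h2)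
      ((toHex_evenPoint_left h1 h2).trans (triple_ext ?_ ?_ ?_)) hm <;> omega
  · refine lozengeRel_or_two (a := a) (c := c) ?_ ?_ (toHex_oddPoint_upper h1 h2)
      ((toHex_evenPoint_upper h1.le h2 (Or.inl h1)).trans (triple_ext ?_ ?_ ?_)) hm <;> omega

theorem labelOdd_eq_of_matched_down (N : Normalized a b c k) (H : IsHeight a b c h) {u w : ℤ}
    (hm : HexMatched a b c k h (oddPoint k u w) (evenPoint k u (w + 1))) :
    labelOdd a b c k h u w = labelEven a b c k h u (w + 1) := by
  obtain ⟨ho, he, hm⟩ := hm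
  have he' := isHexSite_evenPoint N he
  have ho' := isHexSite_oddPoint N ho
  refine labelOdd_eq_of_three H ho' he' rfl rfl rfl rfl
    (fun h1 h2 => ?_) (fun h1 h2 => ?_) (fun h1 h2 => ?_)
  · refine lozengeRel_or_three (a := a) (c := c) ?_ ?_ (toHex_oddPoint_left (by omega) h2)
      ((toHex_evenPoint_left h1 h2).trans (triple_ext ?_ ?_ ?_)) hm <;> omega
  · unfold IsEvenSite at he'
    refine lozengeRel_or_three (a := a) (c := c) ?_ ?_ (toHex_oddPoint_upper (by omega) h2)
      ((toHex_evenPoint_upper h1 h2 (by omega)).trans (triple_ext ?_ ?_ ?_)) hm <;> omega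
  · unfold IsEvenSite at he'
    by_cases h3 : a - k ≤ w + 1 ∧ c + a - k - 1 < u
    · refine lozengeRel_or_three (a := a) (c := c) ?_ ?_ (toHex_oddPoint_right h1 h2)
        ((toHex_evenPoint_right h3.1 h3.2).trans (triple_ext ?_ ?_ ?_)) hm <;> omega
    · exfalso; omega

theorem labelOdd_eq_of_matched_right (N : Normalized a b c k) (H : IsHeight a b c h) {u w : ℤ}
    (hm : HexMatched a b c k h (oddPoint k u w) (evenPoint k (u + 1) (w + 1)))
    (h1 : c + a - k - 1 ≤ u) :
    labelOdd a b c k h u w = labelEven a b c k h (u + 1) (w + 1) := by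
  obtain ⟨ho, he, hm⟩ := hm
  refine labelOdd_eq_of_one H (isHexSite_oddPoint N ho) (isHexSite_evenPoint N he) rfl rfl rfl h1
    (fun h2 => ?_) (fun h2 => ?_)
  · refine lozengeRel_or_one (a := a) (c := c) ?_ ?_ (toHex_oddPoint_upper (by omega) h1)
      ((toHex_evenPoint_upper h2 (by omega) (by omega)).trans (triple_ext ?_ ?_ ?_)) hm <;> omega
  · refine lozengeRel_or_one (a := a) (c := c) ?_ ?_ (toHex_oddPoint_right h2 h1)
      ((toHex_evenPoint_right (by omega) (by omega)).trans (triple_ext ?_ ?_ ?_)) hm <;> omega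

theorem labelOdd_eq_of_matched_up (N : Normalized a b c k) {u w : ℤ}
    (hm : HexMatched a b c k h (oddPoint k u w) (evenPoint k (u + 1) w))
    (h1 : u < c + a - k - 1 ∨ a - k ≤ w) :
    labelOdd a b c k h u w = labelEven a b c k h (u + 1) w := by
  obtain ⟨ho, he, hm⟩ := hm
  have ho' := isHexSite_oddPoint N ho
  refine labelOdd_eq_of_down ho' (isHexSite_evenPoint N he) rfl rfl rfl rfl h1
    (fun h2 h3 => ?_) (fun h2 => ?_)
  · refine lozengeRel_or_one (a := a) (c := c) ?_ ?_ (toHex_oddPoint_left h2 (by omega))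
      ((toHex_evenPoint_left h2 (by omega)).trans (triple_ext ?_ ?_ ?_)) hm <;> omega
  · unfold IsOddSite at ho'
    refine lozengeRel_or_two (a := a) (c := c) ?_ ?_ (toHex_oddPoint_right (by omega) (by omega))
      ((toHex_evenPoint_right h2 (by omega)).trans (triple_ext ?_ ?_ ?_)) hm <;> omega

end FullyPackedLoops

/-! ### The label is constant along paths -/

namespace FullyPackedLoops
variable {a b c : ℕ} {k : ℤ} {h : ℤ → ℤ → ℤ}

/-- The label of the path through a given point, in the configuration with height function `h`. -/
def pathLabel (a b c : ℕ) (k : ℤ) (h : ℤ → ℤ → ℤ) (p : ℤ × ℤ) : ℤ :=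
  if (p.1 + p.2 - k) % 2 = 0 then
    labelEven a b c k h ((p.1 + p.2 - k - 2) / 2) ((p.1 - p.2 - k) / 2)
  else labelOdd a b c k h ((p.1 + p.2 - k - 3) / 2) ((p.1 - p.2 - k - 1) / 2)

theorem pathLabel_evenPoint (u w : ℤ) :
    pathLabel a b c k h (evenPoint k u w) = labelEven a b c k h u w := by
  unfold pathLabel evenPoint
  dsimp only
  rw [if_pos (by omega)]
  congr 1 <;> omega

theorem pathLabel_oddPoint (u w : ℤ) :
    pathLabel a b c k h (oddPoint k u w) = labelOdd a b c k h u w := by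
  unfold pathLabel oddPoint
  dsimp only
  rw [if_neg (by omega)]
  congr 1 <;> omega

theorem exists_evenPoint_or_oddPoint (k x y : ℤ) :
    (∃ u w, (x, y) = evenPoint k u w) ∨ ∃ u w, (x, y) = oddPoint k u w := by
  rcases Int.emod_two_eq_zero_or_one (x + y - k) with h | h
  · refine Or.inl ⟨(x + y - k - 2) / 2, (x - y - k) / 2, Prod.ext ?_ ?_⟩ <;>
      unfold evenPoint <;> dsimp only <;> omega
  · refine Or.inr ⟨(x + y - k - 3) / 2, (x - y - k - 1) / 2, Prod.ext ?_ ?_⟩ <;>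
      unfold oddPoint <;> dsimp only <;> omega

theorem HexMatched.symm {p q : ℤ × ℤ} (H : HexMatched a b c k h p q) : HexMatched a b c k h q p :=
  ⟨H.2.1, H.1, H.2.2.symm⟩

theorem pathLabel_eq_right (N : Normalized a b c k) (H : IsHeight a b c h) {x y : ℤ}
    (hx : 0 ≤ x) (hx' : x ≤ a + b + c) (hy : 1 ≤ y) (hy' : y ≤ a + b + c)
    (he : FixedRight a b c k x y ∨
      ¬ FixedRight a b c k x y ∧ HexMatched a b c k h (x, y) (x + 1, y)) :
    pathLabel a b c k h (x, y) = pathLabel a b c k h (x + 1, y) := by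
  rcases exists_evenPoint_or_oddPoint k x y with ⟨u, w, e⟩ | ⟨u, w, e⟩
  · have e' : (x + 1, y) = oddPoint k u w := by
      unfold evenPoint at e
      unfold oddPoint
      simp only [Prod.mk.injEq] at e ⊢
      omega
    rw [e, e'] at he
    rw [e, e', pathLabel_evenPoint, pathLabel_oddPoint]
    obtain ⟨rfl, rfl⟩ := Prod.mk.inj e
    rw [fixedRight_even (by omega)] at he
    rcases he with he | ⟨he, hm⟩
    · exact labelEven_eq_right N H (by omega) (by omega) (by omega)
    · have hs := isHexSite_evenPoint N hm.1
      unfold IsEvenSite at hs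
      exact (labelOdd_eq_of_matched_left N H hm.symm (by omega)).symm
  · have e' : (x + 1, y) = evenPoint k (u + 1) (w + 1) := by
      unfold oddPoint at e
      unfold evenPoint
      simp only [Prod.mk.injEq] at e ⊢
      omega
    rw [e, e'] at he
    rw [e, e', pathLabel_evenPoint, pathLabel_oddPoint]
    obtain ⟨rfl, rfl⟩ := Prod.mk.inj e
    rw [fixedRight_odd (by omega)] at he
    rcases he with he | ⟨he, hm⟩
    · exact labelOdd_eq_right N H (by omega) (by omega) (by omega) (by omega)
    · have hs := isHexSite_oddPoint N hm.1
      unfold IsOddSite at hs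
      exact labelOdd_eq_of_matched_right N H hm (by omega)

theorem pathLabel_eq_up (N : Normalized a b c k) (H : IsHeight a b c h) {x y : ℤ}
    (hx : 1 ≤ x) (hx' : x ≤ a + b + c) (hy : 0 ≤ y) (hy' : y ≤ a + b + c)
    (he : FixedUp a b c k x y ∨
      ¬ FixedUp a b c k x y ∧ HexMatched a b c k h (x, y) (x, y + 1)) :
    pathLabel a b c k h (x, y) = pathLabel a b c k h (x, y + 1) := by
  rcases exists_evenPoint_or_oddPoint k x y with ⟨u, w, e⟩ | ⟨u, w, e⟩
  · have e' : (x, y + 1) = oddPoint k u (w - 1) := by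
      unfold evenPoint at e
      unfold oddPoint
      simp only [Prod.mk.injEq] at e ⊢
      omega
    rw [e, e'] at he
    rw [e, e', pathLabel_evenPoint, pathLabel_oddPoint]
    obtain ⟨rfl, rfl⟩ := Prod.mk.inj e
    rw [fixedUp_even (by omega)] at he
    rcases he with he | ⟨he, hm⟩
    · exact labelEven_eq_up N (by omega) (by omega) (by omega) (by omega)
    · have := labelOdd_eq_of_matched_down (w := w - 1) N H
        (by rw [sub_add_cancel]; exact hm.symm)
      rw [this, sub_add_cancel]
  · have e' : (x, y + 1) = evenPoint k (u + 1) w := by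
      unfold oddPoint at e
      unfold evenPoint
      simp only [Prod.mk.injEq] at e ⊢
      omega
    rw [e, e'] at he
    rw [e, e', pathLabel_evenPoint, pathLabel_oddPoint]
    obtain ⟨rfl, rfl⟩ := Prod.mk.inj e
    rw [fixedUp_odd (by omega)] at he
    rcases he with he | ⟨he, hm⟩
    · exact labelOdd_eq_up N H (by omega) (by omega) (by omega) (by omega)
    · have hs := isHexSite_oddPoint N hm.1
      unfold IsOddSite at hs
      exact labelOdd_eq_of_matched_up N hm (by omega)

/-- An edge of the configuration is fixed or matched, and never both. Edges with one endpoint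
outside the grid are included, so the label can be compared at the external ends. -/
theorem pathLabel_eq_of_adj (N : Normalized a b c k) (H : IsHeight a b c h) {p q : ℤ × ℤ}
    (hpq : (configOf k (tilingOf a b c h)).Adj p q) :
    pathLabel a b c k h p = pathLabel a b c k h q := by
  wlog hdir : q = (p.1 + 1, p.2) ∨ q = (p.1, p.2 + 1) generalizing p q
  · exact (this hpq.symm (by
      rcases (latticeAdj_iff _ _).1 (configOf_latticeAdj N hpq) with h | h | h | h <;> tauto)).symm
  obtain ⟨x, y⟩ := p
  have hgrid : InGrid (a + b + c) (x, y) ∨ InGrid (a + b + c) q :=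
    hpq.elim (fun h => h.1) fun h => Or.inl (h.1.inGrid N)
  have hm : (matchedGraph k (tilingOf a b c h)).Adj (x, y) q → HexMatched a b c k h (x, y) q := by
    rintro ⟨h1, h2, hu, hv, h3⟩
    exact ⟨h1, h2, h3⟩
  unfold InGrid at hgrid
  push_cast at hgrid
  rcases hdir with rfl | rfl <;> dsimp only at hgrid hpq hm ⊢
  · refine pathLabel_eq_right N H (by omega) (by omega) (by omega) (by omega) ?_
    have hf := edgeGraph_adj_right (n := a + b + c) (R := FixedRight a b c k) (U := FixedUp a b c k) x y
    rcases hpq with h | h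
    · exact Or.inl (hf.1 h).2
    · refine Or.inr ⟨fun h' => not_fixed_of_matched N h (hf.2 ⟨?_, h'⟩), hm h⟩
      exact Or.inl (h.1.inGrid N)
  · refine pathLabel_eq_up N H (by omega) (by omega) (by omega) (by omega) ?_
    have hf := edgeGraph_adj_up (n := a + b + c) (R := FixedRight a b c k) (U := FixedUp a b c k) x y
    rcases hpq with h | h
    · exact Or.inl (hf.1 h).2
    · refine Or.inr ⟨fun h' => not_fixed_of_matched N h (hf.2 ⟨?_, h'⟩), hm h⟩
      exact Or.inl (h.1.inGrid N)

theorem pathLabel_eq_of_reachable (N : Normalized a b c k) (H : IsHeight a b c h) {p q : ℤ × ℤ}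
    (hpq : (configOf k (tilingOf a b c h)).Reachable p q) :
    pathLabel a b c k h p = pathLabel a b c k h q := by
  rw [SimpleGraph.reachable_iff_reflTransGen] at hpq
  induction hpq with
  | refl => rfl
  | tail _ h ih => exact ih.trans (pathLabel_eq_of_adj N H h)

end FullyPackedLoops

/-! ### Labels at the external edges -/

namespace FullyPackedLoops
variable {a b c : ℕ} {k : ℤ} {h : ℤ → ℤ → ℤ}

/-- The label `l` of the path at the external edge `j`, for `j` in a period around `C`. -/
def IsOuterLabel (a b c : ℕ) (k j l : ℤ) : Prop :=
  (j < k - 2 * (c + a) - 2 * (a + b) ∧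
    l = labelCB a b c ((j + 4 * (a + b + c) - k + 1) / 2)) ∨
  (k - 2 * (c + a) - 2 * (a + b) ≤ j ∧ j < k - 2 * (c + a) ∧
    l = labelBA a b ((k - 2 * (c + a) - j + 1) / 2)) ∨
  (k - 2 * (c + a) ≤ j ∧ j < k ∧ l = (j - (k - 2 * (c + a)) + 1) / 2) ∨
  (k ≤ j ∧ j < k + 2 * (b + c) ∧ l = labelCB a b c ((j - k + 1) / 2)) ∨
  (k + 2 * (b + c) ≤ j ∧ l = labelBA a b (a + b + 1 - (j - (k + 2 * (b + c)) + 1) / 2))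

/-- Outside the grid a height either does not enter the label or is the height of the walls, so on
each side the label depends only on the number of the external edge. -/
theorem isOuterLabel_bottom (N : Normalized a b c k) {u w : ℤ}
    (h0 : 0 ≤ 2 * u + k + 1) (h1 : 2 * u + k + 1 < a + b + c) (hw : w = u + 1) :
    IsOuterLabel a b c k (2 * u + k + 1) (labelEven a b c k h u w) := by
  obtain ⟨ha, hb, hc, h1, h2⟩ := N
  unfold IsOuterLabel
  rcases labelEven_cases a b c k h u w with ⟨p1, e⟩ |
    ⟨p1, p2, e⟩ |
    ⟨p1, p2, p3, e⟩ |
    ⟨p1, p2, p3, p4, e⟩ |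
    ⟨p1, p2, p3, p4, p5, p6, e⟩ |
    ⟨p1, p2, p3, p4, p5, p6, e⟩ |
    ⟨p1, p2, p3, p4, p5, p6, e⟩ |
    ⟨p1, p2, p3, p4, p5, p6, e⟩ <;>
  first
  | (exfalso; omega)
  | (simp only [e, labelCB, labelBA]
     omega)

theorem isOuterLabel_top (N : Normalized a b c k) (H : IsHeight a b c h) {u w : ℤ}
    (h0 : -2 * (a + b + c) ≤ -2 * u - k - 1) (h1 : -2 * u - k - 1 < -(a + b + c))
    (hw : w = u - (a + b + c)) :
    IsOuterLabel a b c k (-2 * u - k - 1) (labelEven a b c k h u w) := by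
  obtain ⟨ha, hb, hc, h1, h2⟩ := N
  by_cases hj' : -2 * u - k - 1 < k - 2 * (c + a) - 2 * (a + b)
  · refine Or.inl ⟨hj', ?_⟩
    rcases labelEven_cases a b c k h u w with ⟨p1, e⟩ |
    ⟨p1, p2, e⟩ |
    ⟨p1, p2, p3, e⟩ |
    ⟨p1, p2, p3, p4, e⟩ |
    ⟨p1, p2, p3, p4, p5, p6, e⟩ |
    ⟨p1, p2, p3, p4, p5, p6, e⟩ |
    ⟨p1, p2, p3, p4, p5, p6, e⟩ |
    ⟨p1, p2, p3, p4, p5, p6, e⟩ <;>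
      first
      | (exfalso; omega)
      | (rw [e]
         have l1 := H.lower (w + a) (u - c)
         have u1 := H.upper (w + a) (u - c)
         try simp only [labelCB, labelBA]
         split_ifs <;> omega)
  by_cases hj : -2 * u - k - 1 < k - 2 * (c + a)
  · refine Or.inr (Or.inl ⟨by omega, by omega, ?_⟩)
    rcases labelEven_cases a b c k h u w with ⟨p1, e⟩ |
    ⟨p1, p2, e⟩ |
    ⟨p1, p2, p3, e⟩ |
    ⟨p1, p2, p3, p4, e⟩ |
    ⟨p1, p2, p3, p4, p5, p6, e⟩ |
    ⟨p1, p2, p3, p4, p5, p6, e⟩ |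
    ⟨p1, p2, p3, p4, p5, p6, e⟩ |
    ⟨p1, p2, p3, p4, p5, p6, e⟩ <;>
      first
      | (exfalso; omega)
      | (rw [e]
         have l1 := H.lower (w + a) (u - c)
         have u1 := H.upper (w + a) (u - c)
         try simp only [labelCB, labelBA]
         split_ifs <;> omega)
  · refine Or.inr (Or.inr (Or.inl ⟨by omega, by omega, ?_⟩))
    rcases labelEven_cases a b c k h u w with ⟨p1, e⟩ |
    ⟨p1, p2, e⟩ |
    ⟨p1, p2, p3, e⟩ |
    ⟨p1, p2, p3, p4, e⟩ |
    ⟨p1, p2, p3, p4, p5, p6, e⟩ |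
    ⟨p1, p2, p3, p4, p5, p6, e⟩ |
    ⟨p1, p2, p3, p4, p5, p6, e⟩ |
    ⟨p1, p2, p3, p4, p5, p6, e⟩ <;>
      first
      | (exfalso; omega)
      | (rw [e]
         have l1 := H.lower (w + a) (u - c)
         have u1 := H.upper (w + a) (u - c)
         try simp only [labelBA]
         split_ifs <;> omega)

theorem isOuterLabel_right (N : Normalized a b c k) (H : IsHeight a b c h) {u w : ℤ}
    (h0 : a + b + c ≤ 2 * u + k + 1) (h1 : 2 * u + k + 1 < 2 * (a + b + c))
    (hw : w = a + b + c - u - k - 1) :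
    IsOuterLabel a b c k (2 * u + k + 1) (labelOdd a b c k h u w) := by
  obtain ⟨ha, hb, hc, h1, h2⟩ := N
  by_cases hj : 2 * u + k + 1 < k + 2 * (b + c)
  · refine Or.inr (Or.inr (Or.inr (Or.inl ⟨by omega, by omega, ?_⟩)))
    rcases labelOdd_cases a b c k h u w with ⟨p1, e⟩ |
    ⟨p1, p2, e⟩ |
    ⟨p1, p2, p3, e⟩ |
    ⟨p1, p2, p3, p4, e⟩ |
    ⟨p1, p2, p3, p4, p5, p6, e⟩ |
    ⟨p1, p2, p3, p4, p5, p6, e⟩ |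
    ⟨p1, p2, p3, p4, p5, p6, e⟩ |
    ⟨p1, p2, p3, p4, p5, p6, e⟩ <;>
      first
      | (exfalso; omega)
      | (rw [e]
         have l1 := H.lower (w + a) (w + u + k - a - c + 1)
         have u1 := H.upper (w + a) (w + u + k - a - c + 1)
         try simp only [labelCB, labelBA]
         split_ifs <;> omega)
  · refine Or.inr (Or.inr (Or.inr (Or.inr ⟨by omega, ?_⟩)))
    rcases labelOdd_cases a b c k h u w with ⟨p1, e⟩ |
    ⟨p1, p2, e⟩ |
    ⟨p1, p2, p3, e⟩ |
    ⟨p1, p2, p3, p4, e⟩ |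
    ⟨p1, p2, p3, p4, p5, p6, e⟩ |
    ⟨p1, p2, p3, p4, p5, p6, e⟩ |
    ⟨p1, p2, p3, p4, p5, p6, e⟩ |
    ⟨p1, p2, p3, p4, p5, p6, e⟩ <;>
      first
      | (exfalso; omega)
      | (rw [e]
         have l1 := H.lower (w + a) (w + u + k - a - c + 1)
         have u1 := H.upper (w + a) (w + u + k - a - c + 1)
         try simp only [labelCB, labelBA]
         split_ifs <;> omega)

theorem isOuterLabel_left (N : Normalized a b c k) (H : IsHeight a b c h) {u w : ℤ}
    (h0 : -(a + b + c) ≤ 2 * w + k + 1) (h1 : 2 * w + k + 1 < 0)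
    (hw : u = -w - k - 2) :
    IsOuterLabel a b c k (2 * w + k + 1) (labelOdd a b c k h u w) := by
  obtain ⟨ha, hb, hc, h1, h2⟩ := N
  by_cases hj : 2 * w + k + 1 < k - 2 * (c + a)
  · refine Or.inr (Or.inl ⟨by omega, by omega, ?_⟩)
    rcases labelOdd_cases a b c k h u w with ⟨p1, e⟩ |
    ⟨p1, p2, e⟩ |
    ⟨p1, p2, p3, e⟩ |
    ⟨p1, p2, p3, p4, e⟩ |
    ⟨p1, p2, p3, p4, p5, p6, e⟩ |
    ⟨p1, p2, p3, p4, p5, p6, e⟩ |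
    ⟨p1, p2, p3, p4, p5, p6, e⟩ |
    ⟨p1, p2, p3, p4, p5, p6, e⟩ <;>
      first
      | (exfalso; omega)
      | (rw [e]
         have l1 := H.lower (u + w + k - c + 1 + 1) (u - c + 1)
         have u1 := H.upper (u + w + k - c + 1 + 1) (u - c + 1)
         have l2 := H.lower (w + a) (u - c + 1)
         have u2 := H.upper (w + a) (u - c + 1)
         try simp only [labelBA]
         omega)
  · refine Or.inr (Or.inr (Or.inl ⟨by omega, by omega, ?_⟩))
    rcases labelOdd_cases a b c k h u w with ⟨p1, e⟩ |
    ⟨p1, p2, e⟩ |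
    ⟨p1, p2, p3, e⟩ |
    ⟨p1, p2, p3, p4, e⟩ |
    ⟨p1, p2, p3, p4, p5, p6, e⟩ |
    ⟨p1, p2, p3, p4, p5, p6, e⟩ |
    ⟨p1, p2, p3, p4, p5, p6, e⟩ |
    ⟨p1, p2, p3, p4, p5, p6, e⟩ <;>
      first
      | (exfalso; omega)
      | (rw [e]
         have l1 := H.lower (u + w + k - c + 1 + 1) (u - c + 1)
         have u1 := H.upper (u + w + k - c + 1 + 1) (u - c + 1)
         have l2 := H.lower (w + a) (u - c + 1)
         have u2 := H.upper (w + a) (u - c + 1)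
         try simp only [labelBA]
         omega)

end FullyPackedLoops

/-! ### The link pattern of the configuration given by a matching -/

namespace FullyPackedLoops
variable {a b c : ℕ} {k : ℤ} {h : ℤ → ℤ → ℤ}

theorem isOuterLabel_pathLabel (N : Normalized a b c k) (H : IsHeight a b c h) {j : ℤ}
    (hj : Odd (j - k)) (h0 : -2 * ((a + b + c : ℕ) : ℤ) ≤ j) (h1 : j < 2 * ((a + b + c : ℕ) : ℤ)) :
    IsOuterLabel a b c k j (pathLabel a b c k h (outer (a + b + c) j)) := by
  have hjk : (j - k) % 2 = 1 := Int.odd_iff.1 hj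
  have hn : ((a + b + c : ℕ) : ℤ) = a + b + c := by push_cast; ring
  rcases outer_inner_cases h0 h1 with ⟨h2, h3, e, _⟩ | ⟨h2, e, _⟩ | ⟨h2, e, _⟩ | ⟨h2, h3, e, _⟩ <;>
    rw [e]
  · obtain ⟨u, rfl⟩ : ∃ u, j = 2 * u + k + 1 := ⟨(j - k - 1) / 2, by omega⟩
    have e' : (2 * u + k + 1 + 1, (0 : ℤ)) = evenPoint k u (u + 1) := by
      unfold evenPoint
      refine Prod.ext ?_ ?_ <;> dsimp only <;> ring
    rw [e', pathLabel_evenPoint]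
    exact isOuterLabel_bottom N (by omega) (by omega) rfl
  · obtain ⟨u, rfl⟩ : ∃ u, j = 2 * u + k + 1 := ⟨(j - k - 1) / 2, by omega⟩
    have e' : (((a + b + c : ℕ) : ℤ) + 1, 2 * u + k + 1 - ((a + b + c : ℕ) : ℤ) + 1) =
        oddPoint k u (a + b + c - u - k - 1) := by
      unfold oddPoint
      refine Prod.ext ?_ ?_ <;> dsimp only <;> omega
    rw [e', pathLabel_oddPoint]
    exact isOuterLabel_right N H (by omega) (by omega) rfl
  · obtain ⟨u, rfl⟩ : ∃ u, j = -2 * u - k - 1 := ⟨(-j - k - 1) / 2, by omega⟩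
    have e' : (-((a + b + c : ℕ) : ℤ) - (-2 * u - k - 1), ((a + b + c : ℕ) : ℤ) + 1) =
        evenPoint k u (u - (a + b + c)) := by
      unfold evenPoint
      refine Prod.ext ?_ ?_ <;> dsimp only <;> omega
    rw [e', pathLabel_evenPoint]
    exact isOuterLabel_top N H (by omega) (by omega) rfl
  · obtain ⟨w, rfl⟩ : ∃ w, j = 2 * w + k + 1 := ⟨(j - k - 1) / 2, by omega⟩
    have e' : ((0 : ℤ), -(2 * w + k + 1)) = oddPoint k (-w - k - 2) w := by
      unfold oddPoint
      refine Prod.ext ?_ ?_ <;> dsimp only <;> ring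
    rw [e', pathLabel_oddPoint]
    exact isOuterLabel_left N H (by omega) (by omega) rfl

/-- The label of the path at the external edge `j`, in the period which starts from `A`. -/
def outerLabel (a b c : ℕ) (k j : ℤ) : ℤ :=
  if j < k then (j - (k - 2 * (c + a)) + 1) / 2
  else if j < k + 2 * (b + c) then labelCB a b c ((j - k + 1) / 2)
  else labelBA a b (a + b + 1 - (j - (k + 2 * (b + c)) + 1) / 2)

/-- Numbers from `2 n` on are moved back by one period before the positions can be computed. -/
theorem pathLabel_outer (N : Normalized a b c k) (H : IsHeight a b c h) {j : ℤ}
    (hj : Odd (j - k)) (h0 : k - 2 * (c + a) ≤ j)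
    (h1 : j < k - 2 * (c + a) + 4 * ((a + b + c : ℕ) : ℤ)) :
    pathLabel a b c k h (outer (a + b + c) j) = outerLabel a b c k j := by
  have hn : ((a + b + c : ℕ) : ℤ) = a + b + c := by push_cast; ring
  obtain ⟨ha, hb, hc, h2, h3⟩ := id N
  unfold outerLabel
  by_cases h4 : j < 2 * ((a + b + c : ℕ) : ℤ)
  · have h5 := isOuterLabel_pathLabel N H hj (by omega) h4
    rcases h5 with ⟨_, e⟩ | ⟨_, _, e⟩ | ⟨_, _, e⟩ | ⟨_, _, e⟩ | ⟨_, e⟩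
    · omega
    · omega
    · rw [e, if_pos (by omega)]
    · rw [e, if_neg (by omega), if_pos (by omega)]
    · rw [e, if_neg (by omega), if_neg (by omega)]
  · have hper := outer_add_period (a + b + c) j (-1)
    have hjk := Int.odd_iff.1 hj
    have h5 := isOuterLabel_pathLabel (j := j + 4 * ((a + b + c : ℕ) : ℤ) * (-1)) N H
      (Int.odd_iff.2 (by omega)) (by omega) (by omega)
    rw [hper] at h5
    rcases h5 with ⟨_, e⟩ | ⟨_, _, e⟩ | ⟨_, _, e⟩ | ⟨_, _, e⟩ | ⟨_, e⟩
    · rw [e, if_neg (by omega), if_pos (by omega)]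
      congr 1; omega
    · rw [e, if_neg (by omega), if_neg (by omega)]
      congr 1; omega
    all_goals omega

/-- Any external end of the path that starts at `i` carries the same label, hence is `i` or `i'`.
All other points of the path have degree two, so `reachable_of_degrees` produces the end `i'`. -/
theorem reachable_of_outerLabel (N : Normalized a b c k) {M : (hexGraph a b c).Subgraph}
    (hM : M.IsPerfectMatching) {i i' : ℤ} (hi : Odd (i - k))
    (hi0 : k - 2 * (c + a) ≤ i) (hi1 : i < k - 2 * (c + a) + 4 * (a + b + c))
    (huniq : ∀ j, k - 2 * (c + a) ≤ j → j < k - 2 * (c + a) + 4 * (a + b + c) → Odd (j - k) →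
      outerLabel a b c k i = outerLabel a b c k j → j = i ∨ j ≡ i' [ZMOD 4 * (a + b + c : ℕ)]) :
    (configOf k M).Reachable (outer (a + b + c) i) (outer (a + b + c) i') := by
  have hn : ((a + b + c : ℕ) : ℤ) = a + b + c := by push_cast; ring
  have hpos : 0 < a + b + c := by have := N.ha; omega
  have hF := isFPL_configOf N hM
  set G := configOf k M with hG
  have hleaf : (G.neighborSet (outer (a + b + c) i)).ncard = 1 := by
    have := (configOf_adj_outer N M i).2 hi
    rw [Set.ncard_eq_one]
    refine ⟨inner (a + b + c) i, Set.eq_singleton_iff_unique_mem.2 ⟨this, fun q hq => ?_⟩⟩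
    have hq' := hF.1 _ _ hq
    exact (outer_inner_spec hpos i).2.2.2 q (hq'.2.resolve_left (outer_inner_spec hpos i).1) hq'.1
  have hgrid : ∀ v, G.Reachable (outer (a + b + c) i) v → InGrid (a + b + c) v ∨
      v = outer (a + b + c) i ∨ v = outer (a + b + c) i' := by
    intro v hv
    by_cases hvg : InGrid (a + b + c) v
    · exact Or.inl hvg
    refine Or.inr ?_
    by_cases hvi : v = outer (a + b + c) i
    · exact Or.inl hvi
    have hlab : pathLabel a b c k (matchingHeight M) (outer (a + b + c) i) =
        pathLabel a b c k (matchingHeight M) v := by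
      refine pathLabel_eq_of_reachable N (isHeight_matchingHeight hM) ?_
      rwa [tilingOf_matchingHeight hM]
    obtain ⟨q, hq⟩ : ∃ q, G.Adj v q := by
      obtain ⟨w⟩ := hv.symm
      cases w with
      | nil => exact absurd rfl hvi
      | cons h _ => exact ⟨_, h⟩
    have hq' := hF.1 _ _ hq
    obtain ⟨j', -, -, rfl, rfl⟩ := exists_outer hvg (hq'.2.resolve_left hvg) hq'.1
    obtain ⟨j, hj0, hj1, hj⟩ := exists_index hpos (k - 2 * (c + a)) j'
    rw [← outer_congr hj] at hlab hq ⊢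
    rw [← inner_congr hj] at hq
    have hodd := (configOf_adj_outer N M j).1 hq
    rw [pathLabel_outer N (isHeight_matchingHeight hM) hi hi0 (by omega),
      pathLabel_outer N (isHeight_matchingHeight hM) hodd hj0 hj1] at hlab
    exact (huniq j hj0 (by omega) hodd hlab).imp (fun h => by rw [h]) fun h => outer_congr h
  refine reachable_of_degrees ?_ hleaf fun v hv => ?_
  · refine ((Set.toFinite (Set.Icc (1 : ℤ) (a + b + c : ℕ) ×ˢ Set.Icc (1 : ℤ) (a + b + c : ℕ))).union
      (Set.toFinite {outer (a + b + c) i, outer (a + b + c) i'})).subset fun v hv => ?_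
    exact (hgrid v hv).imp (fun h => ⟨⟨h.1, h.2.1⟩, h.2.2⟩) fun h => h
  · rcases hgrid v hv with h | h | h
    · exact Or.inr (Or.inr (hF.2.1 v h))
    · exact Or.inl h
    · exact Or.inr (Or.inl h)

/-- In one period every label occurs exactly at the two edges symmetric about the centre of its
bundle. For `A`, where the period starts, the symmetric edge appears shifted by `4 n`. -/
theorem isNormalFPL_configOf (N : Normalized a b c k) {M : (hexGraph a b c).Subgraph}
    (hM : M.IsPerfectMatching) : IsNormalFPL a b c k (configOf k M) := by
  have hn : ((a + b + c : ℕ) : ℤ) = a + b + c := by push_cast; ring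
  obtain ⟨ha, hb, hc, h2, h3⟩ := id N
  refine ⟨isFPL_configOf N hM, ⟨?_, fun i hi1 hi2 => ?_⟩, ⟨?_, fun i hi1 hi2 => ?_⟩,
    ⟨?_, fun i hi1 hi2 => ?_⟩⟩
  · rw [configOf_adj_outer N, Int.odd_iff]; omega
  · refine reachable_of_outerLabel N hM (Int.odd_iff.2 (by omega))
      (by omega) (by omega) fun j hj0 hj1 hj hl => ?_
    rw [Int.odd_iff] at hj
    have : j = k - 2 * (c + a) + (2 * i - 1) ∨
        j = k - 2 * (c + a) - (2 * i - 1) + 4 * (a + b + c : ℕ) := by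
      unfold outerLabel labelBA labelCB at hl
      split_ifs at hl <;> omega
    refine this.imp_right fun h => ?_
    rw [h]
    exact Int.add_modEq_right
  · rw [configOf_adj_outer N, Int.odd_iff]; omega
  · refine reachable_of_outerLabel N hM (Int.odd_iff.2 (by omega))
      (by omega) (by omega) fun j hj0 hj1 hj hl => ?_
    rw [Int.odd_iff] at hj
    have : j = k + 2 * (b + c) + (2 * i - 1) ∨ j = k + 2 * (b + c) - (2 * i - 1) := by
      unfold outerLabel labelBA labelCB at hl
      split_ifs at hl <;> omega
    exact this.imp_right fun h => by rw [h]
  · rw [configOf_adj_outer N, Int.odd_iff]; omega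
  · refine reachable_of_outerLabel N hM (Int.odd_iff.2 (by omega))
      (by omega) (by omega) fun j hj0 hj1 hj hl => ?_
    rw [Int.odd_iff] at hj
    have : j = k + (2 * i - 1) ∨ j = k - (2 * i - 1) := by
      unfold outerLabel labelBA labelCB at hl
      split_ifs at hl <;> omega
    exact this.imp_right fun h => by rw [h]

end FullyPackedLoops

/-! ### The bijection in normalized position, and rotations -/

namespace FullyPackedLoops
variable {a b c : ℕ} {k : ℤ}

/-- A configuration in normalized position is given by a perfect matching of the hexagon. -/
noncomputable def normalEquiv (N : Normalized a b c k) :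
    {G : SimpleGraph (ℤ × ℤ) // IsNormalFPL a b c k G} ≃ HexDimer a b c where
  toFun G := ⟨matchingOf a b c k G.1, (G.2.eq_configOf N).1⟩
  invFun M := ⟨configOf k M.1, isNormalFPL_configOf N M.2⟩
  left_inv G := Subtype.ext (G.2.eq_configOf N).2
  right_inv M := Subtype.ext (matchingOf_configOf N M.2)

theorem normalEquiv_adj (N : Normalized a b c k)
    (G : {G : SimpleGraph (ℤ × ℤ) // IsNormalFPL a b c k G}) (p q : PavingVertex a b c k)
    (h : (dominoGraph (a + b + c) (centreA a b c k) (centreB a b c k) (k + 1, 1)).Adj p q) :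
    G.1.Adj p.1 q.1 ↔ (normalEquiv N G).1.Adj (pavingIso N p) (pavingIso N q) := by
  have h' : (hexGraph a b c).Adj (pavingIso N p) (pavingIso N q) := (pavingIso N).map_adj_iff.2 h
  refine Iff.trans ?_ (and_iff_right h').symm
  have e : ∀ p : PavingVertex a b c k, ofHex a b c k (pavingIso N p).1 = p.1 := fun p =>
    ofHex_toHex N (p.isHexSite N)
  rw [e, e]

/-! ### Rotations of the grid -/

variable {n : ℕ}

/-- The quarter turn is a permutation. -/
def rotEquiv (n : ℕ) : (ℤ × ℤ) ≃ (ℤ × ℤ) where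
  toFun := rot n
  invFun p := (p.2, n + 1 - p.1)
  left_inv p := by simp [rot]
  right_inv p := by simp [rot]

theorem inGrid_rot (p : ℤ × ℤ) : InGrid n (rot n p) ↔ InGrid n p := by
  unfold InGrid rot
  dsimp only
  omega

theorem latticeAdj_rot (p q : ℤ × ℤ) : LatticeAdj (rot n p) (rot n q) ↔ LatticeAdj p q := by
  unfold LatticeAdj rot
  dsimp only
  rw [sub_sub_sub_cancel_left, abs_sub_comm q.2, add_comm]

theorem outer_inner_add (hn : 0 < n) (j : ℤ) :
    outer n (j + n) = rot n (outer n j) ∧ inner n (j + n) = rot n (inner n j) := by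
  have hq : (j + n) / n = j / n + 1 := by
    rw [Int.add_ediv_of_dvd_right (dvd_refl _), Int.ediv_self (by omega)]
  have hr : (j + n) % n = j % n := Int.add_emod_right j n
  unfold outer inner side rot
  rw [hq, hr]
  have h4 : j / n % 4 = 0 ∨ j / n % 4 = 1 ∨ j / n % 4 = 2 ∨ j / n % 4 = 3 := by omega
  have h5 : (j / n + 1) % 4 = (j / n % 4 + 1) % 4 := by omega
  rw [h5]
  have t2 : Int.toNat 2 = 2 := rfl
  have t3 : Int.toNat 3 = 3 := rfl
  rcases h4 with h | h | h | h <;> rw [h] <;> norm_num [t2, t3]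
  exact add_comm _ _

theorem isBundle_comap_rot (hn : 0 < n) (G : SimpleGraph (ℤ × ℤ)) (X : ℤ) (m : ℕ) :
    IsBundle n (G.comap (rot n)) X m ↔ IsBundle n G (X + n) m := by
  unfold IsBundle
  rw [SimpleGraph.comap_adj, (outer_inner_add hn X).1, (outer_inner_add hn X).2]
  refine and_congr_right fun _ => forall_congr' fun i => forall_congr' fun _ =>
    forall_congr' fun _ => ?_
  rw [add_right_comm, add_sub_right_comm, (outer_inner_add hn _).1, (outer_inner_add hn _).1]
  exact (SimpleGraph.Iso.comap (rotEquiv n) G).reachable_iff.symm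

theorem isFPL_comap_rot (hn : 0 < n) (G : SimpleGraph (ℤ × ℤ)) :
    IsFPL n (G.comap (rot n)) ↔ IsFPL n G := by
  have hsurj : Function.Surjective (rot n) := (rotEquiv n).surjective
  have hinj : Function.Injective (rot n) := (rotEquiv n).injective
  unfold IsFPL
  refine and_congr ?_ (and_congr ?_ ?_)
  · refine Iff.trans (forall_congr' fun p => forall_congr' fun q => ?_) hsurj.forall₂.symm
    rw [SimpleGraph.comap_adj, latticeAdj_rot, inGrid_rot, inGrid_rot]
  · refine Iff.trans (forall_congr' fun p => ?_) hsurj.forall.symm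
    rw [inGrid_rot]
    have e : (G.comap (rot n)).neighborSet p = rot n ⁻¹' G.neighborSet (rot n p) := rfl
    rw [e, Set.ncard_preimage_of_injective_subset_range hinj]
    rw [hsurj.range_eq]
    exact Set.subset_univ _
  · have hs : ∀ P : ℤ → Prop, (∀ j, (G.comap (rot n)).Adj (outer n j) (inner n j) ↔ P j) ↔
        ∀ j, G.Adj (outer n j) (inner n j) ↔ P (j - n) := by
      intro P
      have : Function.Surjective fun j : ℤ => j + n := fun j => ⟨j - n, sub_add_cancel j _⟩
      rw [this.forall (p := fun j => G.Adj (outer n j) (inner n j) ↔ P (j - n))]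
      refine forall_congr' fun j => ?_
      rw [SimpleGraph.comap_adj, (outer_inner_add hn j).1, (outer_inner_add hn j).2,
        add_sub_cancel_right]
    rw [hs, hs]
    -- A quarter turn shifts the numbers by `n`, so for odd `n` the two alternatives for the
    -- external edges are exchanged.
    rcases Int.even_or_odd (n : ℤ) with h | h
    · simp only [Int.even_sub, Int.odd_sub, h, iff_true]
    · simp only [Int.even_sub, Int.odd_sub, iff_false, Int.not_even_iff_odd.2 h,
        Int.not_even_iff_odd, Int.not_odd_iff_even]
      exact or_comm

theorem isFPL_comap_rot_iterate (hn : 0 < n) (r : ℕ) (G : SimpleGraph (ℤ × ℤ)) :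
    IsFPL n (G.comap (rot n)^[r]) ↔ IsFPL n G := by
  induction r generalizing G with
  | zero => exact Iff.rfl
  | succ r ih =>
    rw [Function.iterate_succ', ← SimpleGraph.comap_comap, ih, isFPL_comap_rot hn]

theorem isBundle_comap_rot_iterate (hn : 0 < n) (r : ℕ) (G : SimpleGraph (ℤ × ℤ)) (X : ℤ) (m : ℕ) :
    IsBundle n (G.comap (rot n)^[r]) X m ↔ IsBundle n G (X + r * n) m := by
  induction r generalizing X G with
  | zero => simp
  | succ r ih =>
    rw [Function.iterate_succ', ← SimpleGraph.comap_comap, ih, isBundle_comap_rot hn]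
    push_cast
    ring_nf

/-- Rotating a configuration, as a permutation of the graphs. -/
def comapRotEquiv (n r : ℕ) : SimpleGraph (ℤ × ℤ) ≃ SimpleGraph (ℤ × ℤ) where
  toFun G := G.comap (rot n)^[r]
  invFun G := G.comap (rotEquiv n).symm^[r]
  left_inv G := by
    dsimp only
    rw [SimpleGraph.comap_comap]
    have : (rot n)^[r] ∘ (rotEquiv n).symm^[r] = id :=
      funext (Function.LeftInverse.iterate (rotEquiv n).right_inv r)
    rw [this]
    exact SimpleGraph.comap_id
  right_inv G := by
    dsimp only
    rw [SimpleGraph.comap_comap]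
    have : (rotEquiv n).symm^[r] ∘ (rot n)^[r] = id :=
      funext (Function.LeftInverse.iterate (rotEquiv n).left_inv r)
    rw [this]
    exact SimpleGraph.comap_id

/-- Rotating the configurations into normalized position. -/
def fplEquivNormal (hn : 0 < a + b + c) (r : ℕ) {A B C : ℤ}
    (hA : k - 2 * (c + a) + r * (a + b + c : ℕ) ≡ A [ZMOD 4 * (a + b + c : ℕ)])
    (hB : k + 2 * (b + c) + r * (a + b + c : ℕ) ≡ B [ZMOD 4 * (a + b + c : ℕ)])
    (hC : k + r * (a + b + c : ℕ) ≡ C [ZMOD 4 * (a + b + c : ℕ)]) :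
    FPLOfType (a + b + c) A B C a b c ≃ {G : SimpleGraph (ℤ × ℤ) // IsNormalFPL a b c k G} :=
  (comapRotEquiv (a + b + c) r).subtypeEquiv fun G => by
    have h1 := isBundle_comap_rot_iterate hn r G
    constructor
    · rintro ⟨h, h2, h3, h4⟩
      exact ⟨(isFPL_comap_rot_iterate hn r G).2 h, (h1 _ _).2 (h2.congr hA.symm),
        (h1 _ _).2 (h3.congr hB.symm), (h1 _ _).2 (h4.congr hC.symm)⟩
    · rintro ⟨h, h2, h3, h4⟩
      exact ⟨(isFPL_comap_rot_iterate hn r G).1 h, ((h1 _ _).1 h2).congr hA,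
        ((h1 _ _).1 h3).congr hB, ((h1 _ _).1 h4).congr hC⟩

end FullyPackedLoops

namespace FullyPackedLoops
variable {n : ℕ}

/-! ### The cones -/

/-- Rotating `X` to the bottom side gives the number `X % n`, up to a multiple of the period. -/
theorem sub_side_mul (n : ℕ) (X : ℤ) :
    X - side n X * n = X % n + 4 * n * (X / n / 4) := by
  have h1 : ((side n X : ℕ) : ℤ) = X / n % 4 := by
    unfold side
    rw [Int.toNat_of_nonneg (Int.emod_nonneg _ (by norm_num))]
  have h2 := Int.emod_add_mul_ediv X n
  have h3 := Int.emod_add_mul_ediv (X / n) 4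
  rw [h1]
  linear_combination (-1) * h2 + (-n : ℤ) * h3

theorem inCone_iff (hn : 0 < n) {X Y e : ℤ} (he : e ≡ X % n + (Y - X) [ZMOD 4 * n]) :
    InCone n X Y ↔ |(inner n e).1 - (X % n + 1)| ≤ (inner n e).2 - 1 := by
  have h0 := Int.emod_nonneg X (b := (n : ℤ)) (by omega)
  have h1 := Int.emod_lt_of_pos X (b := (n : ℤ)) (by omega)
  have e1 : inner n (X - side n X * n) = (X % n + 1, 1) := by
    rw [sub_side_mul n, inner_add_period, (outer_inner_bottom h0 h1).2]
  have e2 : inner n (Y - side n X * n) = inner n e := by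
    have : Y - side n X * n = X % n + (Y - X) + 4 * n * (X / n / 4) := by
      have := sub_side_mul n X
      linear_combination this
    rw [this, inner_add_period, inner_congr he]
  unfold InCone
  rw [e1, e2]

theorem inCone_self (hn : 0 < n) (X : ℤ) : InCone n X X := by
  have h0 := Int.emod_nonneg X (b := (n : ℤ)) (by omega)
  have h1 := Int.emod_lt_of_pos X (b := (n : ℤ)) (by omega)
  rw [inCone_iff hn (e := X % n) (by rw [sub_self, add_zero]), (outer_inner_bottom h0 h1).2]
  simp

/-- With `X` at distance `X % n` from the left end of the bottom side, the diagonal that goes up to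
the left from `X` separates the external edges `2 p` steps before `X` at the threshold `X % n < p`,
whether `Y` is on the left or the top side. -/
theorem inCone_iff_of_before (hn : 0 < n) {X Y p : ℤ} (hp0 : 0 < p) (hp1 : p < n)
    (h : Y + 2 * p ≡ X [ZMOD 4 * n]) : InCone n X Y ↔ X % n < p := by
  have h0 := Int.emod_nonneg X (b := (n : ℤ)) (by omega)
  have h1 := Int.emod_lt_of_pos X (b := (n : ℤ)) (by omega)
  have he : X % n - 2 * p ≡ X % n + (Y - X) [ZMOD 4 * n] := by
    have := (h.symm.sub_right X).sub_right (2 * p) |>.add_left (X % n)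
    convert this using 1 <;> ring
  rw [inCone_iff hn he]
  rcases outer_inner_cases (n := n) (j := X % n - 2 * p) (by omega) (by omega) with
    ⟨h2, h3, -, e⟩ | ⟨h2, -, e⟩ | ⟨h2, -, e⟩ | ⟨h2, h3, -, e⟩ <;>
    rw [e, abs_le] <;> dsimp only <;> omega

theorem inCone_iff_of_after (hn : 0 < n) {X Y p : ℤ} (hp0 : 0 < p) (hp1 : p < n)
    (h : Y ≡ X + 2 * p [ZMOD 4 * n]) : InCone n X Y ↔ n ≤ X % n + p := by
  have h0 := Int.emod_nonneg X (b := (n : ℤ)) (by omega)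
  have h1 := Int.emod_lt_of_pos X (b := (n : ℤ)) (by omega)
  have he : X % n + 2 * p ≡ X % n + (Y - X) [ZMOD 4 * n] := by
    have := (h.symm.sub_right X).add_left (X % n)
    convert this using 1; ring
  -- On the top side the number is at least `2 n`, beyond the range covered by `outer_inner_cases`.
  by_cases hlt : X % n + 2 * p < 2 * n
  · rw [inCone_iff hn he]
    rcases outer_inner_cases (n := n) (j := X % n + 2 * p) (by omega) (by omega) with
      ⟨h2, h3, -, e⟩ | ⟨h2, -, e⟩ | ⟨h2, -, e⟩ | ⟨h2, h3, -, e⟩ <;>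
      rw [e, abs_le] <;> dsimp only <;> omega
  · rw [inCone_iff hn he, (outer_inner_top (n := n) (j := X % n + 2 * p) (by omega) (by omega)).2, abs_le]
    dsimp only
    omega

theorem emod_cases (hn : 0 < n) {X Y t : ℤ} (h : Y ≡ X + t [ZMOD n]) (h0 : -n < t) (h1 : t < n) :
    Y % n = X % n + t ∨ Y % n = X % n + t + n ∨ Y % n = X % n + t - n := by
  have hX0 := Int.emod_nonneg X (b := (n : ℤ)) (by omega)
  have hX1 := Int.emod_lt_of_pos X (b := (n : ℤ)) (by omega)
  have hY0 := Int.emod_nonneg Y (b := (n : ℤ)) (by omega)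
  have hY1 := Int.emod_lt_of_pos Y (b := (n : ℤ)) (by omega)
  have h' : Y % n ≡ X % n + t [ZMOD n] :=
    (Int.mod_modEq Y n).trans (h.trans ((Int.mod_modEq X n).symm.add_right t))
  obtain ⟨m, hm⟩ := h'.symm.dvd
  have hm2 : m < 2 := by nlinarith
  have hm3 : -2 < m := by nlinarith
  obtain rfl | rfl | rfl : m = 0 ∨ m = 1 ∨ m = -1 := by omega
  all_goals omega

theorem CounterclockwiseCentres.rotate {X Y Z : ℤ} {x y z : ℕ} (hn : x + y + z = n)
    (h : CounterclockwiseCentres n X Y Z x y z) : CounterclockwiseCentres n Y Z X y z x := by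
  refine ⟨h.2, ?_⟩
  have h2 : Z + 2 * (z + x) ≡ X + 4 * n [ZMOD 4 * n] := by
    have := (h.2.trans (h.1.add_right _)).add_right (2 * ((z : ℤ) + x))
    have e : X + 2 * ((x : ℤ) + y) + 2 * (y + z) + 2 * (z + x) = X + 4 * n := by
      rw [← hn]
      push_cast
      ring
    rwa [e] at this
  exact (h2.trans Int.add_modEq_right).symm

/-- The upper bound expresses that `Z` is in the cone, the lower bound that `Y` is; for `X = C`, `Y
= B`, `Z = A` this is the normalized position. -/
theorem CounterclockwiseCentres.inCone_iff {X Y Z : ℤ} {x y z : ℕ} (hx : 0 < x) (hy : 0 < y)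
    (hz : 0 < z) (hn : x + y + z = n) (h : CounterclockwiseCentres n X Y Z x y z) :
    InCone n X Y ∧ InCone n X Z ↔ (z : ℤ) ≤ X % n ∧ X % n < z + x := by
  have h' := (h.rotate hn).2
  rw [inCone_iff_of_after (by omega) (p := x + y) (by omega) (by omega) h.1,
    inCone_iff_of_before (by omega) (p := z + x) (by omega) (by omega) h'.symm]
  omega

/-- Modulo `n` one has `Y ≡ X + x + y - z` and `Z ≡ Y + y + z - x`. In terms of `X - z` modulo `n`,
the three conditions say that it lies in `[0, x)`, in `[-y, 0)`, or in `[-y - z, -y)`; as `x + y + z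
= n`, these intervals partition the residues. -/
theorem CounterclockwiseCentres.existsUnique_inCone {X Y Z : ℤ} {x y z : ℕ} (hx : 0 < x)
    (hy : 0 < y) (hz : 0 < z) (hn : x + y + z = n) (h : CounterclockwiseCentres n X Y Z x y z) :
    ((InCone n X Y ∧ InCone n X Z) ∧ ¬ (InCone n Y X ∧ InCone n Y Z) ∧
      ¬ (InCone n Z X ∧ InCone n Z Y)) ∨
    (¬ (InCone n X Y ∧ InCone n X Z) ∧ (InCone n Y X ∧ InCone n Y Z) ∧
      ¬ (InCone n Z X ∧ InCone n Z Y)) ∨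
    (¬ (InCone n X Y ∧ InCone n X Z) ∧ ¬ (InCone n Y X ∧ InCone n Y Z) ∧
      (InCone n Z X ∧ InCone n Z Y)) := by
  have hY := h.rotate hn
  have hZ := hY.rotate (by omega)
  have e1 := h.inCone_iff hx hy hz hn
  have e2 := hY.inCone_iff hy hz hx (by omega)
  have e3 := hZ.inCone_iff hz hx hy (by omega)
  rw [and_comm] at e2
  rw [e1, e2, e3]
  have hX0 := Int.emod_nonneg X (b := (n : ℤ)) (by omega)
  have hX1 := Int.emod_lt_of_pos X (b := (n : ℤ)) (by omega)
  have hY0 := Int.emod_nonneg Y (b := (n : ℤ)) (by omega)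
  have hY1 := Int.emod_lt_of_pos Y (b := (n : ℤ)) (by omega)
  have hZ0 := Int.emod_nonneg Z (b := (n : ℤ)) (by omega)
  have hZ1 := Int.emod_lt_of_pos Z (b := (n : ℤ)) (by omega)
  have m1 : Y ≡ X + (x + y - z) [ZMOD n] := by
    refine (h.1.of_mul_left 4).trans ?_
    have : X + 2 * ((x : ℤ) + y) = X + (x + y - z) + n := by rw [← hn]; push_cast; ring
    rw [this]
    exact Int.add_modEq_right
  have m2 : Z ≡ Y + (y + z - x) [ZMOD n] := by
    refine (h.2.of_mul_left 4).trans ?_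
    have : Y + 2 * ((y : ℤ) + z) = Y + (y + z - x) + n := by rw [← hn]; push_cast; ring
    rw [this]
    exact Int.add_modEq_right
  have c1 := emod_cases (by omega) m1 (by omega) (by omega)
  have c2 := emod_cases (by omega) m2 (by omega) (by omega)
  rcases c1 with c1 | c1 | c1 <;> rcases c2 with c2 | c2 | c2 <;> omega

end FullyPackedLoops

/-! ### Assembling the explicit bijection -/

namespace FullyPackedLoops
variable {a b c : ℕ} {k : ℤ}

theorem inner_eq_centreA (N : Normalized a b c k) :
    inner (a + b + c) (k - 2 * (c + a)) = centreA a b c k := by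
  obtain ⟨ha, hb, hc, h1, h2⟩ := N
  have hn : ((a + b + c : ℕ) : ℤ) = a + b + c := by push_cast; ring
  unfold centreA
  rcases outer_inner_cases (n := a + b + c) (j := k - 2 * (c + a)) (by omega) (by omega) with
    ⟨h3, h4, -, e⟩ | ⟨h3, -, e⟩ | ⟨h3, -, e⟩ | ⟨h3, h4, -, e⟩
  · omega
  · omega
  · rw [e, if_pos (by omega)]
    refine Prod.ext ?_ ?_ <;> dsimp only <;> omega
  · rw [e, if_neg (by omega)]
    refine Prod.ext rfl ?_
    dsimp only
    omega

theorem inner_eq_centreB (N : Normalized a b c k) :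
    inner (a + b + c) (k + 2 * (b + c)) = centreB a b c k := by
  obtain ⟨ha, hb, hc, h1, h2⟩ := N
  have hn : ((a + b + c : ℕ) : ℤ) = a + b + c := by push_cast; ring
  unfold centreB
  by_cases h3 : k < 2 * a
  · rw [if_pos h3, (outer_inner_right (n := a + b + c) (by omega) (by omega)).2]
    refine Prod.ext ?_ ?_ <;> dsimp only <;> omega
  · rw [if_neg h3, (outer_inner_top (n := a + b + c) (by omega) (by omega)).2]
    refine Prod.ext ?_ ?_ <;> dsimp only <;> omega

/-- The cone condition is `Normalized` for `k = C % n`. The configurations are rotated by `side n C`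
quarter turns, and the three equivalences are composed from `fplEquivNormal`, `normalEquiv` and the
inverse of `pictureEquiv`. -/
theorem explicitBijection (ha : 0 < a) (hb : 0 < b) (hc : 0 < c) {n : ℕ}
    (hn : a + b + c = n) {A B C : ℤ} (hA : InCone n C A) (hB : InCone n C B)
    (h : CounterclockwiseCentres n C B A c b a) : ExplicitBijection n A B C a b c := by
  subst hn
  have hsum : c + b + a = a + b + c := by ring
  have hk := (h.inCone_iff hc hb ha hsum).1 ⟨hB, hA⟩
  have hn : 0 < a + b + c := by omega
  have h0 := Int.emod_nonneg C (b := ((a + b + c : ℕ) : ℤ)) (by omega)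
  have h1 := Int.emod_lt_of_pos C (b := ((a + b + c : ℕ) : ℤ)) (by omega)
  have hr := sub_side_mul (a + b + c) C
  have N : Normalized a b c (C % (a + b + c : ℕ)) := ⟨ha, hb, hc, hk.1, hk.2⟩
  unfold ExplicitBijection
  dsimp only
  generalize side (a + b + c) C = r at hr ⊢
  generalize C % (a + b + c : ℕ) = k at *
  have hC' : C - r * (a + b + c : ℕ) ≡ k [ZMOD 4 * (a + b + c : ℕ)] := by
    rw [hr]
    exact Int.modEq_iff_dvd.2 ⟨-(C / (a + b + c : ℕ) / 4), by ring⟩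
  have hB' : B - r * (a + b + c : ℕ) ≡ k + 2 * (b + c) [ZMOD 4 * (a + b + c : ℕ)] := by
    have := h.1.sub_right (r * (a + b + c : ℕ))
    rw [add_sub_right_comm, add_comm (c : ℤ)] at this
    exact this.trans (hC'.add_right _)
  have hA' : A - r * (a + b + c : ℕ) ≡ k - 2 * (c + a) [ZMOD 4 * (a + b + c : ℕ)] := by
    have h3 := (h.rotate hsum).2.symm.sub_right (2 * ((a : ℤ) + c))
    rw [add_sub_cancel_right] at h3
    have := h3.sub_right (r * (a + b + c : ℕ))
    rw [sub_right_comm, add_comm (a : ℤ)] at this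
    exact this.trans (hC'.sub_right _)
  rw [inner_congr hA', inner_congr hB', inner_congr hC', inner_eq_centreA N, inner_eq_centreB N,
    (outer_inner_bottom h0 h1).2]
  have back : ∀ {X y : ℤ}, X - r * (a + b + c : ℕ) ≡ y [ZMOD 4 * (a + b + c : ℕ)] →
      y + r * (a + b + c : ℕ) ≡ X [ZMOD 4 * (a + b + c : ℕ)] := fun {X y} h => by
    have := h.symm.add_right (r * (a + b + c : ℕ))
    rwa [sub_add_cancel] at this
  refine ⟨pavingIso N, (fplEquivNormal hn r (back hA') (back hB') (back hC')).trans
    (normalEquiv N), (pictureEquiv a b c).symm, isDominoFace_iff_isHexFace N,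
    fun F p q hpq => ?_, fun M u v => ?_⟩
  · exact normalEquiv_adj N (fplEquivNormal hn r (back hA') (back hB') (back hC') F) p q hpq
  · have := pictureEquiv_adj ((pictureEquiv a b c).symm M) u v
    rwa [Equiv.apply_symm_apply] at this

theorem ExplicitBijection.nonempty_equiv {n : ℕ} {A B C : ℤ}
    (h : ExplicitBijection n A B C a b c) :
    Nonempty (FPLOfType n A B C a b c ≃ PlanePartition a b c) := by
  obtain ⟨-, Θ, Λ, -⟩ := h
  exact ⟨Θ.trans Λ⟩

/-! ### Permutations of the three centres -/

/-- Deduced from the symmetry of MacMahon's formula, by counting two finite sets. -/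
theorem nonempty_planePartition_equiv_swap_left (a b c : ℕ) :
    Nonempty (PlanePartition a b c ≃ PlanePartition b a c) := by
  have := finite_planePartition a b c
  have := finite_planePartition b a c
  rw [← Finite.card_eq, ← Nat.cast_inj (R := ℚ), card_planePartition, card_planePartition,
    Finset.prod_comm]
  simp only [add_comm (_ : ℚ)]

theorem nonempty_planePartition_equiv_swap_right (a b c : ℕ) :
    Nonempty (PlanePartition a b c ≃ PlanePartition a c b) := by
  have := finite_planePartition a b c
  have := finite_planePartition a c b
  rw [← Finite.card_eq, ← Nat.cast_inj (R := ℚ), card_planePartition, card_planePartition]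
  refine Finset.prod_congr rfl fun i _ => ?_
  rw [Finset.prod_comm]
  simp only [add_right_comm (_ : ℚ)]

theorem nonempty_equiv_swap_left {n : ℕ} {A B C : ℤ}
    (h : Nonempty (FPLOfType n A B C a b c ≃ PlanePartition a b c)) :
    Nonempty (FPLOfType n B A C b a c ≃ PlanePartition b a c) := by
  obtain ⟨e⟩ := h
  obtain ⟨f⟩ := nonempty_planePartition_equiv_swap_left a b c
  exact ⟨((Equiv.subtypeEquivRight fun G => by tauto).trans e).trans f⟩

theorem nonempty_equiv_swap_right {n : ℕ} {A B C : ℤ}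
    (h : Nonempty (FPLOfType n A B C a b c ≃ PlanePartition a b c)) :
    Nonempty (FPLOfType n A C B a c b ≃ PlanePartition a c b) := by
  obtain ⟨e⟩ := h
  obtain ⟨f⟩ := nonempty_planePartition_equiv_swap_right a b c
  exact ⟨((Equiv.subtypeEquivRight fun G => by tauto).trans e).trans f⟩

/-- Rotating the names cyclically brings the distinguished centre to the place of `C` in the
explicit bijection; the type of a configuration does not depend on the order of the three bundles,
and swaps restore the names. -/
theorem CounterclockwiseCentres.nonempty_equiv {n : ℕ} {X Y Z : ℤ} {x y z : ℕ} (hx : 0 < x)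
    (hy : 0 < y) (hz : 0 < z) (hn : x + y + z = n)
    (h : CounterclockwiseCentres n X Y Z x y z) :
    Nonempty (FPLOfType n Z Y X z y x ≃ PlanePartition z y x) := by
  have hY := h.rotate hn
  have hZ := hY.rotate (by omega)
  rcases h.existsUnique_inCone hx hy hz hn with ⟨g, -⟩ | ⟨-, g, -⟩ | ⟨-, -, g⟩
  · exact (explicitBijection hz hy hx (by omega) g.2 g.1 h).nonempty_equiv
  · have h1 := (explicitBijection hx hz hy (by omega) g.1 g.2 hY).nonempty_equiv
    have h2 := nonempty_equiv_swap_left h1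
    exact nonempty_equiv_swap_right h2
  · have h1 := (explicitBijection hy hx hz (by omega) g.2 g.1 hZ).nonempty_equiv
    have h2 := nonempty_equiv_swap_right h1
    exact nonempty_equiv_swap_left h2

theorem AreCentres.nonempty_equiv {n : ℕ} {A B C : ℤ} (ha : 0 < a) (hb : 0 < b) (hc : 0 < c)
    (hn : a + b + c = n) (h : AreCentres n A B C a b c) :
    Nonempty (FPLOfType n A B C a b c ≃ PlanePartition a b c) := by
  rcases h with h | h
  · exact nonempty_equiv_swap_left (nonempty_equiv_swap_right (nonempty_equiv_swap_left
      (h.nonempty_equiv ha hb hc hn)))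
  · exact h.nonempty_equiv hc hb ha (by omega)

theorem AreCentres.existsUnique_inCone {n : ℕ} {A B C : ℤ} (ha : 0 < a) (hb : 0 < b) (hc : 0 < c)
    (hn : a + b + c = n) (h : AreCentres n A B C a b c) :
    ∃! i : Fin 3, ∀ j : Fin 3, InCone n (![A, B, C] i) (![A, B, C] j) := by
  have key : (InCone n A B ∧ InCone n A C) ∧ ¬ (InCone n B A ∧ InCone n B C) ∧
        ¬ (InCone n C A ∧ InCone n C B) ∨
      ¬ (InCone n A B ∧ InCone n A C) ∧ (InCone n B A ∧ InCone n B C) ∧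
        ¬ (InCone n C A ∧ InCone n C B) ∨
      ¬ (InCone n A B ∧ InCone n A C) ∧ ¬ (InCone n B A ∧ InCone n B C) ∧
        (InCone n C A ∧ InCone n C B) := by
    rcases h with h | h
    · exact h.existsUnique_inCone ha hb hc hn
    · have := h.existsUnique_inCone hc hb ha (by omega)
      generalize InCone n A B = p₁, InCone n A C = p₂, InCone n B A = p₃, InCone n B C = p₄,
        InCone n C A = p₅, InCone n C B = p₆ at this ⊢
      tauto
  have hself := inCone_self (n := n) (by omega)
  have e : ∀ i : Fin 3, (∀ j : Fin 3, InCone n (![A, B, C] i) (![A, B, C] j)) ↔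
      ![InCone n A B ∧ InCone n A C, InCone n B A ∧ InCone n B C,
        InCone n C A ∧ InCone n C B] i := by
    intro i
    rw [Fin.forall_fin_succ, Fin.forall_fin_two]
    fin_cases i <;> simp [hself]
  simp only [e]
  rcases key with ⟨h1, h2, h3⟩ | ⟨h1, h2, h3⟩ | ⟨h1, h2, h3⟩
  · exact ⟨0, h1, fun i hi => by fin_cases i <;> first | rfl | exact absurd hi h2 | exact absurd hi h3⟩
  · exact ⟨1, h2, fun i hi => by fin_cases i <;> first | rfl | exact absurd hi h1 | exact absurd hi h3⟩
  · exact ⟨2, h3, fun i hi => by fin_cases i <;> first | rfl | exact absurd hi h1 | exact absurd hi h2⟩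

end FullyPackedLoops

theorem mainTheorem1 (n a b c : ℕ) (ha : 0 < a) (hb : 0 < b) (hc : 0 < c) (hn : a + b + c = n)
    (A B C : ℤ) (hABC : FullyPackedLoops.AreCentres n A B C a b c) :
    -- a bijection between FPL configurations of type `(A, B, C)` and plane partitions
    Nonempty (FullyPackedLoops.FPLOfType n A B C a b c ≃
      FullyPackedLoops.PlanePartition a b c) ∧
    -- the construction: exactly one of the three centres has a cone containing the other two
    (∃! i : Fin 3, ∀ j : Fin 3, FullyPackedLoops.InCone n (![A, B, C] i) (![A, B, C] j)) ∧
    -- the construction: the explicit form of the bijection, when `A`, `B`, `C` are labelled so that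
    -- this centre is `C` and `C`, `B`, `A` follow one another counterclockwise
    (FullyPackedLoops.InCone n C A → FullyPackedLoops.InCone n C B →
      FullyPackedLoops.CounterclockwiseCentres n C B A c b a →
      FullyPackedLoops.ExplicitBijection n A B C a b c) ∧
    -- the enumeration by MacMahon's formula
    (Nat.card (FullyPackedLoops.FPLOfType n A B C a b c) : ℚ) =
      ∏ i ∈ Finset.Icc 1 a, ∏ j ∈ Finset.Icc 1 b, ∏ k ∈ Finset.Icc 1 c,
        ((i : ℚ) + j + k - 1) / ((i : ℚ) + j + k - 2) := by
  have hequiv := hABC.nonempty_equiv ha hb hc hn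
  refine ⟨hequiv, hABC.existsUnique_inCone ha hb hc hn,
    FullyPackedLoops.explicitBijection ha hb hc hn, ?_⟩
  obtain ⟨e⟩ := hequiv
  rw [Nat.card_congr e, FullyPackedLoops.card_planePartition]
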